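/- **Setting.** Let $k\ge 1$. A *standardized radial density* is a measurable function $f_1:(0,\infty)\to[0,\infty)$, a.e. strictly positive, with $\mu_{k-1;f_1}:=\int_0^\infty r^{k-1}f_1(r)\,dr<\infty$ and $\mu_{k-1;f_1}^{-1}\int_0^1 r^{k-1}f_1(r)\,dr=\tfrac12$. Write $\tilde f_{1k}(r):=\mu_{k-1;f_1}^{-1}r^{k-1}f_1(r)$, $r>0$. For a symmetric $k\times k$ matrix $\mathbf M=(M_{ij})$, let $\operatorname{vech}\mathbf M\in\mathbb R^{k(k+1)/2-1}$ collect the upper-triangular entries of $\mathbf M$ other than $M_{11}$. Let $\Theta$ be the set of $\boldsymbol\vartheta=(\boldsymbol\theta',\sigma^2,(\operatorname{vech}\mathbf V)')'\in\mathbb R^{k+k(k+1)/2}$ with $\boldsymbol\theta\in\mathbb R^k$, $\sigma^2>0$ and $\mathbf V$ symmetric positive definite with $V_{11}=1$; $\sigma:=\sqrt{\sigma^2}$. Let $P^{(n)}_{\boldsymbol\vartheta;f_1}$ be the joint law of $n$ i.i.d. $\mathbb R^k$-valued observations $\mathbf X_1,\dots,\mathbf X_n$ with density $$\underline f_{\boldsymbol\vartheta;f_1}(\mathbf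 x)=c_{k,f_1}\,\frac{1}{\sigma^k|\mathbf V|^{1/2}}\,f_1\!\Big(\tfrac1\sigma\big((\mathbf x-\boldsymbol\theta)'\mathbf V^{-1}(\mathbf x-\boldsymbol\theta)\big)^{1/2}\Big),$$ where $c_{k,f_1}$ is the normalizing constant. Let $\mathbf Z_i:=\mathbf V^{-1/2}(\mathbf X_i-\boldsymbol\theta)$ (symmetric square root), $d_i:=\|\mathbf Z_i\|$, $\mathbf U_i:=\mathbf Z_i/d_i$. For an open set $\Omega\subset\mathbb R$ and a measure $\lambda$ on $\Omega$, $W^{1,2}(\Omega,\lambda)$ is the set of $g\in L^2(\Omega,\lambda)$ that have a weak derivative on $\Omega$ (that is, a locally integrable $T$ with $\int_\Omega g\varphi'\,dx=-\int_\Omega T\varphi\,dx$ for all $\varphi\in C_c^\infty(\Omega)$) which belongs to $L^2(\Omega,\lambda)$. Assume: * **(A1)** $f_1^{1/2}\in W^{1,2}\big((0,\infty),x^{k-1}dx\big)$; * **(A2)** $f_{1;\exp}^{1/2}:x\mapsto f_1^{1/2}(e^x)$ is in $W^{1,2}(\mathbb R,e^{kx}dx)$. With $'$ denoting weak derivatives,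 put $$\varphi_{f_1}(r):=-2\frac{(f_1^{1/2})'(r)}{f_1^{1/2}(r)},\qquad \psi_{f_1}(r):=-2r^{-1}\frac{(f_{1;\exp}^{1/2})'(\ln r)}{f_{1;\exp}^{1/2}(\ln r)},$$ $$\mathcal I_k(f_1):=\int_0^\infty\varphi_{f_1}^2(r)\tilde f_{1k}(r)\,dr,\qquad \mathcal J_k(f_1):=\int_0^\infty\psi_{f_1}^2(r)\,r^2\tilde f_{1k}(r)\,dr.$$ Let $\mathbf V^{\otimes2}:=\mathbf V\otimes\mathbf V$, $\mathbf K_k:=\sum_{i,j}(\mathbf e_i\mathbf e_j')\otimes(\mathbf e_j\mathbf e_i')$, $\mathbf J_k:=\sum_{i,j}(\mathbf e_i\mathbf e_j')\otimes(\mathbf e_i\mathbf e_j')$, and let $\mathbf M_k$ be the $(k(k+1)/2-1)\times k^2$ matrix with $\mathbf M_k'\operatorname{vech}\mathbf v=\operatorname{vec}\mathbf v$ for every symmetric $\mathbf v$ with $v_{11}=0$. Define $$\boldsymbol\Delta^{(n)}_{f_1}(\boldsymbol\vartheta):=\begin{pmatrix} n^{-1/2}\frac1\sigma\sum_{i=1}^n\varphi_{f_1}\big(\frac{d_i}\sigma\big)\mathbf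 V^{-1/2}\mathbf U_i\\[4pt] \frac12n^{-1/2}\begin{pmatrix}\sigma^{-2}(\operatorname{vec}\mathbf I_k)'\\ \mathbf M_k(\mathbf V^{\otimes2})^{-1/2}\end{pmatrix}\sum_{i=1}^n\operatorname{vec}\Big(\psi_{f_1}\big(\frac{d_i}\sigma\big)\frac{d_i}\sigma\mathbf U_i\mathbf U_i'-\mathbf I_k\Big)\end{pmatrix},$$ $$\boldsymbol\Gamma_{f_1}(\boldsymbol\vartheta):=\begin{pmatrix}\boldsymbol\Gamma_{11}&\mathbf 0&\mathbf 0\\ \mathbf 0&\Gamma_{22}&\boldsymbol\Gamma_{32}'\\ \mathbf 0&\boldsymbol\Gamma_{32}&\boldsymbol\Gamma_{33}\end{pmatrix},$$ where $$\boldsymbol\Gamma_{11}=\frac{\mathcal I_k(f_1)}{k\sigma^2}\mathbf V^{-1},\quad \Gamma_{22}=\frac{\mathcal J_k(f_1)-k^2}{4\sigma^4},\quad \boldsymbol\Gamma_{32}=\frac{\mathcal J_k(f_1)-k^2}{4k\sigma^2}\mathbf M_k\operatorname{vec}(\mathbf V^{-1}),$$ $$\boldsymbol\Gamma_{33}=\frac14\mathbf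 M_k(\mathbf V^{\otimes2})^{-1/2}\Big[\frac{\mathcal J_k(f_1)}{k(k+2)}(\mathbf I_{k^2}+\mathbf K_k+\mathbf J_k)-\mathbf J_k\Big](\mathbf V^{\otimes2})^{-1/2}\mathbf M_k'.$$ **Proposition.** Let $f_1$ be a standardized radial density satisfying (A1) and (A2). Then the family $\{P^{(n)}_{\boldsymbol\vartheta;f_1}\mid\boldsymbol\vartheta\in\Theta\}$ is uniformly locally asymptotically normal with central sequence $\boldsymbol\Delta^{(n)}_{f_1}(\boldsymbol\vartheta)$ and full-rank information matrix $\boldsymbol\Gamma_{f_1}(\boldsymbol\vartheta)$. That is, for every $\boldsymbol\vartheta\in\Theta$, the matrix $\boldsymbol\Gamma_{f_1}(\boldsymbol\vartheta)$ is positive definite and, for every sequence $\boldsymbol\vartheta^{(n)}\in\Theta$ with $\boldsymbol\vartheta^{(n)}=\boldsymbol\vartheta+O(n^{-1/2})$ and every bounded sequence $\boldsymbol\tau^{(n)}$ in $\mathbb R^{k+k(k+1)/2}$, $$\log\frac{dP^{(n)}_{\boldsymbol\vartheta^{(n)}+n^{-1/2}\boldsymbol\tau^{(n)};f_1}}{dP^{(n)}_{\boldsymbol\vartheta^{(n)};f_1}}=(\boldsymbol\tau^{(n)})'\boldsymbol\Delta^{(n)}_{f_1}(\boldsymbol\vartheta^{(n)})-\frac12(\boldsymbol\tau^{(n)})'\boldsymbol\Gamma_{f_1}(\boldsymbol\vartheta)\boldsymbol\tau^{(n)}+o_{P}(1)$$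 and $$\boldsymbol\Delta^{(n)}_{f_1}(\boldsymbol\vartheta^{(n)})\xrightarrow{\ \mathcal L\ }\mathcal N\big(\mathbf 0,\boldsymbol\Gamma_{f_1}(\boldsymbol\vartheta)\big)$$ under $P^{(n)}_{\boldsymbol\vartheta^{(n)};f_1}$, as $n\to\infty$. (For $n$ large enough, $\boldsymbol\vartheta^{(n)}+n^{-1/2}\boldsymbol\tau^{(n)}\in\Theta$, so the log-likelihood ratio is well defined.) -/

import Mathlib

open MeasureTheory ProbabilityTheory Filter Set Topology
open scoped Matrix Kronecker

noncomputable section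

namespace EllipticalULAN

/-! ### Weak derivatives and weighted Sobolev spaces on open subsets of the real line -/

/-- `T` is a weak derivative of `g` on the open set `Ω ⊆ ℝ`: both are locally integrable on `Ω` and
`∫_Ω g φ' = - ∫_Ω T φ` for every smooth `φ` with compact support contained in `Ω`. -/
def IsWeakDeriv (Ω : Set ℝ) (g T : ℝ → ℝ) : Prop :=
  LocallyIntegrableOn g Ω ∧ LocallyIntegrableOn T Ω ∧
    ∀ φ : ℝ → ℝ, ContDiff ℝ (⊤ : ℕ∞) φ → HasCompactSupport φ → tsupport φ ⊆ Ω →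
      ∫ x in Ω, g x * deriv φ x = -∫ x in Ω, T x * φ x

open Classical in
/-- A version of the weak derivative of `g` on `Ω` (it is unique up to a null set), and `0` if `g`
has no weak derivative on `Ω`. -/
def weakDeriv (Ω : Set ℝ) (g : ℝ → ℝ) : ℝ → ℝ :=
  if h : ∃ T, IsWeakDeriv Ω g T then h.choose else 0

/-- The Sobolev space `W^{1,2}(Ω, lam)`: `g` is in `L²(Ω, lam)` and has a weak derivative on `Ω`
which is in `L²(Ω, lam)`. -/
def MemW12 (Ω : Set ℝ) (lam : Measure ℝ) (g : ℝ → ℝ) : Prop :=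
  MemLp g 2 (lam.restrict Ω) ∧ ∃ T, IsWeakDeriv Ω g T ∧ MemLp T 2 (lam.restrict Ω)

/-- The measure with weight `x ^ l` on `(0, ∞)`. -/
def powWeight (l : ℕ) : Measure ℝ :=
  (volume.restrict (Ioi 0)).withDensity fun x => ENNReal.ofReal (x ^ l)

/-- The measure with weight `e ^ (l x)` on `ℝ`. -/
def expWeight (l : ℕ) : Measure ℝ :=
  volume.withDensity fun x => ENNReal.ofReal (Real.exp (l * x))

/-! ### Radial densities

A radial density is a function on `(0, ∞)`; it is represented by a function on `ℝ` of which only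
the values on `(0, ∞)` matter. -/

/-- `μ_{k-1; f}`, the integral of `r ^ (k-1) f(r)` over `(0, ∞)`. -/
def radialMass (k : ℕ) (f : ℝ → ℝ) : ℝ := ∫ r in Ioi 0, r ^ (k - 1) * f r

/-- Standardized radial densities in dimension `k`. -/
structure IsStandardizedRadialDensity (k : ℕ) (f : ℝ → ℝ) : Prop where
  measurable : Measurable f
  nonneg : ∀ r, 0 < r → 0 ≤ f r
  ae_pos : ∀ᵐ r ∂(volume.restrict (Ioi 0)), 0 < f r
  integrable : IntegrableOn (fun r => r ^ (k - 1) * f r) (Ioi 0)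
  median : (radialMass k f)⁻¹ * ∫ r in Ioc 0 1, r ^ (k - 1) * f r = 1 / 2

/-- The function `f^{1/2}`. -/
def sqrtDensity (f : ℝ → ℝ) (r : ℝ) : ℝ := √(f r)

/-- The function `x ↦ f^{1/2}(e^x)`. -/
def sqrtDensityExp (f : ℝ → ℝ) (x : ℝ) : ℝ := √(f (Real.exp x))

/-- The location regularity condition: `f^{1/2}` is in `W^{1,2}((0, ∞), x^{k-1} dx)`. -/
def AssumptionA1 (k : ℕ) (f : ℝ → ℝ) : Prop :=
  MemW12 (Ioi 0) (powWeight (k - 1)) (sqrtDensity f)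

/-- The shape regularity condition: `x ↦ f^{1/2}(e^x)` is in `W^{1,2}(ℝ, e^{kx} dx)`. -/
def AssumptionA2 (k : ℕ) (f : ℝ → ℝ) : Prop :=
  MemW12 univ (expWeight k) (sqrtDensityExp f)

/-- The location score `φ_f = -2 (f^{1/2})' / f^{1/2}`. -/
def locScore (f : ℝ → ℝ) (r : ℝ) : ℝ :=
  -2 * weakDeriv (Ioi 0) (sqrtDensity f) r / sqrtDensity f r

/-- The shape score `ψ_f(r) = -2 r⁻¹ (f_exp^{1/2})'(ln r) / f_exp^{1/2}(ln r)`. -/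
def shapeScore (f : ℝ → ℝ) (r : ℝ) : ℝ :=
  -2 * r⁻¹ * weakDeriv univ (sqrtDensityExp f) (Real.log r) / sqrtDensityExp f (Real.log r)

/-- The probability density of the standardized modulus `d / σ` on `(0, ∞)`. -/
def modulusDensity (k : ℕ) (f : ℝ → ℝ) (r : ℝ) : ℝ := (radialMass k f)⁻¹ * (r ^ (k - 1) * f r)

/-- Radial Fisher information for location, `𝓘_k(f) = E[φ_f(R)²]` where `R = d / σ`. -/
def locInfo (k : ℕ) (f : ℝ → ℝ) : ℝ := ∫ r in Ioi 0, locScore f r ^ 2 * modulusDensity k f r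

/-- Radial Fisher information for shape, `𝓙_k(f) = E[ψ_f(R)² R²]` where `R = d / σ`. -/
def shapeInfo (k : ℕ) (f : ℝ → ℝ) : ℝ :=
  ∫ r in Ioi 0, shapeScore f r ^ 2 * r ^ 2 * modulusDensity k f r

/-! ### Parameters -/

/-- Positions of the upper-triangular entries of a `k × k` matrix other than the corner entry. -/
abbrev VechIdx (k : ℕ) [NeZero k] : Type :=
  {p : Fin k × Fin k // p.1 ≤ p.2 ∧ p ≠ (0, 0)}

/-- Coordinates of `(θ, σ², vech V)`: there are `k + k (k + 1) / 2` of them. -/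
abbrev ParamIdx (k : ℕ) [NeZero k] : Type := Fin k ⊕ Unit ⊕ VechIdx k

/-- The space `ℝ^{k + k (k + 1) / 2}`. -/
abbrev Param (k : ℕ) [NeZero k] : Type := EuclideanSpace ℝ (ParamIdx k)

variable {k : ℕ} [NeZero k]

/-- The symmetric matrix with corner entry `c` and the other upper-triangular entries `w`. -/
def unvech (c : ℝ) (w : VechIdx k → ℝ) : Matrix (Fin k) (Fin k) ℝ :=
  Matrix.of fun i j =>
    if h : (i, j) = (0, 0) then c
    else w ⟨(min i j, max i j), min_le_max, fun h0 => h <| by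
      have h1 : max i j = 0 := (Prod.ext_iff.1 h0).2
      have hi : i ≤ 0 := h1 ▸ le_max_left i j
      have hj : j ≤ 0 := h1 ▸ le_max_right i j
      exact Prod.ext (nonpos_iff_eq_zero.1 hi) (nonpos_iff_eq_zero.1 hj)⟩

/-- The location parameter `θ`. -/
def location (ϑ : Param k) : EuclideanSpace ℝ (Fin k) := WithLp.toLp 2 fun i => ϑ (Sum.inl i)

/-- The squared scale parameter `σ²`. -/
def scaleSq (ϑ : Param k) : ℝ := ϑ (Sum.inr (Sum.inl ()))

/-- The scale parameter `σ`. -/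
def scale (ϑ : Param k) : ℝ := √(scaleSq ϑ)

/-- The shape parameter `V`, a symmetric matrix with `V₁₁ = 1`. -/
def shape (ϑ : Param k) : Matrix (Fin k) (Fin k) ℝ := unvech 1 fun p => ϑ (Sum.inr (Sum.inr p))

/-- The parameter space: `σ² > 0` and `V` is positive definite. -/
def paramSpace (k : ℕ) [NeZero k] : Set (Param k) := {ϑ | 0 < scaleSq ϑ ∧ (shape ϑ).PosDef}

/-! ### The elliptical family -/

/-- The normalization factor `c_{k, f}`. -/
def normConst (k : ℕ) (f : ℝ → ℝ) : ℝ := (∫ x : EuclideanSpace ℝ (Fin k), f ‖x‖)⁻¹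

/-- The elliptical density with parameter `ϑ = (θ, σ², vech V)` and radial density `f`. -/
def ellipticalDensity (f : ℝ → ℝ) (ϑ : Param k) (x : EuclideanSpace ℝ (Fin k)) : ℝ :=
  normConst k f * (1 / (scale ϑ ^ k * √(shape ϑ).det)) *
    f (1 / scale ϑ * √((x - location ϑ).ofLp ⬝ᵥ ((shape ϑ)⁻¹ *ᵥ (x - location ϑ).ofLp)))

/-- The law of one observation. -/
def ellipticalLaw (f : ℝ → ℝ) (ϑ : Param k) : Measure (EuclideanSpace ℝ (Fin k)) :=
  volume.withDensity fun x => ENNReal.ofReal (ellipticalDensity f ϑ x)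

/-- The joint law `P^{(n)}_{ϑ; f}` of `n` i.i.d. observations `X₁, …, Xₙ`. -/
def sampleLaw (f : ℝ → ℝ) (n : ℕ) (ϑ : Param k) : Measure (Fin n → EuclideanSpace ℝ (Fin k)) :=
  Measure.pi fun _ => ellipticalLaw f ϑ

/-! ### Central sequence and information matrix -/

open scoped MatrixOrder in
/-- `A^{-1/2}`, the inverse of the symmetric positive semidefinite square root of `A`. -/
def invSqrt {ι : Type*} [Fintype ι] [DecidableEq ι] (A : Matrix ι ι ℝ) : Matrix ι ι ℝ :=
  (CFC.sqrt A)⁻¹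

/-- The commutation matrix `K_k = ∑ (e_i e_j') ⊗ (e_j e_i')`. -/
def commMat (k : ℕ) : Matrix (Fin k × Fin k) (Fin k × Fin k) ℝ :=
  ∑ i, ∑ j, Matrix.single i j 1 ⊗ₖ Matrix.single j i 1

/-- The matrix `J_k = ∑ (e_i e_j') ⊗ (e_i e_j')`. -/
def jMat (k : ℕ) : Matrix (Fin k × Fin k) (Fin k × Fin k) ℝ :=
  ∑ i, ∑ j, Matrix.single i j 1 ⊗ₖ Matrix.single i j 1

/-- The matrix `M_k`, characterized by `M_k' (vech v) = vec v` for every symmetric matrix `v` with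
`v₁₁ = 0`. -/
def dupMat (k : ℕ) [NeZero k] : Matrix (VechIdx k) (Fin k × Fin k) ℝ :=
  Matrix.of fun p q => if q = p.1 ∨ q = p.1.swap then 1 else 0

theorem dupMat_transpose_mulVec (w : VechIdx k → ℝ) :
    (dupMat k)ᵀ *ᵥ w = Matrix.vec (unvech 0 w) := by
  funext q
  obtain ⟨i, j⟩ := q
  simp only [Matrix.mulVec, dotProduct, Matrix.transpose_apply, dupMat, Matrix.of_apply,
    Matrix.vec, unvech, ite_mul, one_mul, zero_mul]
  split_ifs with h
  · refine Finset.sum_eq_zero fun p _ => if_neg ?_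
    obtain ⟨⟨a, b⟩, hab, hne⟩ := p
    simp only [Prod.mk.injEq, Prod.swap_prod_mk, ne_eq] at h hne ⊢
    obtain ⟨rfl, rfl⟩ := h
    rintro (⟨rfl, rfl⟩ | ⟨rfl, rfl⟩) <;> simp at hne
  · rw [Finset.sum_eq_single_of_mem _ (Finset.mem_univ _), if_pos]
    · rcases le_total i j with hij | hij
      · left; simp [hij]
      · right; simp [hij]
    · rintro ⟨⟨a, b⟩, hab, hne⟩ _ hp
      refine if_neg fun hq => hp ?_
      simp only [Prod.mk.injEq, Prod.swap_prod_mk] at hq hab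
      refine Subtype.ext ?_
      rcases hq with ⟨rfl, rfl⟩ | ⟨rfl, rfl⟩ <;> simp [hab]

/-- The sphericized observation `Z(θ, V) = V^{-1/2} (x - θ)`. -/
def sphericized (ϑ : Param k) (x : EuclideanSpace ℝ (Fin k)) : EuclideanSpace ℝ (Fin k) :=
  WithLp.toLp 2 (invSqrt (shape ϑ) *ᵥ (x - location ϑ).ofLp)

/-- The modulus `d(θ, V) = ‖Z(θ, V)‖`. -/
def modulus (ϑ : Param k) (x : EuclideanSpace ℝ (Fin k)) : ℝ := ‖sphericized ϑ x‖

/-- The multivariate sign `U(θ, V) = Z(θ, V) / d(θ, V)`. -/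
def msign (ϑ : Param k) (x : EuclideanSpace ℝ (Fin k)) : Fin k → ℝ :=
  ((modulus ϑ x)⁻¹ • sphericized ϑ x).ofLp

/-- The sum over the sample of `vec (ψ_f(d_i/σ) (d_i/σ) U_i U_i' - I_k)`. -/
def scatterSum (f : ℝ → ℝ) (n : ℕ) (ϑ : Param k) (X : Fin n → EuclideanSpace ℝ (Fin k)) :
    Fin k × Fin k → ℝ :=
  ∑ i, Matrix.vec
    ((shapeScore f (modulus ϑ (X i) / scale ϑ) * (modulus ϑ (X i) / scale ϑ)) •
      Matrix.vecMulVec (msign ϑ (X i)) (msign ϑ (X i)) - 1)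

/-- The location part of the central sequence. -/
def central1 (f : ℝ → ℝ) (n : ℕ) (ϑ : Param k) (X : Fin n → EuclideanSpace ℝ (Fin k)) :
    Fin k → ℝ :=
  ((√n)⁻¹ * (1 / scale ϑ)) •
    ∑ i, locScore f (modulus ϑ (X i) / scale ϑ) • (invSqrt (shape ϑ) *ᵥ msign ϑ (X i))

/-- The scale part of the central sequence. -/
def central2 (f : ℝ → ℝ) (n : ℕ) (ϑ : Param k) (X : Fin n → EuclideanSpace ℝ (Fin k)) : ℝ :=
  1 / 2 * (√n)⁻¹ * ((scaleSq ϑ)⁻¹ *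
    (Matrix.vec (1 : Matrix (Fin k) (Fin k) ℝ) ⬝ᵥ scatterSum f n ϑ X))

/-- The shape part of the central sequence. -/
def central3 (f : ℝ → ℝ) (n : ℕ) (ϑ : Param k) (X : Fin n → EuclideanSpace ℝ (Fin k)) :
    VechIdx k → ℝ :=
  (1 / 2 * (√n)⁻¹) •
    ((dupMat k * invSqrt (shape ϑ ⊗ₖ shape ϑ)) *ᵥ scatterSum f n ϑ X)

/-- The central sequence `Δ_f^{(n)}(ϑ)`. -/
def centralSeq (f : ℝ → ℝ) (n : ℕ) (ϑ : Param k) (X : Fin n → EuclideanSpace ℝ (Fin k)) :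
    Param k :=
  WithLp.toLp 2 (Sum.elim (central1 f n ϑ X)
    (Sum.elim (fun _ => central2 f n ϑ X) (central3 f n ϑ X)))

/-- The location block of the information matrix. -/
def info11 (f : ℝ → ℝ) (ϑ : Param k) : Matrix (Fin k) (Fin k) ℝ :=
  (1 / (k * scaleSq ϑ) * locInfo k f) • (shape ϑ)⁻¹

/-- The scale block of the information matrix. -/
def info22 (f : ℝ → ℝ) (ϑ : Param k) : Matrix Unit Unit ℝ :=
  Matrix.of fun _ _ => 1 / (4 * scaleSq ϑ ^ 2) * (shapeInfo k f - k ^ 2)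

/-- The shape-scale block of the information matrix. -/
def info32 (f : ℝ → ℝ) (ϑ : Param k) : Matrix (VechIdx k) Unit ℝ :=
  Matrix.of fun p _ => 1 / (4 * k * scaleSq ϑ) * (shapeInfo k f - k ^ 2) *
    (dupMat k *ᵥ Matrix.vec (shape ϑ)⁻¹) p

/-- The shape block of the information matrix. -/
def info33 (f : ℝ → ℝ) (ϑ : Param k) : Matrix (VechIdx k) (VechIdx k) ℝ :=
  (1 / 4 : ℝ) • (dupMat k * invSqrt (shape ϑ ⊗ₖ shape ϑ) *
    ((shapeInfo k f / (k * (k + 2))) • (1 + commMat k + jMat k) - jMat k) *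
    invSqrt (shape ϑ ⊗ₖ shape ϑ) * (dupMat k)ᵀ)

/-- The information matrix `Γ_f(ϑ)`. -/
def infoMat (f : ℝ → ℝ) (ϑ : Param k) : Matrix (ParamIdx k) (ParamIdx k) ℝ :=
  Matrix.fromBlocks (info11 f ϑ) 0 0
    (Matrix.fromBlocks (info22 f ϑ) (info32 f ϑ)ᵀ (info32 f ϑ) (info33 f ϑ))

end EllipticalULAN

end

open EllipticalULAN

/-!
The elliptical laws are the images of one spherical law under affine maps, so a change of parameter
acts on a standardized observation `y` as an affine deformation `y ↦ y + (A y - b)` with symmetric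
linear part, and only deformations of the root `η ‖y‖` of the spherical density matter, where `η` is
the square root of the radial density.

By the du Bois-Reymond lemma `η` has an absolutely continuous version with derivative `T`
(`exists_isRegularRoot`); the chain rule under `r = exp x` shows that both scores are `-2 T / η`.
The modulus of a point moving along a segment first decreases and then increases, and almost no
segment hits the origin in dimension at least two, so the fundamental theorem of calculus holds for
`η ‖·‖` along almost every segment joining a point to its deformed image. Averaging over these
segments and using that deformations act continuously on `L²` gives differentiability in quadratic
mean (`IsRegularRoot.eventually_eLpNorm_sub_deformDeriv`). All the deformed roots, multiplied by the
root of their Jacobian, have the same norm in `L²`, so the expansion of the Jacobian factor is that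
of the normalization in a Hilbert space (`IsRegularRoot.tendsto_normalized_deform`); comparing it
with the expansion of the determinant also yields the identity `E[ψ(R) R] = k`.

Differentiability in quadratic mean at rate `n ^ (-1/2)` implies the expansion of the log-likelihood
ratio of an independent sample (`IsSample.vanishesInProb_log_sub`) along any filter finer than
`atTop`. The statement for bounded sequences of directions follows by working along ultrafilters, on
which the directions converge. The asymptotic normality of the central sequence is the central limit
theorem for characteristic functions (`IsSample.tendsto_integral_exp`), applied in every direction.

The scores in the directions of the parameter are identified with those of the central sequence by
`inner_centralSeq` and `IsRadialRoot.standardScore_eq`, and their second moments, computed from the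
second and fourth moments of spherical laws, with the quadratic form of the information matrix by
`dotProduct_infoMat`. This matrix is positive definite because `k ^ 2 < 𝓙_k(f)`: this is the
Cauchy–Schwarz inequality for `E[ψ(R) R] = k`, and equality would make `η` a power of `r`, which is
not square integrable.
-/

noncomputable section

set_option linter.unusedSectionVars false

namespace EllipticalULAN

/-! ### Weak derivatives on intervals -/

section WeakDerivative

variable {Ω : Set ℝ} {g T : ℝ → ℝ}

lemma integrable_mul_of_tsupport_subset (hT : LocallyIntegrableOn T Ω) {φ : ℝ → ℝ}
    (hφ : Continuous φ) (hc : HasCompactSupport φ) (hs : tsupport φ ⊆ Ω) :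
    Integrable fun x => T x * φ x := by
  have h1 : IntegrableOn T (tsupport φ) := hT.integrableOn_compact_subset hs hc
  refine (integrableOn_iff_integrable_of_support_subset (s := tsupport φ) ?_).1
    (h1.mul_continuousOn hφ.continuousOn hc)
  exact fun x hx => subset_tsupport φ (right_ne_zero_of_mul hx)

lemma setIntegral_mul_of_tsupport_subset (T : ℝ → ℝ) {φ : ℝ → ℝ} (hs : tsupport φ ⊆ Ω) :
    ∫ x in Ω, T x * φ x = ∫ x, T x * φ x := by
  refine setIntegral_eq_integral_of_forall_compl_eq_zero fun x hx => ?_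
  rw [image_eq_zero_of_notMem_tsupport fun h => hx (hs h), mul_zero]

/-- A weak derivative is unique up to a null set. -/
lemma IsWeakDeriv.ae_eq (hΩ : IsOpen Ω) {T' : ℝ → ℝ} (h : IsWeakDeriv Ω g T)
    (h' : IsWeakDeriv Ω g T') : T =ᵐ[volume.restrict Ω] T' := by
  have key := hΩ.ae_eq_zero_of_integral_contDiff_smul_eq_zero (μ := volume)
    (f := fun x => T x - T' x) (h.2.1.sub h'.2.1) fun φ hφ hc hs => ?_
  · rw [EventuallyEq, ae_restrict_iff' hΩ.measurableSet]
    filter_upwards [key] with x hx hxΩ using sub_eq_zero.1 (hx hxΩ)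
  · have h1 := h.2.2 φ hφ hc hs
    have h2 := h'.2.2 φ hφ hc hs
    rw [h1, neg_inj, setIntegral_mul_of_tsupport_subset T hs,
      setIntegral_mul_of_tsupport_subset T' hs] at h2
    have e : (fun x => φ x • (T x - T' x)) = fun x => T x * φ x - T' x * φ x := by
      funext x; simp only [smul_eq_mul]; ring
    rw [e, integral_sub (integrable_mul_of_tsupport_subset h.2.1 hφ.continuous hc hs)
      (integrable_mul_of_tsupport_subset h'.2.1 hφ.continuous hc hs), h2, sub_self]

lemma weakDeriv_isWeakDeriv (h : IsWeakDeriv Ω g T) : IsWeakDeriv Ω g (weakDeriv Ω g) := by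
  have h0 : ∃ T, IsWeakDeriv Ω g T := ⟨T, h⟩
  rw [weakDeriv, dif_pos h0]
  exact h0.choose_spec

lemma exists_Ioo_of_isCompact (hΩ : IsOpen Ω) (hoc : OrdConnected Ω) {K : Set ℝ}
    (hK : IsCompact K) (hne : K.Nonempty) (hKΩ : K ⊆ Ω) :
    ∃ p q, p < q ∧ K ⊆ Ioo p q ∧ Icc p q ⊆ Ω := by
  obtain ⟨m, hm, hm'⟩ := hK.exists_isLeast hne
  obtain ⟨M, hM, hM'⟩ := hK.exists_isGreatest hne
  obtain ⟨ε, hε, hb⟩ := Metric.isOpen_iff.1 hΩ m (hKΩ hm)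
  obtain ⟨δ, hδ, hb'⟩ := Metric.isOpen_iff.1 hΩ M (hKΩ hM)
  have h1 : m - ε / 2 ∈ Ω := hb (by
    rw [Metric.mem_ball, Real.dist_eq, abs_lt]; constructor <;> linarith)
  have h2 : M + δ / 2 ∈ Ω := hb' (by
    rw [Metric.mem_ball, Real.dist_eq, abs_lt]; constructor <;> linarith)
  have hmM : m ≤ M := hm' hM
  refine ⟨m - ε / 2, M + δ / 2, by linarith, fun x hx => ⟨?_, ?_⟩, hoc.out h1 h2⟩
  · linarith [hm' hx]
  · linarith [hM' hx]

lemma _root_.MeasureTheory.LocallyIntegrableOn.intervalIntegrable_of_mem (hoc : OrdConnected Ω)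
    (hT : LocallyIntegrableOn T Ω) {a b : ℝ} (ha : a ∈ Ω) (hb : b ∈ Ω) :
    IntervalIntegrable T volume a b :=
  (intervalIntegrable_iff' (by simp)).2
    (hT.integrableOn_compact_subset (hoc.uIcc_subset ha hb) isCompact_uIcc)

/-- The primitive of a locally integrable function has that function as a weak derivative. -/
lemma integral_primitive_mul_deriv (hΩ : IsOpen Ω) (hoc : OrdConnected Ω)
    (hT : LocallyIntegrableOn T Ω) {a : ℝ} (ha : a ∈ Ω) {φ : ℝ → ℝ}
    (hφ : ContDiff ℝ (⊤ : ℕ∞) φ) (hc : HasCompactSupport φ) (hs : tsupport φ ⊆ Ω) :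
    ∫ x in Ω, (∫ t in a..x, T t) * deriv φ x = -∫ x in Ω, T x * φ x := by
  obtain ⟨p, q, hpq, hK, hpqΩ⟩ := exists_Ioo_of_isCompact hΩ hoc (hc.isCompact.insert a)
    (insert_nonempty _ _) (insert_subset ha hs)
  have hKφ : tsupport φ ⊆ Ioo p q := (subset_insert _ _).trans hK
  have hap : a ∈ Ioo p q := hK (mem_insert _ _)
  have hsd : tsupport (deriv φ) ⊆ tsupport φ :=
    closure_minimal (fun x hx => by
      by_contra hx'
      exact hx (deriv_of_notMem_tsupport hx')) (isClosed_tsupport φ)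
  rw [setIntegral_mul_of_tsupport_subset _ (hsd.trans hs), setIntegral_mul_of_tsupport_subset _ hs]
  rw [← intervalIntegral.integral_eq_integral_of_support_subset (a := p) (b := q),
    ← intervalIntegral.integral_eq_integral_of_support_subset (a := p) (b := q)]
  rotate_left
  · exact fun x hx => Ioo_subset_Ioc_self (hKφ (subset_tsupport φ (right_ne_zero_of_mul hx)))
  · exact fun x hx => Ioo_subset_Ioc_self (hKφ (hsd (subset_tsupport _ (right_ne_zero_of_mul hx))))
  have hTi : IntervalIntegrable T volume p q :=
    hT.intervalIntegrable_of_mem hoc (hpqΩ (left_mem_Icc.2 hpq.le)) (hpqΩ (right_mem_Icc.2 hpq.le))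
  have haI : a ∈ uIcc p q := by rw [uIcc_of_le hpq.le]; exact Ioo_subset_Icc_self hap
  rw [(hTi.absolutelyContinuousOnInterval_intervalIntegral haI).integral_mul_deriv_eq_deriv_mul
    (ContDiffOn.absolutelyContinuousOnInterval (hφ.contDiffOn.of_le (by exact_mod_cast le_top)))]
  have hp0 : φ p = 0 := image_eq_zero_of_notMem_tsupport fun h => lt_irrefl _ (hKφ h).1
  have hq0 : φ q = 0 := image_eq_zero_of_notMem_tsupport fun h => lt_irrefl _ (hKφ h).2
  rw [hp0, hq0, mul_zero, mul_zero, sub_zero, zero_sub, neg_inj]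
  refine intervalIntegral.integral_congr_ae ?_
  filter_upwards [hTi.ae_hasDerivAt_integral] with x hx hxI
  rw [(hx (uIoc_subset_uIcc hxI) a haI).deriv]

lemma locallyIntegrableOn_primitive (hΩ : IsOpen Ω) (hoc : OrdConnected Ω)
    (hT : LocallyIntegrableOn T Ω) {a : ℝ} (ha : a ∈ Ω) :
    LocallyIntegrableOn (fun x => ∫ t in a..x, T t) Ω := by
  refine ContinuousOn.locallyIntegrableOn (fun x hx => ContinuousAt.continuousWithinAt ?_)
    hΩ.measurableSet
  obtain ⟨p, q, hpq, hK, hpqΩ⟩ := exists_Ioo_of_isCompact hΩ hoc (isCompact_singleton.insert a)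
    (insert_nonempty a {x}) (insert_subset ha (singleton_subset_iff.2 hx))
  have hTi : IntervalIntegrable T volume p q :=
    hT.intervalIntegrable_of_mem hoc (hpqΩ (left_mem_Icc.2 hpq.le)) (hpqΩ (right_mem_Icc.2 hpq.le))
  have hap := hK (mem_insert a _)
  have hxp := hK (mem_insert_of_mem a (mem_singleton x))
  have := intervalIntegral.continuousOn_primitive_interval' (f := T) (μ := volume) (a := a) hTi
    (by rw [uIcc_of_le hpq.le]; exact Ioo_subset_Icc_self hap)
  rw [uIcc_of_le hpq.le] at this
  exact this.continuousAt (Icc_mem_nhds hxp.1 hxp.2)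

/-- A function with a weak derivative on an open interval is, up to a null set, a constant plus
a primitive of its weak derivative (the du Bois-Reymond lemma). -/
lemma IsWeakDeriv.exists_ae_eq_add_integral (hΩ : IsOpen Ω) (hoc : OrdConnected Ω)
    (h : IsWeakDeriv Ω g T) {a : ℝ} (ha : a ∈ Ω) :
    ∃ c, g =ᵐ[volume.restrict Ω] fun x => c + ∫ t in a..x, T t := by
  set G : ℝ → ℝ := fun x => ∫ t in a..x, T t with hG
  have hGl : LocallyIntegrableOn G Ω := locallyIntegrableOn_primitive hΩ hoc h.2.1 ha
  have hu : LocallyIntegrableOn (fun x => g x - G x) Ω := h.1.sub hGl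
  -- A test function of integral one: modulo a multiple of `χ`, every test function is a derivative.
  obtain ⟨ε, hε, hb⟩ := Metric.isOpen_iff.1 hΩ a ha
  let bump : ContDiffBump a := ⟨ε / 4, ε / 2, by positivity, by linarith⟩
  set χ : ℝ → ℝ := bump.normed volume with hχ
  have hχs : ContDiff ℝ (⊤ : ℕ∞) χ := bump.contDiff_normed
  have hχc : HasCompactSupport χ := bump.hasCompactSupport_normed
  have hχΩ : tsupport χ ⊆ Ω := by
    rw [hχ, bump.tsupport_normed_eq]
    refine (Metric.closedBall_subset_ball ?_).trans hb
    show ε / 2 < ε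
    linarith
  have hχ1 : ∫ x, χ x = 1 := bump.integral_normed
  have horth : ∀ φ : ℝ → ℝ, ContDiff ℝ (⊤ : ℕ∞) φ → HasCompactSupport φ → tsupport φ ⊆ Ω →
      ∫ x, (g x - G x) * φ x = (∫ x, (g x - G x) * χ x) * ∫ x, φ x := by
    intro φ hφ hc hs
    set m := ∫ x, φ x with hm
    set ψ : ℝ → ℝ := fun x => φ x - m * χ x with hψ
    have hψs : ContDiff ℝ (⊤ : ℕ∞) ψ := hφ.sub (contDiff_const.mul hχs)
    have hψc : Continuous ψ := hψs.continuous
    obtain ⟨p, q, hpq, hK, hpqΩ⟩ := exists_Ioo_of_isCompact hΩ hoc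
      ((hc.isCompact.union hχc.isCompact).insert a) (insert_nonempty _ _)
      (insert_subset ha (union_subset hs hχΩ))
    have hψ0 : ∀ x, x ∉ Ioo p q → ψ x = 0 := fun x hx => by
      have h1 : φ x = 0 := image_eq_zero_of_notMem_tsupport fun h =>
        hx (hK (mem_insert_of_mem _ (Or.inl h)))
      have h2 : χ x = 0 := image_eq_zero_of_notMem_tsupport fun h =>
        hx (hK (mem_insert_of_mem _ (Or.inr h)))
      rw [hψ]; simp only [h1, h2]; ring
    have hφi : Integrable φ := hφ.continuous.integrable_of_hasCompactSupport hc
    have hχi : Integrable χ := hχs.continuous.integrable_of_hasCompactSupport hχc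
    have hψi : ∫ x, ψ x = 0 := by
      rw [hψ, integral_sub hφi (hχi.const_mul m), integral_const_mul, hχ1, mul_one, hm, sub_self]
    set Φ : ℝ → ℝ := fun x => ∫ t in p..x, ψ t with hΦ
    have hΦd : ∀ x, HasDerivAt Φ (ψ x) x := fun x =>
      intervalIntegral.integral_hasDerivAt_right (hψc.intervalIntegrable _ _)
        hψc.stronglyMeasurable.stronglyMeasurableAtFilter hψc.continuousAt
    have hΦ' : deriv Φ = ψ := funext fun x => (hΦd x).deriv
    have hΦs : ContDiff ℝ (⊤ : ℕ∞) Φ :=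
      contDiff_infty_iff_deriv.2 ⟨fun x => (hΦd x).differentiableAt, by rw [hΦ']; exact hψs⟩
    have hΦ0 : ∀ x, x ∉ Icc p q → Φ x = 0 := by
      intro x hx
      rcases lt_or_ge x p with hxp | hxp
      · rw [hΦ]; simp only
        rw [intervalIntegral.integral_congr (g := fun _ => 0), intervalIntegral.integral_zero]
        intro t ht
        rw [uIcc_of_ge hxp.le] at ht
        exact hψ0 t fun h => by linarith [h.1, ht.2]
      · have hxq : q < x := by
          by_contra hxq
          exact hx ⟨hxp, not_lt.1 hxq⟩
        rw [hΦ]; simp only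
        rw [intervalIntegral.integral_eq_integral_of_support_subset, hψi]
        intro t ht
        by_contra ht'
        exact ht (hψ0 t fun h => ht' ⟨h.1, h.2.le.trans hxq.le⟩)
    have hΦsub : tsupport Φ ⊆ Icc p q :=
      closure_minimal (fun x hx => by by_contra hx'; exact hx (hΦ0 x hx')) isClosed_Icc
    have hΦc : HasCompactSupport Φ := isCompact_Icc.of_isClosed_subset (isClosed_tsupport _) hΦsub
    have e1 := h.2.2 Φ hΦs hΦc (hΦsub.trans hpqΩ)
    have e2 := integral_primitive_mul_deriv hΩ hoc h.2.1 ha hΦs hΦc (hΦsub.trans hpqΩ)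
    rw [hΦ'] at e1 e2
    have hψsup : tsupport ψ ⊆ Icc p q :=
      closure_minimal (fun x hx => by
        by_contra hx'; exact hx (hψ0 x fun h => hx' (Ioo_subset_Icc_self h))) isClosed_Icc
    have hψcs : HasCompactSupport ψ := isCompact_Icc.of_isClosed_subset (isClosed_tsupport _) hψsup
    rw [← e2, setIntegral_mul_of_tsupport_subset _ (hψsup.trans hpqΩ),
      setIntegral_mul_of_tsupport_subset _ (hψsup.trans hpqΩ)] at e1
    have e3 : ∫ x, (g x - G x) * ψ x = 0 := by
      have : (fun x => (g x - G x) * ψ x) = fun x => g x * ψ x - G x * ψ x := by funext x; ring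
      rw [this, integral_sub
        (integrable_mul_of_tsupport_subset h.1 hψc hψcs (hψsup.trans hpqΩ))
        (integrable_mul_of_tsupport_subset hGl hψc hψcs (hψsup.trans hpqΩ)), e1, sub_self]
    have e4 : (fun x => (g x - G x) * ψ x) =
        fun x => (g x - G x) * φ x - m * ((g x - G x) * χ x) := by
      funext x; rw [hψ]; ring
    rw [e4, integral_sub (integrable_mul_of_tsupport_subset hu hφ.continuous hc hs)
      ((integrable_mul_of_tsupport_subset hu hχs.continuous hχc hχΩ).const_mul m),
      integral_const_mul, sub_eq_zero] at e3
    rw [e3, mul_comm]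
  set c := ∫ x, (g x - G x) * χ x with hcdef
  refine ⟨c, ?_⟩
  have key := hΩ.ae_eq_zero_of_integral_contDiff_smul_eq_zero (μ := volume)
    (f := fun x => (g x - G x) - c) (hu.sub ((locallyIntegrable_const c).locallyIntegrableOn Ω))
    fun φ hφ hc hs => ?_
  · rw [EventuallyEq, ae_restrict_iff' hΩ.measurableSet]
    filter_upwards [key] with x hx hxΩ
    have h0 : g x - G x - c = 0 := hx hxΩ
    show g x = c + G x
    linarith
  · have e : (fun x => φ x • ((g x - G x) - c)) = fun x => (g x - G x) * φ x - c * φ x := by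
      funext x; simp only [smul_eq_mul]; ring
    rw [e, integral_sub (integrable_mul_of_tsupport_subset hu hφ.continuous hc hs)
      ((hφ.continuous.integrable_of_hasCompactSupport hc).const_mul c), integral_const_mul,
      horth φ hφ hc hs, sub_self]

end WeakDerivative

/-! ### The absolutely continuous version of a root density -/

/-- The exponential pulls null sets of `(0, ∞)` back to null sets. -/
lemma ae_comp_exp {p : ℝ → Prop} (h : ∀ᵐ r ∂(volume.restrict (Ioi 0)), p r) :
    ∀ᵐ x, p (Real.exp x) := by
  rw [ae_restrict_iff' measurableSet_Ioi] at h
  have h0 : volume ({r : ℝ | ¬ (r ∈ Ioi (0 : ℝ) → p r)}) = 0 := h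
  have h1 := addHaar_image_eq_zero_of_differentiableOn_of_addHaar_eq_zero volume
    (f := Real.log) (s := {r : ℝ | ¬ (r ∈ Ioi (0 : ℝ) → p r)})
    (fun r hr => by
      have : r ∈ Ioi (0 : ℝ) := by
        by_contra h; exact hr fun h' => absurd h' h
      exact (Real.differentiableAt_log (ne_of_gt this)).differentiableWithinAt) h0
  refine measure_mono_null ?_ h1
  intro x hx
  exact ⟨Real.exp x, fun hp => hx (hp (Real.exp_pos x)), Real.log_exp x⟩

lemma ae_comp_log {p : ℝ → Prop} (h : ∀ᵐ x, p x) :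
    ∀ᵐ r ∂(volume.restrict (Ioi 0)), p (Real.log r) := by
  rw [ae_restrict_iff' measurableSet_Ioi]
  have h1 := addHaar_image_eq_zero_of_differentiableOn_of_addHaar_eq_zero volume
    (f := Real.exp) (s := {x : ℝ | ¬ p x}) Real.differentiable_exp.differentiableOn h
  refine measure_mono_null (fun r hr => ?_) h1
  rw [mem_compl_iff, mem_ofPred_eq, Classical.not_imp] at hr
  exact ⟨Real.log r, hr.2, Real.exp_log hr.1⟩

lemma integrableOn_of_memLp_powWeight {l : ℕ} {g : ℝ → ℝ}
    (h : MemLp g 2 ((powWeight l).restrict (Ioi 0))) :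
    IntegrableOn (fun r => r ^ l * g r ^ 2) (Ioi 0) := by
  have h1 := h.integrable_sq
  rw [powWeight, restrict_withDensity measurableSet_Ioi,
    Measure.restrict_restrict measurableSet_Ioi,
    inter_self, integrable_withDensity_iff_integrable_smul' (by fun_prop) (by simp)] at h1
  refine h1.congr ?_
  filter_upwards [ae_restrict_mem measurableSet_Ioi] with x hx
  rw [ENNReal.toReal_ofReal (pow_nonneg (le_of_lt hx) _), smul_eq_mul]

lemma integrable_of_memLp_expWeight {l : ℕ} {g : ℝ → ℝ}
    (h : MemLp g 2 ((expWeight l).restrict univ)) :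
    Integrable fun x => Real.exp (l * x) * g x ^ 2 := by
  have h1 := h.integrable_sq
  rw [Measure.restrict_univ, expWeight,
    integrable_withDensity_iff_integrable_smul' (by fun_prop) (by simp)] at h1
  refine h1.congr (ae_of_all _ fun x => ?_)
  simp only
  rw [ENNReal.toReal_ofReal (Real.exp_nonneg _), smul_eq_mul]

/-- The radii between which the fundamental theorem of calculus is available for the root of a
radial density in dimension `k`: in dimension one the origin is included. -/
def radii (k : ℕ) : Set ℝ := if k = 1 then Ici 0 else Ioi 0

lemma Ioi_subset_radii (k : ℕ) : Ioi 0 ⊆ radii k := by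
  unfold radii; split_ifs
  · exact Ioi_subset_Ici_self
  · exact Subset.rfl

/-- `η` is an absolutely continuous root of a radial density in dimension `k`, and `T` is its
derivative: `η`, `T` and `r ↦ r T(r)` are square integrable for the weight `r ^ (k - 1)`. -/
structure IsRegularRoot (k : ℕ) (η T : ℝ → ℝ) : Prop where
  measurable : Measurable η
  measurable_deriv : Measurable T
  integrableOn_sq : IntegrableOn (fun r => r ^ (k - 1) * η r ^ 2) (Ioi 0)
  integrableOn_deriv_sq : IntegrableOn (fun r => r ^ (k - 1) * T r ^ 2) (Ioi 0)
  integrableOn_mul_deriv_sq : IntegrableOn (fun r => r ^ (k - 1) * (r * T r) ^ 2) (Ioi 0)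
  intervalIntegrable : ∀ a ∈ radii k, ∀ b ∈ radii k, IntervalIntegrable T volume a b
  integral_eq : ∀ a ∈ radii k, ∀ b ∈ radii k, ∫ t in a..b, T t = η b - η a

lemma integral_deriv_eq_zero {φ : ℝ → ℝ} (hφ : ContDiff ℝ (⊤ : ℕ∞) φ) (hc : HasCompactSupport φ) :
    ∫ x, deriv φ x = 0 := by
  have h1 : Continuous (deriv φ) := hφ.continuous_deriv (by exact_mod_cast le_top)
  exact integral_eq_zero_of_hasDerivAt_of_integrable
    (fun x => (hφ.differentiable (by simp) x).hasDerivAt)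
    (h1.integrable_of_hasCompactSupport hc.deriv)
    (hφ.continuous.integrable_of_hasCompactSupport hc)

/-- The chain rule for weak derivatives under `r = exp x`. -/
lemma IsWeakDeriv.comp_exp {g T : ℝ → ℝ} (h : IsWeakDeriv (Ioi 0) g T)
    (hg : LocallyIntegrableOn (fun x => g (Real.exp x)) univ) :
    IsWeakDeriv univ (fun x => g (Real.exp x)) fun x => Real.exp x * T (Real.exp x) := by
  obtain ⟨c, hc⟩ := h.exists_ae_eq_add_integral isOpen_Ioi ordConnected_Ioi (a := 1)
    (mem_Ioi.2 one_pos)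
  have hint : ∀ a b : ℝ, a ≤ b → IntegrableOn (fun x => Real.exp x * T (Real.exp x)) (Icc a b) := by
    intro a b hab
    refine (integrableOn_Icc_deriv_smul_iff_of_deriv_nonneg (g := T)
      Real.continuous_exp.continuousOn (fun x _ => Real.hasDerivAt_exp x)
      (fun x _ => (Real.exp_pos x).le) hab).2 ?_
    exact h.2.1.integrableOn_compact_subset (fun x hx => (Real.exp_pos a).trans_le hx.1)
      isCompact_Icc
  have hloc : LocallyIntegrableOn (fun x => Real.exp x * T (Real.exp x)) univ := by
    intro x _
    refine ⟨Icc (x - 1) (x + 1), mem_nhdsWithin_of_mem_nhds (Icc_mem_nhds (by linarith)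
      (by linarith)), hint _ _ (by linarith)⟩
  have hcv : ∀ x, ∫ t in (0 : ℝ)..x, Real.exp t * T (Real.exp t)
      = ∫ t in (1 : ℝ)..(Real.exp x), T t := by
    have key : ∀ a b : ℝ, a ≤ b → ∫ t in a..b, Real.exp t * T (Real.exp t)
        = ∫ t in (Real.exp a)..(Real.exp b), T t := by
      intro a b hab
      rw [intervalIntegral.integral_of_le hab, intervalIntegral.integral_of_le
        (Real.exp_le_exp.2 hab), ← integral_Icc_eq_integral_Ioc, ← integral_Icc_eq_integral_Ioc]
      exact integral_Icc_deriv_smul_of_deriv_nonneg (g := T) Real.continuous_exp.continuousOn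
        (fun x _ => Real.hasDerivAt_exp x) (fun x _ => (Real.exp_pos x).le) hab
    intro x
    rcases le_total 0 x with hx | hx
    · rw [key 0 x hx, Real.exp_zero]
    · rw [intervalIntegral.integral_symm, key x 0 hx, Real.exp_zero,
        ← intervalIntegral.integral_symm]
  refine ⟨hg, hloc, fun φ hφ hcs hs => ?_⟩
  have e1 := integral_primitive_mul_deriv isOpen_univ ordConnected_univ hloc (mem_univ (0 : ℝ))
    hφ hcs hs
  rw [← e1]
  have e2 : ∫ x in univ, g (Real.exp x) * deriv φ x =
      ∫ x in univ, (c * deriv φ x +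
        (∫ t in (0 : ℝ)..x, Real.exp t * T (Real.exp t)) * deriv φ x) := by
    rw [Measure.restrict_univ]
    refine integral_congr_ae ?_
    filter_upwards [ae_comp_exp hc] with x hx
    rw [hx, hcv, add_mul]
  have h1 : Continuous (deriv φ) := hφ.continuous_deriv (by exact_mod_cast le_top)
  rw [e2, Measure.restrict_univ, integral_add, integral_const_mul, integral_deriv_eq_zero hφ hcs,
    mul_zero, zero_add]
  · exact (h1.integrable_of_hasCompactSupport hcs.deriv).const_mul c
  · exact integrable_mul_of_tsupport_subset
      (locallyIntegrableOn_primitive isOpen_univ ordConnected_univ hloc (mem_univ (0 : ℝ))) h1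
      hcs.deriv (subset_univ _)

/-- Under the two regularity assumptions the root of a radial density has an absolutely continuous
version, and the location and shape scores are almost everywhere equal. -/
theorem exists_isRegularRoot {k : ℕ} [NeZero k] {f : ℝ → ℝ} (hA1 : AssumptionA1 k f)
    (hA2 : AssumptionA2 k f) :
    ∃ η T : ℝ → ℝ, IsRegularRoot k η T ∧
      (∀ᵐ r ∂(volume.restrict (Ioi 0)), √(f r) = η r) ∧
      (∀ᵐ r ∂(volume.restrict (Ioi 0)), locScore f r = -2 * T r / η r) ∧
      (∀ᵐ r ∂(volume.restrict (Ioi 0)), shapeScore f r = -2 * T r / η r) := by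
  obtain ⟨hL, T₀, hT₀, hT₀L⟩ := hA1
  obtain ⟨-, S₀, hS₀, hS₀L⟩ := hA2
  have hW₀ := weakDeriv_isWeakDeriv hT₀
  have hm : AEStronglyMeasurable T₀ (volume.restrict (Ioi 0)) := hT₀.2.1.aestronglyMeasurable
  set T : ℝ → ℝ := hm.mk T₀ with hTdef
  have hTm : Measurable T := hm.stronglyMeasurable_mk.measurable
  have hTT : T₀ =ᵐ[volume.restrict (Ioi 0)] T := hm.ae_eq_mk
  have hTw : IsWeakDeriv (Ioi 0) (sqrtDensity f) T := by
    refine ⟨hT₀.1, ?_, fun φ h1 h2 h3 => ?_⟩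
    · refine (locallyIntegrableOn_iff isOpen_Ioi.isLocallyClosed).2 fun K hK hKc => ?_
      exact (hT₀.2.1.integrableOn_compact_subset hK hKc).congr
        (ae_restrict_of_ae_restrict_of_subset hK hTT)
    · rw [hT₀.2.2 φ h1 h2 h3, neg_inj]
      refine integral_congr_ae ?_
      filter_upwards [hTT] with x hx
      rw [hx]
  have h1 : (1 : ℝ) ∈ Ioi (0 : ℝ) := mem_Ioi.2 one_pos
  obtain ⟨c, hc⟩ := hTw.exists_ae_eq_add_integral isOpen_Ioi ordConnected_Ioi h1
  set η : ℝ → ℝ := (Ioi 0).piecewise (fun r => c + ∫ t in (1 : ℝ)..r, T t)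
    (fun _ => c + ∫ t in (1 : ℝ)..0, T t) with hη
  have hηpos : ∀ r, 0 < r → η r = c + ∫ t in (1 : ℝ)..r, T t := fun r hr =>
    piecewise_eq_of_mem _ _ _ hr
  have hηae : ∀ᵐ r ∂(volume.restrict (Ioi 0)), √(f r) = η r := by
    filter_upwards [hc, ae_restrict_mem measurableSet_Ioi] with r hr hr0
    rw [hηpos r hr0, ← hr, sqrtDensity]
  have hT2 : IntegrableOn (fun r => r ^ (k - 1) * T r ^ 2) (Ioi 0) := by
    refine (integrableOn_of_memLp_powWeight hT₀L).congr ?_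
    filter_upwards [hTT] with r hr
    rw [hr]
  have hint : ∀ a ∈ radii k, ∀ b ∈ radii k, IntervalIntegrable T volume a b := by
    intro a ha b hb
    by_cases hk : k = 1
    · subst hk
      simp only [radii, if_true, mem_Ici] at ha hb
      simp only [Nat.sub_self, pow_zero, one_mul] at hT2
      have hsub : uIoc a b ⊆ Ioi 0 := fun x hx => (le_min ha hb).trans_lt hx.1
      rw [intervalIntegrable_iff]
      have h3 : IntegrableOn (fun r => T r ^ 2) (uIoc a b) := hT2.mono_set hsub
      have : IsFiniteMeasure (volume.restrict (uIoc a b)) :=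
        ⟨by rw [Measure.restrict_apply_univ, uIoc]; exact measure_Ioc_lt_top⟩
      exact (MemLp.integrable one_le_two
        ((memLp_two_iff_integrable_sq hTm.aestronglyMeasurable).2 h3))
    · simp only [radii, if_neg hk] at ha hb
      exact hTw.2.1.intervalIntegrable_of_mem ordConnected_Ioi ha hb
  have hηrad : ∀ r ∈ radii k, η r = c + ∫ t in (1 : ℝ)..r, T t := by
    intro r hr
    by_cases hr0 : 0 < r
    · exact hηpos r hr0
    · have : r = 0 := by
        unfold radii at hr
        split_ifs at hr
        · exact le_antisymm (not_lt.1 hr0) hr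
        · exact absurd hr hr0
      rw [hη, piecewise_eq_of_notMem _ _ _ (by exact hr0), this]
  have hS := hTw.comp_exp hS₀.1
  have hSS : ∀ᵐ x, S₀ x = Real.exp x * T (Real.exp x) := by
    have := hS₀.ae_eq isOpen_univ hS
    rwa [Measure.restrict_univ] at this
  refine ⟨η, T, ⟨?_, hTm, ?_, hT2, ?_, hint, ?_⟩, hηae, ?_, ?_⟩
  · refine ContinuousOn.measurable_piecewise ?_ continuousOn_const measurableSet_Ioi
    intro x hx
    refine (ContinuousAt.continuousWithinAt ?_)
    obtain ⟨p, q, hpq, hK, hpqΩ⟩ := exists_Ioo_of_isCompact isOpen_Ioi ordConnected_Ioi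
      (isCompact_singleton.insert (1 : ℝ))
      (insert_nonempty 1 {x}) (insert_subset h1 (singleton_subset_iff.2 hx))
    have hTi : IntervalIntegrable T volume p q := hTw.2.1.intervalIntegrable_of_mem
      ordConnected_Ioi (hpqΩ (left_mem_Icc.2 hpq.le)) (hpqΩ (right_mem_Icc.2 hpq.le))
    have hap := hK (mem_insert 1 _)
    have hxp := hK (mem_insert_of_mem 1 (mem_singleton x))
    have := intervalIntegral.continuousOn_primitive_interval' (f := T) (μ := volume) (a := 1) hTi
      (by rw [uIcc_of_le hpq.le]; exact Ioo_subset_Icc_self hap)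
    rw [uIcc_of_le hpq.le] at this
    exact continuousAt_const.add (this.continuousAt (Icc_mem_nhds hxp.1 hxp.2))
  · refine (integrableOn_of_memLp_powWeight hL).congr ?_
    filter_upwards [hηae] with r hr
    rw [sqrtDensity, hr]
  · have h2 := integrable_of_memLp_expWeight hS₀L
    have h3 := integrableOn_image_iff_integrableOn_abs_deriv_smul (s := univ) (f := Real.exp)
      (f' := Real.exp) MeasurableSet.univ (fun x _ => (Real.hasDerivAt_exp x).hasDerivWithinAt)
      Real.exp_injective.injOn (fun r => r ^ (k - 1) * (r * T r) ^ 2)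
    rw [image_univ, Real.range_exp] at h3
    refine h3.2 ?_
    rw [integrableOn_univ]
    refine h2.congr ?_
    filter_upwards [hSS] with x hx
    rw [hx, Real.abs_exp, smul_eq_mul, ← mul_assoc]
    obtain ⟨l, rfl⟩ := Nat.exists_eq_succ_of_ne_zero (NeZero.ne k)
    rw [Nat.succ_eq_add_one, Nat.add_sub_cancel, ← Real.exp_nat_mul, ← Real.exp_add]
    congr 2
    push_cast
    ring
  · intro a ha b hb
    have h1' := Ioi_subset_radii k h1
    rw [hηrad a ha, hηrad b hb, ← intervalIntegral.integral_add_adjacent_intervals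
      (hint a ha 1 h1') (hint 1 h1' b hb), intervalIntegral.integral_symm]
    ring
  · have := hW₀.ae_eq isOpen_Ioi hTw
    filter_upwards [this, hηae] with r hr1 hr2
    rw [locScore, hr1, sqrtDensity, hr2]
  · have hW := weakDeriv_isWeakDeriv hS₀
    have h2 := hW.ae_eq isOpen_univ hS
    rw [Measure.restrict_univ] at h2
    filter_upwards [ae_comp_log h2, hηae, ae_restrict_mem measurableSet_Ioi] with r hr1 hr2 hr0
    have hr0' : (0 : ℝ) < r := hr0
    rw [shapeScore, hr1, sqrtDensityExp, Real.exp_log hr0, hr2]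
    field_simp

/-! ### The fundamental theorem of calculus along segments -/

section Segment

variable {E : Type*} [NormedAddCommGroup E] [InnerProductSpace ℝ E]

lemma hasDerivAt_norm_add_smul (v w : E) {s : ℝ} (h : v + s • w ≠ 0) :
    HasDerivAt (fun s : ℝ => ‖v + s • w‖) (inner ℝ (v + s • w) w / ‖v + s • w‖) s := by
  have h1 : HasDerivAt (fun s : ℝ => v + s • w) w s := by
    simpa using ((hasDerivAt_id s).smul_const w).const_add v
  have h2 := h1.norm_sq.sqrt (by positivity)
  have e : (fun s : ℝ => √(‖v + s • w‖ ^ 2)) = fun s : ℝ => ‖v + s • w‖ := by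
    funext s; exact Real.sqrt_sq (norm_nonneg _)
  rw [e, Real.sqrt_sq (norm_nonneg _)] at h2
  convert h2 using 1
  field_simp

/-- The modulus decreases and then increases along a segment, so the chain rule holds for an
absolutely continuous function of the modulus even though it may fail to be differentiable. -/
lemma integral_along_segment {k : ℕ} {η T : ℝ → ℝ} (hR : IsRegularRoot k η T) (v w : E)
    (hpath : ∀ s ∈ Icc (0 : ℝ) 1, ‖v + s • w‖ ∈ radii k) :
    IntegrableOn (fun s : ℝ => inner ℝ (v + s • w) w / ‖v + s • w‖ * T ‖v + s • w‖) (Icc 0 1) ∧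
    ∫ s in Icc (0 : ℝ) 1, inner ℝ (v + s • w) w / ‖v + s • w‖ * T ‖v + s • w‖
      = η ‖v + w‖ - η ‖v‖ := by
  rcases eq_or_ne w 0 with rfl | hw
  · simp
  have hw2 : 0 < ‖w‖ ^ 2 := by positivity
  -- `s₀` is where the line through `v` in the direction `w` is closest to the origin.
  set s₀ := -inner ℝ v w / ‖w‖ ^ 2 with hs₀
  have hin : ∀ s : ℝ, inner ℝ (v + s • w) w = ‖w‖ ^ 2 * (s - s₀) := by
    intro s
    rw [inner_add_left, real_inner_smul_left, real_inner_self_eq_norm_sq, hs₀]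
    field_simp
    ring
  have hne : ∀ s, s ≠ s₀ → v + s • w ≠ 0 := by
    intro s hs h
    have := hin s
    rw [h, inner_zero_left] at this
    rcases mul_eq_zero.1 this.symm with h' | h'
    · exact hw2.ne' h'
    · exact hs (sub_eq_zero.1 h')
  set m := max 0 (min 1 s₀) with hm
  have hm0 : 0 ≤ m := le_max_left _ _
  have hm1 : m ≤ 1 := max_le zero_le_one (min_le_left _ _)
  have hlt : ∀ s ∈ Ioo 0 m, s < s₀ := by
    intro s hs
    rcases lt_max_iff.1 hs.2 with h | h
    · exact absurd h (not_lt.2 hs.1.le)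
    · exact h.trans_le (min_le_right _ _)
  have hgt : ∀ s ∈ Ioo m 1, s₀ < s := by
    intro s hs
    by_contra h
    have h1 : s ≤ min 1 s₀ := le_min hs.2.le (not_lt.1 h)
    exact absurd hs.1 (not_lt.2 (h1.trans (le_max_right _ _)))
  set ρ : ℝ → ℝ := fun s => ‖v + s • w‖ with hρ
  set ρ' : ℝ → ℝ := fun s => inner ℝ (v + s • w) w / ‖v + s • w‖ with hρ'
  have hc : Continuous ρ := by fun_prop
  have hd1 : ∀ s ∈ Ioo 0 m, HasDerivAt ρ (ρ' s) s := fun s hs =>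
    hasDerivAt_norm_add_smul v w (hne s (hlt s hs).ne)
  have hd2 : ∀ s ∈ Ioo m 1, HasDerivAt ρ (ρ' s) s := fun s hs =>
    hasDerivAt_norm_add_smul v w (hne s (hgt s hs).ne')
  have hn1 : ∀ s ∈ Ioo 0 m, ρ' s ≤ 0 := fun s hs => by
    rw [hρ']; simp only [hin]
    exact div_nonpos_of_nonpos_of_nonneg
      (mul_nonpos_of_nonneg_of_nonpos hw2.le (by linarith [hlt s hs])) (norm_nonneg _)
  have hn2 : ∀ s ∈ Ioo m 1, 0 ≤ ρ' s := fun s hs => by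
    rw [hρ']; simp only [hin]
    exact div_nonneg (mul_nonneg hw2.le (by linarith [hgt s hs])) (norm_nonneg _)
  have hr0 : ρ 0 ∈ radii k := hpath 0 ⟨le_rfl, zero_le_one⟩
  have hrm : ρ m ∈ radii k := hpath m ⟨hm0, hm1⟩
  have hr1 : ρ 1 ∈ radii k := hpath 1 ⟨zero_le_one, le_rfl⟩
  have hle1 : ρ m ≤ ρ 0 := by
    have := antitoneOn_of_deriv_nonpos (convex_Icc 0 m) hc.continuousOn
      (by rw [interior_Icc]; exact fun z hz => (hd1 z hz).differentiableAt.differentiableWithinAt)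
      (by rw [interior_Icc]; exact fun z hz => by rw [(hd1 z hz).deriv]; exact hn1 z hz)
    exact this ⟨le_rfl, hm0⟩ ⟨hm0, le_rfl⟩ hm0
  have hle2 : ρ m ≤ ρ 1 := by
    have := monotoneOn_of_deriv_nonneg (convex_Icc m 1) hc.continuousOn
      (by rw [interior_Icc]; exact fun z hz => (hd2 z hz).differentiableAt.differentiableWithinAt)
      (by rw [interior_Icc]; exact fun z hz => by rw [(hd2 z hz).deriv]; exact hn2 z hz)
    exact this ⟨le_rfl, hm1⟩ ⟨hm1, le_rfl⟩ hm1
  have hi1 : IntegrableOn (fun s => ρ' s • T (ρ s)) (Icc 0 m) := by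
    refine (integrableOn_Icc_deriv_smul_iff_of_deriv_nonpos hc.continuousOn hd1 hn1 hm0).2 ?_
    exact (intervalIntegrable_iff_integrableOn_Icc_of_le hle1 (by simp)).1
      (hR.intervalIntegrable _ hrm _ hr0)
  have hi2 : IntegrableOn (fun s => ρ' s • T (ρ s)) (Icc m 1) := by
    refine (integrableOn_Icc_deriv_smul_iff_of_deriv_nonneg hc.continuousOn hd2 hn2 hm1).2 ?_
    exact (intervalIntegrable_iff_integrableOn_Icc_of_le hle2 (by simp)).1
      (hR.intervalIntegrable _ hrm _ hr1)
  have e1 := integral_Icc_deriv_smul_of_deriv_nonpos (g := T) hc.continuousOn hd1 hn1 hm0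
  have e2 := integral_Icc_deriv_smul_of_deriv_nonneg (g := T) hc.continuousOn hd2 hn2 hm1
  rw [integral_Icc_eq_integral_Ioc, ← intervalIntegral.integral_of_le hm0,
    integral_Icc_eq_integral_Ioc (μ := volume) (x := ρ m), ← intervalIntegral.integral_of_le hle1,
    hR.integral_eq _ hrm _ hr0] at e1
  rw [integral_Icc_eq_integral_Ioc, ← intervalIntegral.integral_of_le hm1,
    integral_Icc_eq_integral_Ioc (μ := volume) (x := ρ m), ← intervalIntegral.integral_of_le hle2,
    hR.integral_eq _ hrm _ hr1] at e2
  refine ⟨?_, ?_⟩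
  · rw [← Icc_union_Icc_eq_Icc hm0 hm1]
    exact hi1.union hi2
  · rw [integral_Icc_eq_integral_Ioc, ← intervalIntegral.integral_of_le zero_le_one]
    have := intervalIntegral.integral_add_adjacent_intervals (μ := volume)
      (f := fun s => ρ' s • T (ρ s))
      ((intervalIntegrable_iff_integrableOn_Icc_of_le hm0 enorm_ne_top).2 hi1)
      ((intervalIntegrable_iff_integrableOn_Icc_of_le hm1 enorm_ne_top).2 hi2)
    have h3 : ∫ s in (0 : ℝ)..1, ρ' s * T (ρ s) = η (ρ 1) - η (ρ 0) := by
      rw [e1, e2] at this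
      simp only [smul_eq_mul] at this
      rw [← this]; ring
    simpa [hρ] using h3

variable [FiniteDimensional ℝ E] [MeasurableSpace E] [BorelSpace E]

/-- In dimension at least two, almost no orbit of a nearly trivial affine deformation hits the
origin: the initial points of those that do form a Lipschitz curve. -/
lemma volume_segment_hits_zero (hdim : 1 < Module.finrank ℝ E) {A : E →L[ℝ] E} (hA : ‖A‖ ≤ 1 / 2)
    (b : E) : volume {y : E | ∃ s ∈ Icc (0 : ℝ) 1, y + s • (A y - b) = 0} = 0 := by
  set N := {y : E | ∃ s ∈ Icc (0 : ℝ) 1, y + s • (A y - b) = 0} with hN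
  -- `σ y` is the time at which the orbit of `y` hits the origin; it determines `y`.
  choose! σ hσ1 hσ2 using fun y (hy : y ∈ N) => hy
  have hbd : ∀ y ∈ N, ‖y‖ ≤ 2 * ‖b‖ := by
    intro y hy
    have h1 : y = σ y • (b - A y) := by
      rw [← sub_eq_zero, ← hσ2 y hy]; module
    have h2 : ‖y‖ ≤ ‖b‖ + 1 / 2 * ‖y‖ := by
      calc ‖y‖ = ‖σ y • (b - A y)‖ := by rw [← h1]
        _ = σ y * ‖b - A y‖ := by rw [norm_smul, Real.norm_of_nonneg (hσ1 y hy).1]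
        _ ≤ 1 * ‖b - A y‖ := by gcongr; exact (hσ1 y hy).2
        _ ≤ ‖b‖ + ‖A y‖ := by rw [one_mul]; exact norm_sub_le _ _
        _ ≤ ‖b‖ + 1 / 2 * ‖y‖ := by gcongr; exact A.le_of_opNorm_le hA y
    linarith
  have hlip : ∀ y ∈ N, ∀ z ∈ N, ‖y - z‖ ≤ 4 * ‖b‖ * |σ y - σ z| := by
    intro y hy z hz
    have h1 : y - z = -(σ y • A (y - z) + (σ y - σ z) • (A z - b)) := by
      have e1 := hσ2 y hy
      have e2 := hσ2 z hz
      rw [map_sub, ← sub_eq_zero]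
      have : (y + σ y • (A y - b)) - (z + σ z • (A z - b)) = 0 := by rw [e1, e2, sub_zero]
      rw [← this]; module
    have h2 : ‖y - z‖ ≤ 1 / 2 * ‖y - z‖ + |σ y - σ z| * (2 * ‖b‖) := by
      calc ‖y - z‖ = ‖σ y • A (y - z) + (σ y - σ z) • (A z - b)‖ := by
            rw [← norm_neg (σ y • A (y - z) + _), ← h1]
        _ ≤ ‖σ y • A (y - z)‖ + ‖(σ y - σ z) • (A z - b)‖ := norm_add_le _ _
        _ = σ y * ‖A (y - z)‖ + |σ y - σ z| * ‖A z - b‖ := by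
            rw [norm_smul, norm_smul, Real.norm_of_nonneg (hσ1 y hy).1, Real.norm_eq_abs]
        _ ≤ 1 * (1 / 2 * ‖y - z‖) + |σ y - σ z| * (2 * ‖b‖) := by
            gcongr
            · exact (hσ1 y hy).2
            · exact A.le_of_opNorm_le hA _
            · calc ‖A z - b‖ ≤ ‖A z‖ + ‖b‖ := norm_sub_le _ _
                _ ≤ 1 / 2 * ‖z‖ + ‖b‖ := by gcongr; exact A.le_of_opNorm_le hA _
                _ ≤ 2 * ‖b‖ := by linarith [hbd z hz]
        _ = _ := by ring
    nlinarith
  have hinj : InjOn σ N := fun y hy z hz h => by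
    have := hlip y hy z hz
    rw [h, sub_self, abs_zero, mul_zero] at this
    exact sub_eq_zero.1 (norm_le_zero_iff.1 this)
  have hL : LipschitzOnWith (4 * ‖b‖).toNNReal (Function.invFunOn σ N) (σ '' N) := by
    refine LipschitzOnWith.of_dist_le_mul ?_
    rintro _ ⟨y, hy, rfl⟩ _ ⟨z, hz, rfl⟩
    rw [hinj.leftInvOn_invFunOn hy, hinj.leftInvOn_invFunOn hz, dist_eq_norm, Real.dist_eq,
      Real.coe_toNNReal _ (by positivity)]
    exact hlip y hy z hz
  have himg : Function.invFunOn σ N '' (σ '' N) = N := by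
    rw [image_image]
    conv_rhs => rw [← image_id N]
    exact image_congr fun y hy => hinj.leftInvOn_invFunOn hy
  have hd : dimH N ≤ 1 := by
    calc dimH N = dimH (Function.invFunOn σ N '' (σ '' N)) := by rw [himg]
      _ ≤ dimH (σ '' N) := hL.dimH_image_le
      _ ≤ dimH (univ : Set ℝ) := dimH_mono (subset_univ _)
      _ = 1 := Real.dimH_univ
  have hac : (volume : Measure E) ≪ μH[((Module.finrank ℝ E : NNReal) : ℝ)] := by
    rw [NNReal.coe_natCast]
    exact Measure.absolutelyContinuous_isAddHaarMeasure _ _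
  refine measure_zero_of_dimH_lt hac (hd.trans_lt ?_)
  exact_mod_cast hdim

end Segment

/-! ### Affine deformations of square integrable functions -/

section Deformation

variable {E : Type*} [NormedAddCommGroup E] [InnerProductSpace ℝ E] [FiniteDimensional ℝ E]
  [MeasurableSpace E] [BorelSpace E]

lemma measurable_deform (A : E →L[ℝ] E) (b : E) : Measurable fun y : E => y + (A y - b) := by
  fun_prop

/-- The image of the Lebesgue measure under an affine deformation. -/
lemma map_deform_volume (A : E →L[ℝ] E) (b : E) (h : (1 + A).det ≠ 0) :
    Measure.map (fun y : E => y + (A y - b)) volume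
      = ENNReal.ofReal |((1 + A).det)⁻¹| • (volume : Measure E) := by
  have e : (fun y : E => y + (A y - b)) = (fun z => z - b) ∘ ((1 + A : E →L[ℝ] E) : E →ₗ[ℝ] E) := by
    funext y
    simp [add_sub_assoc]
  have hm : Measurable ((1 + A : E →L[ℝ] E) : E →ₗ[ℝ] E) :=
    (1 + A : E →L[ℝ] E).continuous.measurable
  rw [e, ← Measure.map_map (by fun_prop) hm,
    Measure.map_linearMap_addHaar_eq_smul_addHaar volume h, Measure.map_smul]
  congr 1
  exact (measurePreserving_sub_right volume b).map_eq

lemma tendsto_det_one_add : Tendsto (fun A : E →L[ℝ] E => (1 + A).det) (𝓝 0) (𝓝 1) := by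
  have h : Continuous fun A : E →L[ℝ] E => (1 + A).det :=
    ContinuousLinearMap.continuous_det.comp (continuous_const.add continuous_id)
  have := h.tendsto 0
  simpa [ContinuousLinearMap.det] using this

lemma eventually_deform_le : ∀ᶠ A : E →L[ℝ] E in 𝓝 0, ∀ b : E,
    (1 + A).det ≠ 0 ∧
    Measure.map (fun y : E => y + (A y - b)) volume ≤ (2 : ENNReal) • (volume : Measure E) := by
  have h := (tendsto_det_one_add (E := E)).eventually
    (lt_mem_nhds (show (1 / 2 : ℝ) < 1 by norm_num))
  filter_upwards [h] with A hA b
  have h0 : 0 < (1 + A).det := by linarith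
  refine ⟨h0.ne', ?_⟩
  rw [map_deform_volume A b h0.ne']
  refine Measure.le_iff.2 fun s _ => ?_
  rw [Measure.smul_apply, Measure.smul_apply, smul_eq_mul, smul_eq_mul]
  gcongr
  rw [abs_of_pos (inv_pos.2 h0), show (2 : ENNReal) = ENNReal.ofReal 2 by simp]
  refine ENNReal.ofReal_le_ofReal ?_
  rw [inv_le_comm₀ h0 two_pos]
  linarith

lemma eLpNorm_comp_deform_le {A : E →L[ℝ] E} {b : E} {D : E → ℝ}
    (hA : Measure.map (fun y : E => y + (A y - b)) volume ≤ (2 : ENNReal) • (volume : Measure E))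
    (hD : AEStronglyMeasurable D volume) :
    eLpNorm (fun y => D (y + (A y - b))) 2 volume ≤ 2 * eLpNorm D 2 volume := by
  have hac : Measure.map (fun y : E => y + (A y - b)) volume ≪ (volume : Measure E) :=
    (Measure.absolutelyContinuous_of_le hA).trans
      (Measure.smul_absolutelyContinuous)
  have h1 := eLpNorm_map_measure (p := 2) (hD.mono_ac hac) (measurable_deform A b).aemeasurable
  have h2 : eLpNorm (fun y => D (y + (A y - b))) 2 volume
      = eLpNorm D 2 (Measure.map (fun y : E => y + (A y - b)) volume) := h1.symm
  rw [h2]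
  refine (eLpNorm_mono_measure D hA).trans ?_
  rw [eLpNorm_smul_measure_of_ne_zero two_ne_zero, smul_eq_mul]
  gcongr
  calc (2 : ENNReal) ^ ((1 / 2 : ENNReal).toReal) ≤ (2 : ENNReal) ^ (1 : ℝ) :=
        ENNReal.rpow_le_rpow_of_exponent_le (by norm_num) (by norm_num)
    _ = 2 := ENNReal.rpow_one 2

lemma aestronglyMeasurable_comp_deform {A : E →L[ℝ] E} {b : E} {D : E → ℝ}
    (hA : Measure.map (fun y : E => y + (A y - b)) volume ≤ (2 : ENNReal) • (volume : Measure E))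
    (hD : AEStronglyMeasurable D volume) :
    AEStronglyMeasurable (fun y => D (y + (A y - b))) volume := by
  have hac : Measure.map (fun y : E => y + (A y - b)) volume ≪ (volume : Measure E) :=
    (Measure.absolutelyContinuous_of_le hA).trans
      (Measure.smul_absolutelyContinuous)
  exact (hD.mono_ac hac).comp_measurable (measurable_deform A b)

lemma tendsto_fst_nhds_zero :
    Tendsto (fun p : (E →L[ℝ] E) × E => p.1) (𝓝 0) (𝓝 0) := continuous_fst.tendsto' _ _ rfl

/-- Affine deformations close to the identity act continuously on `L²`: the case of a continuous
function with compact support. -/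
lemma tendsto_eLpNorm_deform_sub_of_hasCompactSupport {g : E → ℝ} (hg : Continuous g)
    (hc : HasCompactSupport g) :
    Tendsto (fun p : (E →L[ℝ] E) × E => eLpNorm (fun y => g (y + (p.1 y - p.2)) - g y) 2 volume)
      (𝓝 0) (𝓝 0) := by
  obtain ⟨M, hM⟩ := hg.bounded_above_of_compact_support hc
  obtain ⟨R, hR0, hR⟩ := hc.isCompact.isBounded.exists_pos_norm_le
  have hzero : ∀ y, R < ‖y‖ → g y = 0 := fun y hy =>
    image_eq_zero_of_notMem_tsupport fun h => absurd (hR y h) (not_le.2 hy)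
  have hcl : Tendsto (fun p : (E →L[ℝ] E) × E =>
      ∫⁻ y, ‖g (y + (p.1 y - p.2)) - g y‖ₑ ^ (2 : ℝ)) (𝓝 0) (𝓝 (∫⁻ _ : E, 0)) := by
    refine tendsto_lintegral_filter_of_dominated_convergence
      ((Metric.closedBall (0 : E) (2 * R + 1)).indicator fun _ => ENNReal.ofReal (2 * M) ^ (2 : ℝ))
      (Eventually.of_forall fun p => ?_) ?_ ?_ (ae_of_all _ fun y => ?_)
    · have : Measurable fun y => g (y + (p.1 y - p.2)) - g y := by fun_prop
      exact this.enorm.pow_const _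
    · have hball : ∀ᶠ p : (E →L[ℝ] E) × E in 𝓝 0, ‖p‖ < 1 / 2 := by
        filter_upwards [Metric.ball_mem_nhds (0 : (E →L[ℝ] E) × E)
          (show (0 : ℝ) < 1 / 2 by norm_num)]
          with p hp
        simpa using hp
      filter_upwards [hball] with p hp
      refine ae_of_all _ fun y => ?_
      by_cases hy : y ∈ Metric.closedBall (0 : E) (2 * R + 1)
      · rw [indicator_of_mem hy]
        gcongr
        rw [← ofReal_norm]
        refine ENNReal.ofReal_le_ofReal ((norm_sub_le _ _).trans ?_)
        linarith [hM (y + (p.1 y - p.2)), hM y]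
      · have hy' : 2 * R + 1 < ‖y‖ := by simpa using hy
        have h1 : ‖p.1 y‖ ≤ 1 / 2 * ‖y‖ :=
          p.1.le_of_opNorm_le ((norm_fst_le p).trans hp.le) y
        have h2 : ‖p.2‖ ≤ 1 / 2 := (norm_snd_le p).trans hp.le
        have h3 : ‖y‖ ≤ ‖y + (p.1 y - p.2)‖ + (‖p.1 y‖ + ‖p.2‖) := by
          calc ‖y‖ = ‖(y + (p.1 y - p.2)) - (p.1 y - p.2)‖ := by rw [add_sub_cancel_right]
            _ ≤ ‖y + (p.1 y - p.2)‖ + ‖p.1 y - p.2‖ := norm_sub_le _ _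
            _ ≤ _ := by gcongr; exact norm_sub_le _ _
        rw [hzero y (by linarith), hzero (y + (p.1 y - p.2)) (by linarith)]
        simp
    · rw [lintegral_indicator measurableSet_closedBall, setLIntegral_const]
      exact ENNReal.mul_ne_top (ENNReal.rpow_ne_top_of_nonneg (by norm_num) ENNReal.ofReal_ne_top)
        (measure_closedBall_lt_top).ne
    · have hcont : Continuous fun p : (E →L[ℝ] E) × E =>
          ‖g (y + (p.1 y - p.2)) - g y‖ₑ ^ (2 : ℝ) := by
        have : Continuous fun p : (E →L[ℝ] E) × E => g (y + (p.1 y - p.2)) - g y := by fun_prop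
        exact (ENNReal.continuous_rpow_const).comp this.enorm
      refine hcont.tendsto' _ _ ?_
      simp
  rw [lintegral_zero] at hcl
  have hfin := (ENNReal.continuous_rpow_const (y := 1 / 2)).tendsto' (0 : ENNReal) 0
    (ENNReal.zero_rpow_of_pos (by norm_num)) |>.comp hcl
  refine hfin.congr fun p => ?_
  rw [eLpNorm_eq_lintegral_rpow_enorm_toReal two_ne_zero ENNReal.ofNat_ne_top]
  simp

/-- Affine deformations close to the identity act continuously on `L²`. -/
lemma tendsto_eLpNorm_deform_sub {D : E → ℝ} (hD : MemLp D 2 volume) :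
    Tendsto (fun p : (E →L[ℝ] E) × E => eLpNorm (fun y => D (y + (p.1 y - p.2)) - D y) 2 volume)
      (𝓝 0) (𝓝 0) := by
  rw [ENNReal.tendsto_nhds_zero]
  intro ε hε
  obtain ⟨g, hgc, hDg, hg, hgL⟩ := hD.exists_hasCompactSupport_eLpNorm_sub_le
    ENNReal.ofNat_ne_top (ε := ε / 4) (by simpa using hε.ne')
  have h1 := ENNReal.tendsto_nhds_zero.1 (tendsto_eLpNorm_deform_sub_of_hasCompactSupport hg hgc)
    (ε / 4) (by simpa using hε.ne')
  filter_upwards [h1, tendsto_fst_nhds_zero.eventually (eventually_deform_le (E := E))]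
    with p hp hp2
  have hle := (hp2 p.2).2
  have hDgm : AEStronglyMeasurable (D - g) volume := (hD.sub hgL).1
  have e : (fun y => D (y + (p.1 y - p.2)) - D y)
      = (fun y => (D - g) (y + (p.1 y - p.2))) + ((fun y => g (y + (p.1 y - p.2)) - g y)
        - (D - g)) := by
    funext y; simp only [Pi.sub_apply, Pi.add_apply]; ring
  have hm2 : AEStronglyMeasurable (fun y => g (y + (p.1 y - p.2)) - g y) volume := by
    have : Continuous fun y => g (y + (p.1 y - p.2)) - g y := by fun_prop
    exact this.aestronglyMeasurable
  rw [e]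
  calc eLpNorm _ 2 volume ≤ eLpNorm (fun y => (D - g) (y + (p.1 y - p.2))) 2 volume
        + (eLpNorm (fun y => g (y + (p.1 y - p.2)) - g y) 2 volume + eLpNorm (D - g) 2 volume) :=
        (eLpNorm_add_le (aestronglyMeasurable_comp_deform hle hDgm) (hm2.sub hDgm) one_le_two).trans
          (by gcongr; exact eLpNorm_sub_le hm2 hDgm one_le_two)
    _ ≤ 2 * (ε / 4) + (ε / 4 + ε / 4) := by
        gcongr
        exact (eLpNorm_comp_deform_le hle hDgm).trans (by gcongr)
    _ = ε := by
        rw [← two_mul, ← two_mul, ← mul_assoc]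
        norm_num
        exact ENNReal.mul_div_cancel (by norm_num) (by norm_num)

end Deformation

/-! ### Differentiability in quadratic mean -/

section QuadraticMean

variable {E : Type*} [NormedAddCommGroup E] [InnerProductSpace ℝ E]

/-- The derivative at the identity of `y ↦ η ‖y‖` under the affine deformations
`y ↦ y + (A y - b)`, when `T` is the derivative of `η`. -/
def deformDeriv (T : ℝ → ℝ) (A : E →L[ℝ] E) (b y : E) : ℝ :=
  inner ℝ y (A y - b) / ‖y‖ * T ‖y‖

lemma abs_deformDeriv_le (T : ℝ → ℝ) (A : E →L[ℝ] E) (b y : E) :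
    |deformDeriv T A b y| ≤ ‖A y - b‖ * |T ‖y‖| := by
  rw [deformDeriv, abs_mul, abs_div, abs_norm]
  gcongr
  rcases eq_or_ne y 0 with rfl | hy
  · simp
  · rw [div_le_iff₀ (norm_pos_iff.2 hy), mul_comm]
    exact abs_real_inner_le_norm _ _

lemma deformDeriv_add (T : ℝ → ℝ) (A A' : E →L[ℝ] E) (b b' y : E) :
    deformDeriv T (A + A') (b + b') y = deformDeriv T A b y + deformDeriv T A' b' y := by
  simp only [deformDeriv, add_apply]
  rw [show A y + A' y - (b + b') = (A y - b) + (A' y - b') by abel, inner_add_right]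
  ring

lemma deformDeriv_smul (T : ℝ → ℝ) (c : ℝ) (A : E →L[ℝ] E) (b y : E) :
    deformDeriv T (c • A) (c • b) y = c * deformDeriv T A b y := by
  simp only [deformDeriv, smul_apply]
  rw [← smul_sub, real_inner_smul_right]
  ring

variable [FiniteDimensional ℝ E] [MeasurableSpace E] [BorelSpace E]

lemma measurable_deformDeriv {T : ℝ → ℝ} (hT : Measurable T) (A : E →L[ℝ] E) (b : E) :
    Measurable (deformDeriv T A b) := by
  unfold deformDeriv; fun_prop

variable {k : ℕ} [NeZero k] {η T : ℝ → ℝ}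

lemma memLp_comp_norm (hk : Module.finrank ℝ E = k) {g : ℝ → ℝ} (hg : Measurable g)
    (hi : IntegrableOn (fun r => r ^ (k - 1) * g r ^ 2) (Ioi 0)) :
    MemLp (fun y : E => g ‖y‖) 2 volume := by
  have : Nontrivial E := Module.nontrivial_of_finrank_pos (R := ℝ) (by
    rw [hk]; exact Nat.pos_of_ne_zero (NeZero.ne k))
  have hm : AEStronglyMeasurable (fun y : E => g ‖y‖) volume :=
    (hg.comp measurable_norm).aestronglyMeasurable
  rw [memLp_two_iff_integrable_sq hm]
  rw [integrable_fun_norm_addHaar volume (f := fun r => g r ^ 2), hk]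
  exact hi

lemma IsRegularRoot.memLp_root (hR : IsRegularRoot k η T) (hk : Module.finrank ℝ E = k) :
    MemLp (fun y : E => η ‖y‖) 2 volume :=
  memLp_comp_norm hk hR.measurable hR.integrableOn_sq

lemma IsRegularRoot.memLp_deriv (hR : IsRegularRoot k η T) (hk : Module.finrank ℝ E = k) :
    MemLp (fun y : E => T ‖y‖) 2 volume :=
  memLp_comp_norm hk hR.measurable_deriv hR.integrableOn_deriv_sq

lemma IsRegularRoot.memLp_norm_mul_deriv (hR : IsRegularRoot k η T)
    (hk : Module.finrank ℝ E = k) : MemLp (fun y : E => ‖y‖ * T ‖y‖) 2 volume :=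
  memLp_comp_norm hk (measurable_id.mul hR.measurable_deriv) hR.integrableOn_mul_deriv_sq

lemma IsRegularRoot.memLp_deformDeriv (hR : IsRegularRoot k η T) (hk : Module.finrank ℝ E = k)
    (A : E →L[ℝ] E) (b : E) : MemLp (deformDeriv T A b) 2 volume := by
  have h1 := ((hR.memLp_norm_mul_deriv hk).norm.const_mul ‖A‖).add
    ((hR.memLp_deriv hk).norm.const_mul ‖b‖)
  refine h1.mono (measurable_deformDeriv hR.measurable_deriv A b).aestronglyMeasurable
    (ae_of_all _ fun y => ?_)
  rw [Real.norm_eq_abs]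
  refine (abs_deformDeriv_le T A b y).trans (le_trans ?_ (le_abs_self _))
  simp only [Pi.add_apply, norm_mul, Real.norm_eq_abs, abs_norm]
  calc ‖A y - b‖ * |T ‖y‖| ≤ (‖A‖ * ‖y‖ + ‖b‖) * |T ‖y‖| := by
        gcongr
        exact (norm_sub_le _ _).trans (by gcongr; exact A.le_opNorm y)
    _ = _ := by ring

/-- The derivative `deformDeriv T A b` is continuous in `L²` under small deformations, uniformly
in the direction `(A, b)` because the directions span a finite-dimensional space. -/
lemma IsRegularRoot.eventually_deformDeriv_sub (hR : IsRegularRoot k η T)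
    (hk : Module.finrank ℝ E = k) {ε : ℝ} (hε : 0 < ε) :
    ∀ᶠ p : (E →L[ℝ] E) × E in 𝓝 0, ∀ (A : E →L[ℝ] E) (b : E),
      eLpNorm (fun y => deformDeriv T A b (y + (p.1 y - p.2)) - deformDeriv T A b y) 2 volume
        ≤ ENNReal.ofReal (ε * (‖A‖ + ‖b‖)) := by
  set e := stdOrthonormalBasis ℝ E with he
  -- It is enough to treat the finitely many elementary directions.
  let M : Fin (Module.finrank ℝ E) → Fin (Module.finrank ℝ E) → E →L[ℝ] E := fun i j =>
    (innerSL ℝ (e j)).smulRight (e i)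
  set C : ℝ := (Module.finrank ℝ E : ℝ) * Module.finrank ℝ E + Module.finrank ℝ E + 1 with hC
  have hCpos : 0 < C := by positivity
  have hexp : ∀ (A : E →L[ℝ] E) (b y : E), deformDeriv T A b y =
      (∑ i, ∑ j, inner ℝ (e i) (A (e j)) * deformDeriv T (M i j) 0 y)
        + ∑ i, inner ℝ (e i) b * deformDeriv T 0 (e i) y := by
    intro A b y
    have h1 : inner ℝ y (A y)
        = ∑ i, ∑ j, inner ℝ (e i) (A (e j)) * (inner ℝ (e j) y * inner ℝ y (e i)) := by
      have hy : A y = ∑ j, inner ℝ (e j) y • A (e j) := by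
        conv_lhs => rw [← e.sum_repr' y]
        simp
      rw [← e.sum_inner_mul_inner y (A y)]
      refine Finset.sum_congr rfl fun i _ => ?_
      conv_lhs => rw [hy, inner_sum, Finset.mul_sum]
      refine Finset.sum_congr rfl fun j _ => ?_
      rw [real_inner_smul_right]; ring
    have h2 : inner ℝ y b = ∑ i, inner ℝ (e i) b * inner ℝ y (e i) := by
      rw [← e.sum_inner_mul_inner y b]
      exact Finset.sum_congr rfl fun i _ => mul_comm _ _
    simp only [deformDeriv, M, ContinuousLinearMap.smulRight_apply, innerSL_apply_apply, sub_zero,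
      zero_apply, zero_sub, inner_neg_right, inner_sub_right, inner_smul_right]
    rw [h1, h2, sub_div, sub_mul, sub_eq_add_neg]
    congr 1
    · rw [Finset.sum_div, Finset.sum_mul]
      refine Finset.sum_congr rfl fun i _ => ?_
      rw [Finset.sum_div, Finset.sum_mul]
      exact Finset.sum_congr rfl fun j _ => by ring
    · rw [Finset.sum_div, Finset.sum_mul, ← Finset.sum_neg_distrib]
      exact Finset.sum_congr rfl fun j _ => by ring
  have hev : ∀ (A : E →L[ℝ] E) (b : E), ∀ᶠ p : (E →L[ℝ] E) × E in 𝓝 0,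
      eLpNorm (fun y => deformDeriv T A b (y + (p.1 y - p.2)) - deformDeriv T A b y) 2 volume
        ≤ ENNReal.ofReal (ε / C) := fun A b =>
    ENNReal.tendsto_nhds_zero.1 (tendsto_eLpNorm_deform_sub (hR.memLp_deformDeriv hk A b)) _
      (ENNReal.ofReal_pos.2 (by positivity))
  have hev1 : ∀ᶠ p : (E →L[ℝ] E) × E in 𝓝 0, ∀ i j,
      eLpNorm (fun y => deformDeriv T (M i j) 0 (y + (p.1 y - p.2)) - deformDeriv T (M i j) 0 y)
        2 volume ≤ ENNReal.ofReal (ε / C) :=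
    eventually_all.2 fun i => eventually_all.2 fun j => hev _ _
  have hev2 : ∀ᶠ p : (E →L[ℝ] E) × E in 𝓝 0, ∀ i,
      eLpNorm (fun y => deformDeriv T 0 (e i) (y + (p.1 y - p.2)) - deformDeriv T 0 (e i) y)
        2 volume ≤ ENNReal.ofReal (ε / C) :=
    eventually_all.2 fun i => hev _ _
  filter_upwards [hev1, hev2] with p hp1 hp2 A b
  have hmeas : ∀ (A' : E →L[ℝ] E) (b' : E) (c : ℝ), AEStronglyMeasurable (fun y =>
      c * (deformDeriv T A' b' (y + (p.1 y - p.2)) - deformDeriv T A' b' y)) volume := by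
    intro A' b' c
    have := measurable_deformDeriv hR.measurable_deriv A' b'
    exact (((this.comp (measurable_deform p.1 p.2)).sub this).const_mul c).aestronglyMeasurable
  have hone : ∀ (A' : E →L[ℝ] E) (b' : E) (c d : ℝ), |c| ≤ d →
      eLpNorm (fun y => deformDeriv T A' b' (y + (p.1 y - p.2)) - deformDeriv T A' b' y)
        2 volume ≤ ENNReal.ofReal (ε / C) →
      eLpNorm (fun y => c * (deformDeriv T A' b' (y + (p.1 y - p.2)) - deformDeriv T A' b' y))
        2 volume ≤ ENNReal.ofReal (d * (ε / C)) := by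
    intro A' b' c d hcd h
    have := eLpNorm_const_smul_le (c := c) (p := 2) (μ := (volume : Measure E))
      (f := fun y => deformDeriv T A' b' (y + (p.1 y - p.2)) - deformDeriv T A' b' y)
    refine this.trans ?_
    rw [ENNReal.ofReal_mul ((abs_nonneg c).trans hcd)]
    gcongr
    rw [← ofReal_norm, Real.norm_eq_abs]
    exact ENNReal.ofReal_le_ofReal hcd
  have hsplit : (fun y => deformDeriv T A b (y + (p.1 y - p.2)) - deformDeriv T A b y)
      = (∑ i, ∑ j, fun y => inner ℝ (e i) (A (e j)) *
          (deformDeriv T (M i j) 0 (y + (p.1 y - p.2)) - deformDeriv T (M i j) 0 y))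
        + ∑ i, fun y => inner ℝ (e i) b *
          (deformDeriv T 0 (e i) (y + (p.1 y - p.2)) - deformDeriv T 0 (e i) y) := by
    funext y
    rw [hexp A b, hexp A b y]
    simp only [Pi.add_apply, Finset.sum_apply, mul_sub, Finset.sum_sub_distrib]
    ring
  have hA : ∀ i j, |inner ℝ (e i) (A (e j))| ≤ ‖A‖ := fun i j => by
    refine (abs_real_inner_le_norm _ _).trans ?_
    have := A.le_opNorm (e j)
    rw [e.norm_eq_one, one_mul]
    rwa [e.norm_eq_one, mul_one] at this
  have hb : ∀ i, |inner ℝ (e i) b| ≤ ‖b‖ := fun i => by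
    refine (abs_real_inner_le_norm _ _).trans ?_
    rw [e.norm_eq_one, one_mul]
  rw [hsplit]
  calc eLpNorm _ 2 volume ≤ (∑ _i : Fin (Module.finrank ℝ E), ∑ _j : Fin (Module.finrank ℝ E),
          ENNReal.ofReal (‖A‖ * (ε / C))) + ∑ _i : Fin (Module.finrank ℝ E),
            ENNReal.ofReal (‖b‖ * (ε / C)) := by
        refine (eLpNorm_add_le ?_ ?_ one_le_two).trans (add_le_add ?_ ?_)
        · exact Finset.aestronglyMeasurable_sum _ fun i _ =>
            Finset.aestronglyMeasurable_sum _ fun j _ => hmeas _ _ _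
        · exact Finset.aestronglyMeasurable_sum _ fun i _ => hmeas _ _ _
        · refine (eLpNorm_sum_le (fun i _ => Finset.aestronglyMeasurable_sum _
            fun j _ => hmeas _ _ _) one_le_two).trans (Finset.sum_le_sum fun i _ => ?_)
          exact (eLpNorm_sum_le (fun j _ => hmeas _ _ _) one_le_two).trans
            (Finset.sum_le_sum fun j _ => hone _ _ _ _ (hA i j) (hp1 i j))
        · exact (eLpNorm_sum_le (fun i _ => hmeas _ _ _) one_le_two).trans
            (Finset.sum_le_sum fun i _ => hone _ _ _ _ (hb i) (hp2 i))
    _ = ENNReal.ofReal ((Module.finrank ℝ E : ℝ) * (Module.finrank ℝ E * (‖A‖ * (ε / C)))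
          + (Module.finrank ℝ E : ℝ) * (‖b‖ * (ε / C))) := by
        simp only [Finset.sum_const, Finset.card_univ, Fintype.card_fin, nsmul_eq_mul]
        rw [ENNReal.ofReal_add (by positivity) (by positivity)]
        simp only [ENNReal.ofReal_mul (Nat.cast_nonneg _), ENNReal.ofReal_natCast]
    _ ≤ _ := by
        refine ENNReal.ofReal_le_ofReal ?_
        have h1 : (Module.finrank ℝ E : ℝ) * (Module.finrank ℝ E * (‖A‖ * (ε / C)))
          + (Module.finrank ℝ E : ℝ) * (‖b‖ * (ε / C)) ≤ C * ((‖A‖ + ‖b‖) * (ε / C)) := by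
          have hn : (0 : ℝ) ≤ Module.finrank ℝ E := Nat.cast_nonneg _
          have ha : 0 ≤ ‖A‖ * (ε / C) := by positivity
          have hb' : 0 ≤ ‖b‖ * (ε / C) := by positivity
          rw [hC]
          nlinarith [mul_nonneg hn ha, mul_nonneg hn hb', mul_nonneg (mul_nonneg hn hn) hb']
        refine h1.trans (le_of_eq ?_)
        field_simp

lemma eLpNorm_two_sq {α : Type*} [MeasurableSpace α] (μ : Measure α) (f : α → ℝ) :
    eLpNorm f 2 μ ^ 2 = ∫⁻ x, ‖f x‖ₑ ^ 2 ∂μ := by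
  rw [eLpNorm_eq_lintegral_rpow_enorm_toReal two_ne_zero ENNReal.ofNat_ne_top,
    ← ENNReal.rpow_natCast,
    ← ENNReal.rpow_mul]
  simp

lemma sq_lintegral_le_lintegral_sq {α : Type*} [MeasurableSpace α] (μ : Measure α)
    [IsProbabilityMeasure μ] {u : α → ENNReal} (hu : AEMeasurable u μ) :
    (∫⁻ x, u x ∂μ) ^ 2 ≤ ∫⁻ x, u x ^ 2 ∂μ := by
  have h := ENNReal.lintegral_mul_le_Lp_mul_Lq μ (Real.HolderConjugate.two_two) hu
    (aemeasurable_const (b := (1 : ENNReal)))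
  simp only [Pi.mul_apply, mul_one, ENNReal.one_rpow, lintegral_const, measure_univ] at h
  calc (∫⁻ x, u x ∂μ) ^ 2 ≤ ((∫⁻ x, u x ^ (2 : ℝ) ∂μ) ^ (1 / 2 : ℝ)) ^ 2 := by gcongr
    _ = ∫⁻ x, u x ^ 2 ∂μ := by
        rw [← ENNReal.rpow_natCast, ← ENNReal.rpow_mul]
        simp

/-- The integral form of the increment of `y ↦ η ‖y‖` along an affine deformation. -/
lemma IsRegularRoot.ae_sub_eq_integral (hR : IsRegularRoot k η T) (hk : Module.finrank ℝ E = k)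
    {A : E →L[ℝ] E} (hA : ‖A‖ ≤ 1 / 2) (b : E) :
    ∀ᵐ y : E, IntegrableOn (fun s : ℝ => inner ℝ (y + s • (A y - b)) (A y - b)
        / ‖y + s • (A y - b)‖ * T ‖y + s • (A y - b)‖) (Icc 0 1) ∧
      ∫ s in Icc (0 : ℝ) 1, inner ℝ (y + s • (A y - b)) (A y - b)
        / ‖y + s • (A y - b)‖ * T ‖y + s • (A y - b)‖ = η ‖y + (A y - b)‖ - η ‖y‖ := by
  by_cases hk1 : k = 1
  · refine ae_of_all _ fun y => integral_along_segment hR _ _ fun s _ => ?_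
    rw [radii, if_pos hk1]
    exact norm_nonneg _
  · have hk2 : 1 < Module.finrank ℝ E := by
      have := NeZero.ne k
      omega
    have h := volume_segment_hits_zero hk2 hA b
    filter_upwards [compl_mem_ae_iff.2 h] with y hy
    refine integral_along_segment hR _ _ fun s hs => ?_
    rw [radii, if_neg hk1]
    exact norm_pos_iff.2 fun h0 => hy ⟨s, hs, h0⟩

lemma norm_direction_le {A : E →L[ℝ] E} (hA : ‖A‖ ≤ 1 / 2) (b y : E) {s : ℝ}
    (hs : s ∈ Icc (0 : ℝ) 1) :
    ‖A y - b‖ ≤ 2 * ‖A‖ * ‖y + s • (A y - b)‖ + 2 * ‖b‖ := by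
  set w := A y - b with hw
  have h1 : ‖w‖ ≤ ‖A‖ * ‖y‖ + ‖b‖ := (norm_sub_le _ _).trans (by gcongr; exact A.le_opNorm y)
  have h2 : ‖y‖ ≤ ‖y + s • w‖ + ‖w‖ := by
    calc ‖y‖ = ‖(y + s • w) - s • w‖ := by rw [add_sub_cancel_right]
      _ ≤ ‖y + s • w‖ + ‖s • w‖ := norm_sub_le _ _
      _ ≤ ‖y + s • w‖ + 1 * ‖w‖ := by
          rw [norm_smul, Real.norm_of_nonneg hs.1]
          gcongr
          exact hs.2
      _ = _ := by rw [one_mul]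
  have h3 : ‖A‖ * ‖y‖ ≤ ‖A‖ * ‖y + s • w‖ + 1 / 2 * ‖w‖ := by
    calc ‖A‖ * ‖y‖ ≤ ‖A‖ * (‖y + s • w‖ + ‖w‖) := by gcongr
      _ = ‖A‖ * ‖y + s • w‖ + ‖A‖ * ‖w‖ := by ring
      _ ≤ _ := by gcongr
  linarith

/-- **Differentiability in quadratic mean** of the deformations of `y ↦ η ‖y‖`: the increment is
the average over the segment from `y` to its image of the derivatives there, and these are close
to `deformDeriv T A b y` in `L²` because deformations act continuously on `L²`. -/
theorem IsRegularRoot.eventually_eLpNorm_sub_deformDeriv (hR : IsRegularRoot k η T)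
    (hk : Module.finrank ℝ E = k) {ε : ℝ} (hε : 0 < ε) :
    ∀ᶠ p : (E →L[ℝ] E) × E in 𝓝 0,
      eLpNorm (fun y => η ‖y + (p.1 y - p.2)‖ - η ‖y‖ - deformDeriv T p.1 p.2 y) 2 volume
        ≤ ENNReal.ofReal (ε * (‖p.1‖ + ‖p.2‖)) := by
  set Gq : E → ℝ := fun y => ‖‖y‖ * T ‖y‖‖ + ‖T ‖y‖‖ with hGq
  have hGqL : MemLp Gq 2 volume := (hR.memLp_norm_mul_deriv hk).norm.add (hR.memLp_deriv hk).norm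
  set N := (eLpNorm Gq 2 volume).toReal with hN
  have hNe : eLpNorm Gq 2 volume = ENNReal.ofReal N := (ENNReal.ofReal_toReal hGqL.2.ne).symm
  have hN0 : 0 ≤ N := ENNReal.toReal_nonneg
  have hev : ∀ᶠ p : (E →L[ℝ] E) × E in 𝓝 0,
      (∀ (A : E →L[ℝ] E) (b : E),
      eLpNorm (fun y => deformDeriv T A b (y + (p.1 y - p.2)) - deformDeriv T A b y) 2 volume
        ≤ ENNReal.ofReal (ε / 2 * (‖A‖ + ‖b‖))) ∧ (∀ b : E, (1 + p.1).det ≠ 0 ∧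
    Measure.map (fun y : E => y + (p.1 y - b)) volume ≤ (2 : ENNReal) • (volume : Measure E)) :=
    (hR.eventually_deformDeriv_sub hk (half_pos hε)).and
      (tendsto_fst_nhds_zero.eventually (eventually_deform_le (E := E)))
  obtain ⟨δ, hδ, hball⟩ := Metric.eventually_nhds_iff_ball.1 hev
  have hsmall : 0 < min (1 / 2) (ε / (8 * (N + 1))) := by positivity
  filter_upwards [Metric.ball_mem_nhds (0 : (E →L[ℝ] E) × E) (lt_min hδ hsmall)] with p hp
  obtain ⟨A, b⟩ := p
  rw [mem_ball_zero_iff] at hp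
  have hpδ : ‖((A, b) : (E →L[ℝ] E) × E)‖ < δ := hp.trans_le (min_le_left _ _)
  have hA0 : ‖A‖ < min (1 / 2) (ε / (8 * (N + 1))) :=
    (norm_fst_le (A, b)).trans_lt (hp.trans_le (min_le_right _ _))
  have hA : ‖A‖ ≤ 1 / 2 := hA0.le.trans (min_le_left _ _)
  have hAN : 4 * ‖A‖ * N ≤ ε / 2 := by
    have h1 : ‖A‖ ≤ ε / (8 * (N + 1)) := hA0.le.trans (min_le_right _ _)
    rw [le_div_iff₀ (by positivity)] at h1
    nlinarith [norm_nonneg A]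
  simp only
  set H : ℝ → E → ℝ := fun s y => inner ℝ (y + s • (A y - b)) (A y - b)
        / ‖y + s • (A y - b)‖ * T ‖y + s • (A y - b)‖ with hH
  set D : E → ℝ := deformDeriv T A b with hD
  have hDm : Measurable D := measurable_deformDeriv hR.measurable_deriv A b
  have hTm := hR.measurable_deriv
  have hHm : Measurable fun q : ℝ × E => H q.1 q.2 - D q.2 := by
    have h1 : Measurable fun q : ℝ × E => q.2 + q.1 • (A q.2 - b) := by fun_prop
    have h2 : Measurable fun q : ℝ × E => A q.2 - b := by fun_prop
    exact (((h1.inner h2).div h1.norm).mul (hTm.comp h1.norm)).sub (hDm.comp measurable_snd)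
  -- At time `s` the integrand differs from `D` at the deformed point by a term of second order,
  -- and `D` at the deformed point differs from `D` by a term of order `o(‖A‖ + ‖b‖)`.
  have hbound : ∀ s ∈ Icc (0 : ℝ) 1, ∫⁻ y, ‖H s y - D y‖ₑ ^ 2 ≤
      ENNReal.ofReal (ε * (‖A‖ + ‖b‖)) ^ 2 := by
    intro s hs
    have hsp : s • ((A, b) : (E →L[ℝ] E) × E) ∈ Metric.ball (0 : (E →L[ℝ] E) × E) δ := by
      rw [mem_ball_zero_iff, norm_smul, Real.norm_of_nonneg hs.1]
      calc s * ‖((A, b) : (E →L[ℝ] E) × E)‖ ≤ 1 * ‖((A, b) : (E →L[ℝ] E) × E)‖ := by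
            gcongr; exact hs.2
        _ < δ := by rwa [one_mul]
    obtain ⟨hb1, hb2⟩ := hball _ hsp
    have hpath : ∀ y : E, y + ((s • A) y - s • b) = y + s • (A y - b) := fun y => by
      rw [smul_apply, smul_sub]
    simp only [Prod.smul_mk] at hb1 hb2
    have hle := (hb2 (s • b)).2
    have hGm := eLpNorm_comp_deform_le hle hGqL.1
    have h1 : eLpNorm (fun y => H s y - D (y + ((s • A) y - s • b))) 2 volume ≤
        ENNReal.ofReal (ε / 2 * (‖A‖ + ‖b‖)) := by
      have hpt : ∀ y, ‖H s y - D (y + ((s • A) y - s • b))‖ ≤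
          (2 * ‖A‖ * (‖A‖ + ‖b‖)) * ‖Gq (y + ((s • A) y - s • b))‖ := by
        intro y
        rw [hpath]
        set z := y + s • (A y - b) with hz
        have e1 : H s y - D z = inner ℝ z ((A y - b) - (A z - b)) / ‖z‖ * T ‖z‖ := by
          rw [hD, deformDeriv, hH]
          simp only [← hz]
          rw [inner_sub_right z (A y - b) (A z - b)]
          ring
        have e2 : (A y - b) - (A z - b) = -(s • A (A y - b)) := by
          rw [hz, map_add, map_smul]
          abel
        have h4 : ‖(A y - b) - (A z - b)‖ ≤ ‖A‖ * ‖A y - b‖ := by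
          rw [e2, norm_neg, norm_smul, Real.norm_of_nonneg hs.1]
          calc s * ‖A (A y - b)‖ ≤ 1 * (‖A‖ * ‖A y - b‖) := by
                gcongr
                · exact hs.2
                · exact A.le_opNorm _
            _ = _ := one_mul _
        have h5 : |inner ℝ z ((A y - b) - (A z - b)) / ‖z‖| ≤ ‖(A y - b) - (A z - b)‖ := by
          rw [abs_div, abs_norm]
          rcases eq_or_ne z 0 with h0 | h0
          · rw [h0]; simp
          · rw [div_le_iff₀ (norm_pos_iff.2 h0), mul_comm]
            exact abs_real_inner_le_norm _ _
        have h6 := norm_direction_le hA b y hs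
        rw [← hz] at h6
        have h7 : ‖Gq z‖ = ‖z‖ * |T ‖z‖| + |T ‖z‖| := by
          rw [hGq]
          simp only [norm_mul, Real.norm_eq_abs, abs_norm]
          exact abs_of_nonneg (by positivity)
        rw [e1, Real.norm_eq_abs, abs_mul, h7]
        calc |inner ℝ z ((A y - b) - (A z - b)) / ‖z‖| * |T ‖z‖|
            ≤ (‖A‖ * (2 * ‖A‖ * ‖z‖ + 2 * ‖b‖)) * |T ‖z‖| := by
              gcongr
              exact h5.trans (h4.trans (by gcongr))
          _ ≤ _ := by
              have ha := norm_nonneg A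
              have hbn := norm_nonneg b
              have hzn := norm_nonneg z
              have ht := abs_nonneg (T ‖z‖)
              have : ‖A‖ * (2 * ‖A‖ * ‖z‖ + 2 * ‖b‖) ≤ 2 * ‖A‖ * (‖A‖ + ‖b‖) * (‖z‖ + 1) := by
                nlinarith [mul_nonneg ha hbn, mul_nonneg ha ha, mul_nonneg (mul_nonneg ha hbn) hzn]
              calc _ ≤ (2 * ‖A‖ * (‖A‖ + ‖b‖) * (‖z‖ + 1)) * |T ‖z‖| := by gcongr
                _ = _ := by ring
      refine (eLpNorm_le_mul_eLpNorm_of_ae_le_mul (ae_of_all _ hpt) 2).trans ?_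
      calc ENNReal.ofReal (2 * ‖A‖ * (‖A‖ + ‖b‖))
            * eLpNorm (fun y => Gq (y + ((s • A) y - s • b))) 2 volume
          ≤ ENNReal.ofReal (2 * ‖A‖ * (‖A‖ + ‖b‖)) * (ENNReal.ofReal 2 * ENNReal.ofReal N) := by
            gcongr
            rw [← hNe]
            simpa using hGm
        _ = ENNReal.ofReal (4 * ‖A‖ * N * (‖A‖ + ‖b‖)) := by
            rw [← ENNReal.ofReal_mul (by positivity), ← ENNReal.ofReal_mul (by positivity)]
            congr 1; ring
        _ ≤ _ := by
            refine ENNReal.ofReal_le_ofReal ?_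
            gcongr
    have h2 := hb1 A b
    have h3 : eLpNorm (fun y => H s y - D y) 2 volume ≤ ENNReal.ofReal (ε * (‖A‖ + ‖b‖)) := by
      have e : (fun y => H s y - D y) = (fun y => H s y - D (y + ((s • A) y - s • b)))
          + fun y => D (y + ((s • A) y - s • b)) - D y := by
        funext y; simp
      have hm1 : Measurable fun y => H s y - D y := hHm.comp (measurable_const.prodMk measurable_id)
      have hm2 : Measurable fun y => D (y + ((s • A) y - s • b)) - D y :=
        (hDm.comp (measurable_deform _ _)).sub hDm
      have hm3 : Measurable fun y => H s y - D (y + ((s • A) y - s • b)) := by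
        have := hm1.sub hm2
        convert this using 1
        funext y
        simp
      rw [e]
      refine (eLpNorm_add_le hm3.aestronglyMeasurable hm2.aestronglyMeasurable one_le_two).trans ?_
      refine (add_le_add h1 h2).trans (le_of_eq ?_)
      rw [← ENNReal.ofReal_add (by positivity) (by positivity)]
      congr 1; ring
    rw [← eLpNorm_two_sq]
    gcongr
  -- Jensen's inequality on the segment, followed by Tonelli's theorem.
  have hprob : IsProbabilityMeasure (volume.restrict (Icc (0 : ℝ) 1)) :=
    ⟨by rw [Measure.restrict_apply_univ, Real.volume_Icc]; simp⟩
  have hpt : ∀ᵐ y : E, ‖η ‖y + (A y - b)‖ - η ‖y‖ - D y‖ₑ ^ 2 ≤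
      ∫⁻ s in Icc (0 : ℝ) 1, ‖H s y - D y‖ₑ ^ 2 := by
    filter_upwards [hR.ae_sub_eq_integral hk hA b] with y hy
    have e : η ‖y + (A y - b)‖ - η ‖y‖ - D y = ∫ s in Icc (0 : ℝ) 1, (H s y - D y) := by
      rw [integral_sub hy.1 (integrable_const _), ← hy.2]
      simp
    have hm : Measurable fun s => H s y - D y := hHm.comp (measurable_id.prodMk measurable_const)
    rw [e]
    refine (pow_le_pow_left' (enorm_integral_le_lintegral_enorm _) 2).trans ?_
    exact sq_lintegral_le_lintegral_sq _ hm.enorm.aemeasurable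
  refine (ENNReal.pow_le_pow_left_iff two_ne_zero).1 ?_
  rw [eLpNorm_two_sq]
  calc ∫⁻ y, ‖η ‖y + (A y - b)‖ - η ‖y‖ - D y‖ₑ ^ 2
      ≤ ∫⁻ y, ∫⁻ s in Icc (0 : ℝ) 1, ‖H s y - D y‖ₑ ^ 2 := lintegral_mono_ae hpt
    _ = ∫⁻ s in Icc (0 : ℝ) 1, ∫⁻ y, ‖H s y - D y‖ₑ ^ 2 := by
        refine lintegral_lintegral_swap ?_
        exact ((hHm.comp measurable_swap).enorm.pow_const 2).aemeasurable
    _ ≤ ∫⁻ _s in Icc (0 : ℝ) 1, ENNReal.ofReal (ε * (‖A‖ + ‖b‖)) ^ 2 :=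
        setLIntegral_mono' measurableSet_Icc hbound
    _ = ENNReal.ofReal (ε * (‖A‖ + ‖b‖)) ^ 2 := by
        rw [lintegral_const, measure_univ, mul_one]

end QuadraticMean

/-! ### Convergence to zero in probability -/

section InProbability

variable {Ω : Type*} [MeasurableSpace Ω] {P : Measure Ω} {l : Filter ℕ}

/-- The sequence `Z` converges to zero in `P`-probability along `l`. -/
def VanishesInProb (P : Measure Ω) (l : Filter ℕ) (Z : ℕ → Ω → ℝ) : Prop :=
  ∀ ε, 0 < ε → Tendsto (fun n => P {ω | ε ≤ |Z n ω|}) l (𝓝 0)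

lemma tendsto_zero_of_forall_le {u : ℕ → ENNReal}
    (h : ∀ δ : ENNReal, 0 < δ → ∀ᶠ n in l, u n ≤ δ) : Tendsto u l (𝓝 0) :=
  ENNReal.tendsto_nhds_zero.2 h

lemma tendsto_zero_of_le {u v : ℕ → ENNReal} (hv : Tendsto v l (𝓝 0))
    (h : ∀ᶠ n in l, u n ≤ v n) : Tendsto u l (𝓝 0) :=
  tendsto_of_tendsto_of_tendsto_of_le_of_le' tendsto_const_nhds hv
    (Eventually.of_forall fun _ => zero_le) h

lemma VanishesInProb.add {Z Z' : ℕ → Ω → ℝ} (h : VanishesInProb P l Z)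
    (h' : VanishesInProb P l Z') : VanishesInProb P l fun n ω => Z n ω + Z' n ω := by
  intro ε hε
  have h1 := (h (ε / 2) (half_pos hε)).add (h' (ε / 2) (half_pos hε))
  rw [add_zero] at h1
  refine tendsto_zero_of_le h1 (Eventually.of_forall fun n => ?_)
  refine (measure_mono ?_).trans (measure_union_le _ _)
  intro ω hω
  by_contra hcon
  simp only [mem_union, mem_ofPred_eq, not_or, not_le] at hcon hω
  linarith [abs_add_le (Z n ω) (Z' n ω)]

lemma VanishesInProb.const_mul {Z : ℕ → Ω → ℝ} (h : VanishesInProb P l Z) {c : ℝ} (hc : c ≠ 0) :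
    VanishesInProb P l fun n ω => c * Z n ω := by
  intro ε hε
  refine (h (ε / |c|) (by positivity)).congr fun n => ?_
  congr 1
  ext ω
  simp only [mem_ofPred_eq]
  rw [div_le_iff₀ (abs_pos.2 hc), abs_mul, mul_comm]

lemma VanishesInProb.congr {Z Z' : ℕ → Ω → ℝ} (h : VanishesInProb P l Z)
    (hZ : ∀ᶠ n in l, Z n =ᵐ[P] Z' n) : VanishesInProb P l Z' := by
  intro ε hε
  refine (h ε hε).congr' ?_
  filter_upwards [hZ] with n hn
  refine measure_congr ?_
  filter_upwards [hn] with ω hω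
  refine propext ?_
  show ε ≤ |Z n ω| ↔ ε ≤ |Z' n ω|
  rw [hω]

lemma vanishesInProb_of_tendsto {c : ℕ → ℝ} (hc : Tendsto c l (𝓝 0)) :
    VanishesInProb P l fun n _ => c n := by
  intro ε hε
  refine tendsto_const_nhds.congr' ?_
  filter_upwards [hc.eventually (Metric.ball_mem_nhds 0 hε)] with n hn
  have : |c n| < ε := by simpa using hn
  symm
  convert measure_empty (μ := P)
  ext ω
  simp [this]

/-- Markov's inequality for sequences. -/
lemma vanishesInProb_of_integral_abs_le {Z : ℕ → Ω → ℝ} {c : ℕ → ℝ}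
    (hi : ∀ᶠ n in l, Integrable (Z n) P) (hle : ∀ᶠ n in l, ∫ ω, |Z n ω| ∂P ≤ c n)
    (hc : Tendsto c l (𝓝 0)) : VanishesInProb P l Z := by
  intro ε hε
  have h0 : Tendsto (fun n => ENNReal.ofReal (c n / ε)) l (𝓝 0) := by
    have := ENNReal.tendsto_ofReal (hc.div_const ε)
    simpa using this
  refine tendsto_zero_of_le h0 ?_
  filter_upwards [hi, hle] with n hn hn2
  have h2 := mul_meas_ge_le_lintegral₀ (μ := P) (f := fun ω => ‖Z n ω‖ₑ) hn.1.enorm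
    (ENNReal.ofReal ε)
  have h3 : ∫⁻ ω, ‖Z n ω‖ₑ ∂P = ENNReal.ofReal (∫ ω, |Z n ω| ∂P) := by
    rw [← ofReal_integral_norm_eq_lintegral_enorm hn]; rfl
  have h4 : {ω | ENNReal.ofReal ε ≤ ‖Z n ω‖ₑ} = {ω | ε ≤ |Z n ω|} := by
    ext ω
    simp only [mem_ofPred_eq]
    rw [← ofReal_norm, Real.norm_eq_abs, ENNReal.ofReal_le_ofReal_iff (abs_nonneg _)]
  rw [h3, h4] at h2
  rw [ENNReal.ofReal_div_of_pos hε, ENNReal.le_div_iff_mul_le (by simp [hε]) (by simp), mul_comm]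
  exact h2.trans (ENNReal.ofReal_le_ofReal hn2)

lemma vanishesInProb_of_integral_sq_le {Z : ℕ → Ω → ℝ} {c : ℕ → ℝ}
    (hi : ∀ᶠ n in l, MemLp (Z n) 2 P) (hle : ∀ᶠ n in l, ∫ ω, Z n ω ^ 2 ∂P ≤ c n)
    (hc : Tendsto c l (𝓝 0)) : VanishesInProb P l Z := by
  have h1 : VanishesInProb P l fun n ω => Z n ω ^ 2 := by
    refine vanishesInProb_of_integral_abs_le (c := c) ?_ ?_ hc
    · filter_upwards [hi] with n hn using hn.integrable_sq
    · filter_upwards [hle] with n hn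
      simp only [abs_sq]
      exact hn
  intro ε hε
  refine (h1 (ε ^ 2) (by positivity)).congr fun n => ?_
  congr 1
  ext ω
  simp only [mem_ofPred_eq]
  rw [abs_sq, ← sq_abs (Z n ω)]
  exact pow_le_pow_iff_left₀ hε.le (abs_nonneg _) two_ne_zero

end InProbability

/-! ### Sums of independent identically distributed variables -/

section IID

variable {α Ω : Type*} [MeasurableSpace α] [MeasurableSpace Ω] {P : Measure Ω}
  [IsProbabilityMeasure P] {G : Measure α}

lemma integral_abs_mul_le {f g : α → ℝ} (hf : MemLp f 2 G) (hg : MemLp g 2 G) :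
    ∫ x, |f x * g x| ∂G ≤ √(∫ x, f x ^ 2 ∂G) * √(∫ x, g x ^ 2 ∂G) := by
  have h := integral_mul_norm_le_Lp_mul_Lq (μ := G) (f := f) (g := g) Real.HolderConjugate.two_two
    (by simpa using hf) (by simpa using hg)
  simp only [Real.norm_eq_abs, Real.rpow_two, sq_abs] at h
  rw [Real.sqrt_eq_rpow, Real.sqrt_eq_rpow]
  simpa only [abs_mul] using h

/-- An independent sample `Y₀, Y₁, …` from `G`. -/
structure IsSample (Y : ℕ → Ω → α) (G : Measure α) (P : Measure Ω) : Prop where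
  measurable : ∀ i, Measurable (Y i)
  map_eq : ∀ i, P.map (Y i) = G
  indep : iIndepFun Y P

variable {Y : ℕ → Ω → α}

lemma IsSample.measurePreserving (hY : IsSample Y G P) (i : ℕ) : MeasurePreserving (Y i) P G :=
  ⟨hY.measurable i, hY.map_eq i⟩

lemma IsSample.integral_comp (hY : IsSample Y G P) (i : ℕ) {g : α → ℝ}
    (hg : AEStronglyMeasurable g G) : ∫ ω, g (Y i ω) ∂P = ∫ x, g x ∂G := by
  rw [← hY.map_eq i] at hg ⊢
  exact (integral_map (hY.measurable i).aemeasurable hg).symm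

lemma IsSample.integrable_comp (hY : IsSample Y G P) (i : ℕ) {g : α → ℝ} (hg : Integrable g G) :
    Integrable (fun ω => g (Y i ω)) P :=
  (hY.measurePreserving i).integrable_comp_of_integrable hg

lemma IsSample.memLp_comp (hY : IsSample Y G P) (i : ℕ) {g : α → ℝ} (hg : MemLp g 2 G) :
    MemLp (fun ω => g (Y i ω)) 2 P :=
  hg.comp_measurePreserving (hY.measurePreserving i)

lemma IsSample.indepFun_comp (hY : IsSample Y G P) {g : α → ℝ} (hg : AEMeasurable g G) {i j : ℕ}
    (hij : i ≠ j) : IndepFun (fun ω => g (Y i ω)) (fun ω => g (Y j ω)) P := by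
  have h := (hY.indep.indepFun hij).comp₀ (hY.measurable i).aemeasurable
    (hY.measurable j).aemeasurable (φ := g) (ψ := g) (by rwa [hY.map_eq]) (by rwa [hY.map_eq])
  exact h

lemma IsSample.identDistrib_comp (hY : IsSample Y G P) {g : α → ℝ} (hg : AEMeasurable g G)
    (i : ℕ) : IdentDistrib (fun ω => g (Y i ω)) (fun ω => g (Y 0 ω)) P P := by
  have h : IdentDistrib (Y i) (Y 0) P P :=
    ⟨(hY.measurable i).aemeasurable, (hY.measurable 0).aemeasurable, by rw [hY.map_eq, hY.map_eq]⟩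
  exact h.comp_of_aemeasurable (by rwa [hY.map_eq])

lemma IsSample.integral_sum_sq (hY : IsSample Y G P) {g : α → ℝ} (hg : MemLp g 2 G)
    (h0 : ∫ x, g x ∂G = 0) (n : ℕ) :
    ∫ ω, (∑ i ∈ Finset.range n, g (Y i ω)) ^ 2 ∂P = n * ∫ x, g x ^ 2 ∂G := by
  have hL : ∀ i ∈ Finset.range n, MemLp (fun ω => g (Y i ω)) 2 P := fun i _ => hY.memLp_comp i hg
  have hv := IndepFun.variance_sum hL fun i _ j _ hij => hY.indepFun_comp hg.1.aemeasurable hij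
  have h1 : ∀ i, Var[fun ω => g (Y i ω); P] = ∫ x, g x ^ 2 ∂G := by
    intro i
    rw [variance_of_integral_eq_zero (hY.memLp_comp i hg).1.aemeasurable
      (by rw [hY.integral_comp i hg.1, h0])]
    exact hY.integral_comp i (g := fun x => g x ^ 2) (hg.1.pow 2)
  rw [variance_of_integral_eq_zero] at hv
  · simp only [Finset.sum_apply, h1, Finset.sum_const, Finset.card_range, nsmul_eq_mul] at hv
    exact hv
  · exact (memLp_finsetSum' _ hL).1.aemeasurable
  · simp only [Finset.sum_apply]
    rw [integral_finsetSum _ fun i _ => hY.integrable_comp i (memLp_one_iff_integrable.1 (by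
      have : IsProbabilityMeasure G := by
        rw [← hY.map_eq 0]; exact Measure.isProbabilityMeasure_map (hY.measurable 0).aemeasurable
      exact hg.mono_exponent one_le_two))]
    refine Finset.sum_eq_zero fun i _ => ?_
    rw [hY.integral_comp i hg.1, h0]

lemma IsSample.integral_abs_sum_le (hY : IsSample Y G P) {g : α → ℝ} (hg : Integrable g G) (n : ℕ) :
    ∫ ω, |∑ i ∈ Finset.range n, g (Y i ω)| ∂P ≤ n * ∫ x, |g x| ∂G := by
  calc ∫ ω, |∑ i ∈ Finset.range n, g (Y i ω)| ∂P
      ≤ ∫ ω, ∑ i ∈ Finset.range n, |g (Y i ω)| ∂P := by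
        refine integral_mono (integrable_finsetSum _ fun i _ => hY.integrable_comp i hg).abs
          (integrable_finsetSum _ fun i _ => (hY.integrable_comp i hg).abs) fun ω => ?_
        exact Finset.abs_sum_le_sum_abs _ _
    _ = n * ∫ x, |g x| ∂G := by
        rw [integral_finsetSum _ fun i _ => (hY.integrable_comp i hg).abs]
        rw [Finset.sum_congr rfl fun i _ => hY.integral_comp i (g := fun x => |g x|) hg.abs.1]
        simp

lemma IsSample.isProbabilityMeasure (hY : IsSample Y G P) : IsProbabilityMeasure G := by
  rw [← hY.map_eq 0]; exact Measure.isProbabilityMeasure_map (hY.measurable 0).aemeasurable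

end IID

/-! ### Local asymptotic normality from differentiability in quadratic mean -/

section LocalAsymptoticNormality

variable {α Ω : Type*} [MeasurableSpace α] [MeasurableSpace Ω] {P : Measure Ω}
  [IsProbabilityMeasure P] {G : Measure α} {Y : ℕ → Ω → α} {l : Filter ℕ} {ζ : α → ℝ}

/-- A square integrable function has tails of order `o(n⁻¹)` at the scale `√n`. -/
lemma tendsto_mul_measureReal_lt_abs [IsProbabilityMeasure G] (hζ : MemLp ζ 2 G) {δ : ℝ}
    (hδ : 0 < δ) : Tendsto (fun n : ℕ => (n : ℝ) * G.real {x | δ * √n < |ζ x|}) atTop (𝓝 0) := by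
  have hi := hζ.integrable_sq
  have hmeas : ∀ n : ℕ, NullMeasurableSet {x | δ * √n < |ζ x|} G := fun n =>
    nullMeasurableSet_lt aemeasurable_const hζ.1.aemeasurable.abs
  have hd : Tendsto (fun n : ℕ => ∫ x, ({x | δ * √n < |ζ x|}.indicator (fun x => ζ x ^ 2)) x ∂G)
      atTop (𝓝 (∫ _, (0 : ℝ) ∂G)) := by
    refine tendsto_integral_of_dominated_convergence (fun x => ζ x ^ 2)
      (fun n => hi.1.indicator₀ (hmeas n)) hi (fun n => ae_of_all _ fun x => ?_)
      (ae_of_all _ fun x => ?_)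
    · rw [Real.norm_eq_abs]
      by_cases hx : x ∈ {x | δ * √n < |ζ x|}
      · rw [indicator_of_mem hx, abs_sq]
      · rw [indicator_of_notMem hx, abs_zero]; positivity
    · refine tendsto_const_nhds.congr' ?_
      have h1 : Tendsto (fun n : ℕ => δ * √(n : ℝ)) atTop atTop :=
        (Real.tendsto_sqrt_atTop.comp tendsto_natCast_atTop_atTop).const_mul_atTop hδ
      filter_upwards [h1.eventually_ge_atTop |ζ x|] with n hn
      rw [indicator_of_notMem]
      simpa using hn
  rw [integral_zero] at hd
  have hd2 := hd.const_mul (δ ^ 2)⁻¹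
  rw [mul_zero] at hd2
  refine tendsto_of_tendsto_of_tendsto_of_le_of_le tendsto_const_nhds hd2
    (fun n => by positivity) fun n => ?_
  have h2 : ∫ x, ({x | δ * √n < |ζ x|}.indicator (fun _ => δ ^ 2 * n)) x ∂G ≤
      ∫ x, ({x | δ * √n < |ζ x|}.indicator (fun x => ζ x ^ 2)) x ∂G := by
    refine integral_mono_ae ((integrable_const _).indicator₀ (hmeas n)) (hi.indicator₀ (hmeas n))
      (ae_of_all _ fun x => ?_)
    by_cases hx : x ∈ {x | δ * √n < |ζ x|}
    · rw [indicator_of_mem hx, indicator_of_mem hx, ← sq_abs (ζ x)]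
      have h3 : δ * √n < |ζ x| := hx
      calc δ ^ 2 * n = (δ * √n) ^ 2 := by rw [mul_pow, Real.sq_sqrt (Nat.cast_nonneg n)]
        _ ≤ |ζ x| ^ 2 := by gcongr
    · rw [indicator_of_notMem hx, indicator_of_notMem hx]
  rw [integral_indicator₀ (hmeas n), setIntegral_const, smul_eq_mul] at h2
  simp only
  rw [inv_mul_eq_div, le_div_iff₀ (by positivity)]
  linarith

lemma abs_log_one_add_sq_sub_le {x : ℝ} (hx : |x| ≤ 1 / 2) :
    |Real.log ((1 + x) ^ 2) - 2 * x + x ^ 2| ≤ 4 * |x| ^ 3 := by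
  have h := Real.abs_log_sub_add_sum_range_le (x := -x) (by rw [abs_neg]; linarith) 2
  simp only [Finset.sum_range_succ, Finset.sum_range_zero, abs_neg, sub_neg_eq_add] at h
  have h1 : |x| ^ (2 + 1) / (1 - |x|) ≤ 2 * |x| ^ 3 := by
    rw [div_le_iff₀ (by linarith)]
    show |x| ^ 3 ≤ _
    nlinarith [mul_nonneg (pow_nonneg (abs_nonneg x) 3) (sub_nonneg.2 hx)]
  have h2 := h.trans h1
  rw [Real.log_pow]
  have e : ((2 : ℕ) : ℝ) * Real.log (1 + x) - 2 * x + x ^ 2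
      = 2 * (0 + (-x) ^ (0 + 1) / (((0 : ℕ) : ℝ) + 1) + (-x) ^ (1 + 1) / (((1 : ℕ) : ℝ) + 1)
        + Real.log (1 + x)) := by
    push_cast; ring
  rw [e, abs_mul, abs_two]
  linarith

/-- If the root likelihood ratios `Λ n` are differentiable in quadratic mean with score `ζ`, at
rate `n ^ (-1/2)`, then the log-likelihood ratio of an independent sample has the expansion of a
locally asymptotically normal family. The filter `l` need not be `atTop`, so that the theorem can be
used along subsequences and ultrafilters. -/
theorem IsSample.vanishesInProb_log_sub (hY : IsSample Y G P) (hl : l ≤ atTop)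
    (hζ : MemLp ζ 2 G) (hζ0 : ∫ x, ζ x ∂G = 0) {Λ : ℕ → α → ℝ}
    (hΛ : ∀ᶠ n in l, MemLp (Λ n) 2 G) (hΛ1 : ∀ᶠ n in l, ∫ x, Λ n x ^ 2 ∂G = 1)
    (hqm : Tendsto (fun n : ℕ => (n : ℝ) * ∫ x, (Λ n x - 1 - (2 * √n)⁻¹ * ζ x) ^ 2 ∂G) l (𝓝 0)) :
    VanishesInProb P l fun n ω => ∑ i ∈ Finset.range n, Real.log (Λ n (Y i ω) ^ 2)
      - ((√n)⁻¹ * ∑ i ∈ Finset.range n, ζ (Y i ω) - 1 / 2 * ∫ x, ζ x ^ 2 ∂G) := by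
  have hG : IsProbabilityMeasure G := hY.isProbabilityMeasure
  set V := ∫ x, ζ x ^ 2 ∂G with hV
  have hV0 : 0 ≤ V := integral_nonneg fun x => sq_nonneg _
  have hζi : Integrable ζ G := hζ.integrable one_le_two
  have hpos : ∀ᶠ n : ℕ in l, 0 < n := hl (eventually_gt_atTop 0)
  -- With `W = 2 (Λ - 1)`, `log (Λ ^ 2) = W - W ^ 2 / 4 + O(|W| ^ 3)`; the remainder `r` of `W` is
  -- `o(n⁻¹)` in mean square.
  set W : ℕ → α → ℝ := fun n x => 2 * (Λ n x - 1) with hW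
  set r : ℕ → α → ℝ := fun n x => W n x - (√n)⁻¹ * ζ x with hr
  have hWL : ∀ᶠ n in l, MemLp (W n) 2 G := by
    filter_upwards [hΛ] with n hn
    exact (hn.sub (memLp_const 1)).const_mul 2
  have hrL : ∀ᶠ n in l, MemLp (r n) 2 G := by
    filter_upwards [hWL] with n hn
    exact hn.sub (hζ.const_mul _)
  set a : ℕ → ℝ := fun n => (n : ℝ) * ∫ x, r n x ^ 2 ∂G with ha
  have ha0 : ∀ n, 0 ≤ a n := fun n => mul_nonneg (Nat.cast_nonneg n)
    (integral_nonneg fun x => sq_nonneg _)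
  have hat : Tendsto a l (𝓝 0) := by
    have h1 := hqm.const_mul 4
    rw [mul_zero] at h1
    refine h1.congr fun n => ?_
    have : ∀ x, r n x ^ 2 = 4 * (Λ n x - 1 - (2 * √n)⁻¹ * ζ x) ^ 2 := fun x => by
      simp only [hr, hW]; rw [mul_inv]; ring
    simp only [ha, this]
    rw [integral_const_mul]; ring
  -- By the Cauchy–Schwarz inequality the cross term of `W ^ 2` is negligible too.
  set q : ℕ → ℝ := fun n => √n * ∫ x, |ζ x * r n x| ∂G with hq
  have hqle : ∀ᶠ n in l, q n ≤ √V * √(a n) := by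
    filter_upwards [hrL] with n hn
    calc q n ≤ √n * (√V * √(∫ x, r n x ^ 2 ∂G)) := by
          exact mul_le_mul_of_nonneg_left (integral_abs_mul_le hζ hn) (Real.sqrt_nonneg _)
      _ = √V * √(a n) := by rw [ha, Real.sqrt_mul (Nat.cast_nonneg n)]; ring
  have hqt : Tendsto q l (𝓝 0) := by
    have h1 : Tendsto (fun n => √V * √(a n)) l (𝓝 0) := by
      have := (Real.continuous_sqrt.tendsto 0).comp hat
      rw [Real.sqrt_zero] at this
      simpa using this.const_mul √V
    refine tendsto_of_tendsto_of_tendsto_of_le_of_le' tendsto_const_nhds h1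
      (Eventually.of_forall fun n => ?_) hqle
    exact mul_nonneg (Real.sqrt_nonneg _) (integral_nonneg fun x => abs_nonneg _)
  -- Hence `n W ^ 2` is close to `ζ ^ 2` in mean, and `n ∫ W ^ 2` tends to `V`.
  have hdiff : ∀ᶠ n : ℕ in l,
      (n : ℝ) * ∫ x, |W n x ^ 2 - (n : ℝ)⁻¹ * ζ x ^ 2| ∂G ≤ 2 * q n + a n := by
    filter_upwards [hrL, hpos, hWL] with n hn hn0 hnW
    have hnp : (0 : ℝ) < n := Nat.cast_pos.2 hn0
    have hs : 0 < √(n : ℝ) := Real.sqrt_pos.2 hnp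
    have hss : √(n : ℝ) * √n = n := Real.mul_self_sqrt hnp.le
    have hi1 : Integrable (fun x => |ζ x * r n x|) G := (hζ.integrable_mul hn).abs
    have hi2 : Integrable (fun x => r n x ^ 2) G := hn.integrable_sq
    have h1 : ∫ x, |W n x ^ 2 - (n : ℝ)⁻¹ * ζ x ^ 2| ∂G ≤
        ∫ x, (2 * (√n)⁻¹ * |ζ x * r n x| + r n x ^ 2) ∂G := by
      refine integral_mono (hnW.integrable_sq.sub (hζ.integrable_sq.const_mul _)).abs
        ((hi1.const_mul _).add hi2) fun x => ?_
      have e : W n x ^ 2 - (n : ℝ)⁻¹ * ζ x ^ 2 = 2 * (√n)⁻¹ * (ζ x * r n x) + r n x ^ 2 := by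
        have : W n x = r n x + (√n)⁻¹ * ζ x := by simp only [hr]; ring
        have hinv : (n : ℝ)⁻¹ = (√n)⁻¹ * (√n)⁻¹ := by rw [← mul_inv, hss]
        rw [this, hinv]; ring
      simp only
      rw [e]
      refine (abs_add_le _ _).trans ?_
      rw [abs_mul, abs_of_nonneg (show 0 ≤ 2 * (√(n : ℝ))⁻¹ by positivity), abs_sq]
    rw [integral_add (hi1.const_mul _) hi2, integral_const_mul] at h1
    calc (n : ℝ) * ∫ x, |W n x ^ 2 - (n : ℝ)⁻¹ * ζ x ^ 2| ∂G
        ≤ n * (2 * (√n)⁻¹ * ∫ x, |ζ x * r n x| ∂G + ∫ x, r n x ^ 2 ∂G) := by gcongr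
      _ = 2 * q n + a n := by
          simp only [hq, ha]
          have : (n : ℝ) * (√n)⁻¹ = √n := by rw [← div_eq_mul_inv, div_eq_iff hs.ne', hss]
          linear_combination (2 * ∫ x, |ζ x * r n x| ∂G) * this
  have hqa : Tendsto (fun n => 2 * q n + a n) l (𝓝 0) := by
    simpa using (hqt.const_mul 2).add hat
  set m : ℕ → ℝ := fun n => (n : ℝ) * ∫ x, W n x ^ 2 ∂G with hm
  have hmt : Tendsto m l (𝓝 V) := by
    rw [tendsto_iff_dist_tendsto_zero]
    refine tendsto_of_tendsto_of_tendsto_of_le_of_le' tendsto_const_nhds hqa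
      (Eventually.of_forall fun n => dist_nonneg) ?_
    filter_upwards [hdiff, hpos, hWL] with n hn hn0 hnW
    have hnp : (0 : ℝ) < n := Nat.cast_pos.2 hn0
    refine le_trans ?_ hn
    have e : m n - V = n * ∫ x, (W n x ^ 2 - (n : ℝ)⁻¹ * ζ x ^ 2) ∂G := by
      rw [integral_sub hnW.integrable_sq (hζ.integrable_sq.const_mul _), integral_const_mul,
        mul_sub, ← mul_assoc, mul_inv_cancel₀ hnp.ne', one_mul]
    rw [Real.dist_eq, e, abs_mul, abs_of_pos hnp]
    gcongr
    exact abs_integral_le_integral_abs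
  -- Since `∫ Λ ^ 2 = 1`, the means of the remainders sum to `-V / 4` in the limit.
  have hmean : ∀ᶠ n in l, ∫ x, r n x ∂G = -(1 / 4) * ∫ x, W n x ^ 2 ∂G := by
    filter_upwards [hΛ, hΛ1, hWL] with n hn hn1 hnW
    have hni : Integrable (Λ n) G := hn.integrable one_le_two
    have e1 : ∫ x, r n x ∂G = 2 * (∫ x, Λ n x ∂G - 1) := by
      simp only [hr]
      rw [integral_sub (hnW.integrable one_le_two) (hζi.const_mul _),
        integral_const_mul (√(n : ℝ))⁻¹, hζ0, mul_zero, sub_zero]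
      simp only [hW]
      rw [integral_const_mul, integral_sub hni (integrable_const _)]
      simp
    have e2 : ∫ x, W n x ^ 2 ∂G = 4 * (2 - 2 * ∫ x, Λ n x ∂G) := by
      have : ∀ x, W n x ^ 2 = 4 * (Λ n x ^ 2 + (1 - 2 * Λ n x)) := fun x => by
        simp only [hW]; ring
      simp only [this]
      have hi1 : Integrable (fun x => 1 - 2 * Λ n x) G := (integrable_const _).sub (hni.const_mul 2)
      rw [integral_const_mul, integral_add hn.integrable_sq hi1, hn1,
        integral_sub (integrable_const _) (hni.const_mul 2), integral_const_mul]
      simp only [integral_const, probReal_univ, smul_eq_mul]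
      ring
    rw [e1, e2]; ring
  -- The centred sum of the remainders has variance at most `a n`.
  have hZ1 : VanishesInProb P l fun n ω =>
      ∑ i ∈ Finset.range n, (r n (Y i ω) - ∫ x, r n x ∂G) := by
    refine vanishesInProb_of_integral_sq_le (c := a) ?_ ?_ hat
    · filter_upwards [hrL] with n hn
      exact memLp_finsetSum _ fun i _ => (hY.memLp_comp i hn).sub (memLp_const _)
    · filter_upwards [hrL] with n hn
      have hni : Integrable (r n) G := hn.integrable one_le_two
      rw [hY.integral_sum_sq (g := fun x => r n x - ∫ x, r n x ∂G) (hn.sub (memLp_const _))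
        (by rw [integral_sub hni (integrable_const _)]; simp)]
      have h1 := variance_eq_integral hni.1.aemeasurable
      have h2 := variance_le_expectation_sq (X := r n) hn.1
      rw [h1] at h2
      exact mul_le_mul_of_nonneg_left h2 (Nat.cast_nonneg n)
  -- The sum of squares follows the law of large numbers for `ζ ^ 2`.
  have hZ2 : VanishesInProb P l fun n ω => ∑ i ∈ Finset.range n, W n (Y i ω) ^ 2 - V := by
    have h1 : VanishesInProb P l fun n ω =>
        ∑ i ∈ Finset.range n, (W n (Y i ω) ^ 2 - (n : ℝ)⁻¹ * ζ (Y i ω) ^ 2) := by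
      refine vanishesInProb_of_integral_abs_le (c := fun n => 2 * q n + a n) ?_ ?_ hqa
      · filter_upwards [hWL] with n hn
        exact integrable_finsetSum _ fun i _ => hY.integrable_comp i
          (g := fun x => W n x ^ 2 - (n : ℝ)⁻¹ * ζ x ^ 2)
          (hn.integrable_sq.sub (hζ.integrable_sq.const_mul _))
      · filter_upwards [hWL, hdiff] with n hn hnd
        exact (hY.integral_abs_sum_le (g := fun x => W n x ^ 2 - (n : ℝ)⁻¹ * ζ x ^ 2)
          (hn.integrable_sq.sub (hζ.integrable_sq.const_mul _)) n).trans hnd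
    have h2 : VanishesInProb P l fun n ω => (∑ i ∈ Finset.range n, ζ (Y i ω) ^ 2) / n - V := by
      have hsq : AEMeasurable (fun x => ζ x ^ 2) G := hζ.1.aemeasurable.pow_const 2
      have hlln := strong_law_ae_real (μ := P) (fun i ω => ζ (Y i ω) ^ 2)
        (hY.integrable_comp 0 (g := fun x => ζ x ^ 2) hζ.integrable_sq)
        (fun i j hij => hY.indepFun_comp hsq hij) (fun i => hY.identDistrib_comp hsq i)
      rw [hY.integral_comp 0 (g := fun x => ζ x ^ 2) hζ.integrable_sq.1] at hlln
      have hmeas : ∀ n : ℕ, AEStronglyMeasurable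
          (fun ω => (∑ i ∈ Finset.range n, ζ (Y i ω) ^ 2) / (n : ℝ)) P := fun n => by
        have := (integrable_finsetSum (Finset.range n) fun i _ => hY.integrable_comp i
          (g := fun x => ζ x ^ 2) hζ.integrable_sq).div_const (n : ℝ)
        exact this.1
      have h3 := tendstoInMeasure_of_tendsto_ae hmeas hlln
      rw [tendstoInMeasure_iff_norm] at h3
      intro ε hε
      exact (h3 ε hε).mono_left hl
    refine (h1.add h2).congr (Eventually.of_forall fun n => ae_of_all _ fun ω => ?_)
    simp only [Finset.sum_sub_distrib, ← Finset.mul_sum]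
    ring
  -- All increments are small with high probability, which makes the expansion of the logarithm
  -- legitimate.
  have hlarge : ∀ δ : ℝ, 0 < δ →
      Tendsto (fun n : ℕ => (n : ℝ) * G.real {x | δ < |W n x|}) l (𝓝 0) := by
    intro δ hδ
    have h1 := (tendsto_mul_measureReal_lt_abs hζ (half_pos hδ)).mono_left hl
    have h2 := hat.const_mul ((δ / 2) ^ 2)⁻¹
    rw [mul_zero] at h2
    have h3 := h1.add h2
    rw [add_zero] at h3
    refine tendsto_of_tendsto_of_tendsto_of_le_of_le' tendsto_const_nhds h3
      (Eventually.of_forall fun n => by positivity) ?_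
    filter_upwards [hrL, hpos] with n hn hn0
    have hnp : (0 : ℝ) < n := Nat.cast_pos.2 hn0
    have hs : 0 < √(n : ℝ) := Real.sqrt_pos.2 hnp
    have hsub : {x | δ < |W n x|} ⊆ {x | δ / 2 * √n < |ζ x|} ∪ {x | (δ / 2) ^ 2 ≤ r n x ^ 2} := by
      intro x hx
      by_contra hcon
      simp only [mem_union, mem_ofPred_eq, not_or, not_le, not_lt] at hcon hx
      have h4 : |r n x| < δ / 2 := by
        have := sq_lt_sq.1 hcon.2
        rwa [abs_of_pos (half_pos hδ)] at this
      have h5 : |(√n)⁻¹ * ζ x| ≤ δ / 2 := by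
        rw [abs_mul, abs_of_pos (inv_pos.2 hs), inv_mul_le_iff₀ hs]
        linarith [hcon.1]
      have h6 : W n x = r n x + (√n)⁻¹ * ζ x := by simp only [hr]; ring
      rw [h6] at hx
      linarith [abs_add_le (r n x) ((√n)⁻¹ * ζ x)]
    have h7 : G.real {x | (δ / 2) ^ 2 ≤ r n x ^ 2} ≤ ((δ / 2) ^ 2)⁻¹ * ∫ x, r n x ^ 2 ∂G := by
      have := mul_meas_ge_le_integral_of_nonneg (ae_of_all G fun x => sq_nonneg (r n x))
        hn.integrable_sq ((δ / 2) ^ 2)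
      rw [le_inv_mul_iff₀ (by positivity)]
      exact this
    calc (n : ℝ) * G.real {x | δ < |W n x|}
        ≤ n * (G.real {x | δ / 2 * √n < |ζ x|} + G.real {x | (δ / 2) ^ 2 ≤ r n x ^ 2}) := by
          gcongr
          exact (measureReal_mono hsub).trans (measureReal_union_le _ _)
      _ ≤ n * (G.real {x | δ / 2 * √n < |ζ x|} + ((δ / 2) ^ 2)⁻¹ * ∫ x, r n x ^ 2 ∂G) := by
          gcongr
      _ = _ := by simp only [ha]; ring
  -- The cubic remainder is at most `max |W|` times the sum of squares.
  have hZ3 : VanishesInProb P l fun n ω => ∑ i ∈ Finset.range n,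
      (Real.log (Λ n (Y i ω) ^ 2) - W n (Y i ω) + 1 / 4 * W n (Y i ω) ^ 2) := by
    intro ε hε
    refine tendsto_zero_of_forall_le fun κ hκ => ?_
    obtain ⟨κ', hκ'0, hκ'⟩ : ∃ κ' : ℝ, 0 < κ' ∧ ENNReal.ofReal κ' ≤ κ := by
      obtain ⟨c, hc0, hc⟩ := ENNReal.lt_iff_exists_nnreal_btwn.1 hκ
      exact ⟨c, by exact_mod_cast hc0, by rw [ENNReal.ofReal_coe_nnreal]; exact hc.le⟩
    obtain ⟨δ, hδ0, hδ1, hδ⟩ : ∃ δ : ℝ, 0 < δ ∧ δ ≤ 1 ∧ δ * (V + 1) / (2 * ε) ≤ κ' / 2 := by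
      refine ⟨min 1 (κ' * ε / (V + 1)), by positivity, min_le_left _ _, ?_⟩
      have : min 1 (κ' * ε / (V + 1)) * (V + 1) ≤ κ' * ε := by
        rw [← le_div_iff₀ (by positivity)]
        exact min_le_right _ _
      rw [div_le_iff₀ (by positivity)]
      linarith
    filter_upwards [(hlarge δ hδ0).eventually (ge_mem_nhds (half_pos hκ'0)),
      hmt.eventually (ge_mem_nhds (lt_add_one V)), hWL] with n hn1 hn2 hn3
    refine le_trans ?_ hκ'
    have hsub : {ω | ε ≤ |∑ i ∈ Finset.range n,
        (Real.log (Λ n (Y i ω) ^ 2) - W n (Y i ω) + 1 / 4 * W n (Y i ω) ^ 2)|} ⊆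
        (⋃ i ∈ Finset.range n, Y i ⁻¹' {x | δ < |W n x|}) ∪
          {ω | ε ≤ δ / 2 * ∑ i ∈ Finset.range n, W n (Y i ω) ^ 2} := by
      intro ω hω
      by_cases hb : ∃ i ∈ Finset.range n, δ < |W n (Y i ω)|
      · obtain ⟨i, hi, hi2⟩ := hb
        exact Or.inl (mem_biUnion (show i ∈ (↑(Finset.range n) : Set ℕ) from hi) hi2)
      · push Not at hb
        refine Or.inr (le_trans (show ε ≤ _ from hω) ?_)
        refine (Finset.abs_sum_le_sum_abs _ _).trans ?_
        rw [Finset.mul_sum]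
        refine Finset.sum_le_sum fun i hi => ?_
        have hw := hb i hi
        set w := W n (Y i ω) with hw0
        have hw2 : |w / 2| ≤ 1 / 2 := by rw [abs_div, abs_two]; linarith
        have h4 := abs_log_one_add_sq_sub_le hw2
        have e1 : Λ n (Y i ω) = 1 + w / 2 := by rw [hw0, hW]; ring
        have e2 : Real.log (Λ n (Y i ω) ^ 2) - w + 1 / 4 * w ^ 2
            = Real.log ((1 + w / 2) ^ 2) - 2 * (w / 2) + (w / 2) ^ 2 := by rw [e1]; ring
        rw [e2]
        refine h4.trans ?_
        rw [abs_div, abs_two]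
        calc 4 * (|w| / 2) ^ 3 = 1 / 2 * |w| * |w| ^ 2 := by ring
          _ ≤ 1 / 2 * δ * |w| ^ 2 := by gcongr
          _ = δ / 2 * w ^ 2 := by rw [sq_abs]; ring
    have hP1 : P (⋃ i ∈ Finset.range n, Y i ⁻¹' {x | δ < |W n x|}) ≤ ENNReal.ofReal (κ' / 2) := by
      refine (measure_biUnion_finset_le _ _).trans ?_
      have hnull : NullMeasurableSet {x | δ < |W n x|} G :=
        nullMeasurableSet_lt aemeasurable_const hn3.1.aemeasurable.abs
      have : ∀ i ∈ Finset.range n, P (Y i ⁻¹' {x | δ < |W n x|})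
          = ENNReal.ofReal (G.real {x | δ < |W n x|}) := fun i _ => by
        rw [(hY.measurePreserving i).measure_preimage hnull, ofReal_measureReal]
      rw [Finset.sum_congr rfl this, Finset.sum_const, Finset.card_range, nsmul_eq_mul,
        ← ENNReal.ofReal_natCast, ← ENNReal.ofReal_mul (Nat.cast_nonneg n)]
      exact ENNReal.ofReal_le_ofReal hn1
    have hP2 : P {ω | ε ≤ δ / 2 * ∑ i ∈ Finset.range n, W n (Y i ω) ^ 2}
        ≤ ENNReal.ofReal (κ' / 2) := by
      have hint : Integrable (fun ω => δ / 2 * ∑ i ∈ Finset.range n, W n (Y i ω) ^ 2) P :=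
        (integrable_finsetSum _ fun i _ => hY.integrable_comp i (g := fun x => W n x ^ 2)
          hn3.integrable_sq).const_mul _
      have h5 := mul_meas_ge_le_integral_of_nonneg (μ := P)
        (f := fun ω => δ / 2 * ∑ i ∈ Finset.range n, W n (Y i ω) ^ 2)
        (ae_of_all _ fun ω => mul_nonneg (by positivity)
          (Finset.sum_nonneg fun i _ => sq_nonneg _)) hint ε
      rw [integral_const_mul, integral_finsetSum _ fun i _ => hY.integrable_comp i
        (g := fun x => W n x ^ 2) hn3.integrable_sq,
        Finset.sum_congr rfl fun i _ => hY.integral_comp i (g := fun x => W n x ^ 2)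
          hn3.integrable_sq.1, Finset.sum_const, Finset.card_range, nsmul_eq_mul] at h5
      have h6 : P.real {ω | ε ≤ δ / 2 * ∑ i ∈ Finset.range n, W n (Y i ω) ^ 2} ≤ κ' / 2 := by
        refine le_trans ?_ hδ
        rw [le_div_iff₀ (by positivity)]
        have h7 : δ / 2 * m n ≤ δ / 2 * (V + 1) := by gcongr
        have h8 := h5.trans h7
        linarith
      rw [← ofReal_measureReal (by finiteness)]
      exact ENNReal.ofReal_le_ofReal h6
    calc P _ ≤ _ := measure_mono hsub
      _ ≤ ENNReal.ofReal (κ' / 2) + ENNReal.ofReal (κ' / 2) :=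
          (measure_union_le _ _).trans (add_le_add hP1 hP2)
      _ = ENNReal.ofReal κ' := by
          rw [← ENNReal.ofReal_add (by positivity) (by positivity), add_halves]
  -- The constant `-V / 2` is the sum of `-V / 4` from the means and `-V / 4` from the squares.
  have hdet : VanishesInProb P l fun n _ => -(1 / 4) * m n + 1 / 4 * V := by
    refine vanishesInProb_of_tendsto ?_
    have := (hmt.const_mul (-(1 / 4))).add_const (1 / 4 * V)
    simpa using this
  refine ((hZ1.add hdet).add ((hZ2.const_mul (c := -(1 / 4)) (by norm_num)).add hZ3)).congr ?_
  filter_upwards [hmean] with n hn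
  refine ae_of_all _ fun ω => ?_
  have e : ∀ i, r n (Y i ω) = W n (Y i ω) - (√n)⁻¹ * ζ (Y i ω) := fun i => rfl
  simp only [Finset.sum_sub_distrib, Finset.sum_add_distrib, ← Finset.mul_sum, Finset.sum_const,
    Finset.card_range, nsmul_eq_mul, hn, e, hm]
  ring

/-- The central limit theorem, in terms of characteristic functions, for normalized sums of
variables `ζ' n (Y i)` when `ζ' n` converges to `ζ` in `L²`. -/
theorem IsSample.tendsto_integral_exp (hY : IsSample Y G P) (hζ : MemLp ζ 2 G)
    (hζ0 : ∫ x, ζ x ∂G = 0) {ζ' : ℕ → α → ℝ} (hζ' : ∀ n, MemLp (ζ' n) 2 G)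
    (hζ'0 : ∀ n, ∫ x, ζ' n x ∂G = 0)
    (hlim : Tendsto (fun n => ∫ x, (ζ' n x - ζ x) ^ 2 ∂G) atTop (𝓝 0)) :
    Tendsto (fun n : ℕ => ∫ ω, Complex.exp ((((√n)⁻¹ * ∑ i ∈ Finset.range n, ζ' n (Y i ω) : ℝ) : ℂ)
      * Complex.I) ∂P) atTop (𝓝 (Complex.exp (-(((∫ x, ζ x ^ 2 ∂G) / 2 : ℝ) : ℂ)))) := by
  have hG : IsProbabilityMeasure G := hY.isProbabilityMeasure
  have hmean : ∫ ω, ζ (Y 0 ω) ∂P = 0 := by rw [hY.integral_comp 0 hζ.1, hζ0]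
  have hvar : Var[fun ω => ζ (Y 0 ω); P] = ∫ x, ζ x ^ 2 ∂G := by
    rw [variance_of_integral_eq_zero (hY.memLp_comp 0 hζ).1.aemeasurable hmean]
    exact hY.integral_comp 0 (g := fun x => ζ x ^ 2) (hζ.1.pow 2)
  have hindep : iIndepFun (fun i ω => ζ (Y i ω)) P := by
    have h := hY.indep.comp₀ (fun _ => ζ) (fun i => (hY.measurable i).aemeasurable)
      (fun i => by rw [hY.map_eq]; exact hζ.1.aemeasurable)
    exact h
  have hclt := tendstoInDistribution_inv_sqrt_mul_sum_sub (P := P)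
    (P' := gaussianReal 0 (Var[fun ω => ζ (Y 0 ω); P]).toNNReal) (Y := id)
    (X := fun i ω => ζ (Y i ω)) .id (hY.memLp_comp 0 hζ) hindep
    (fun i => hY.identDistrib_comp hζ.1.aemeasurable i)
  have hch := ProbabilityMeasure.tendsto_iff_tendsto_charFun.1 hclt.tendsto 1
  simp only [ProbabilityMeasure.coe_mk, Measure.map_id, charFun_gaussianReal, hmean, mul_zero,
    sub_zero, hvar] at hch
  have hbase : Tendsto (fun n : ℕ => ∫ ω, Complex.exp ((((√n)⁻¹ * ∑ i ∈ Finset.range n, ζ (Y i ω)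
      : ℝ) : ℂ) * Complex.I) ∂P) atTop (𝓝 (Complex.exp (-(((∫ x, ζ x ^ 2 ∂G) / 2 : ℝ) : ℂ)))) := by
    have e : Complex.exp (((1 : ℝ) : ℂ) * ((0 : ℝ) : ℂ) * Complex.I
        - (((∫ x, ζ x ^ 2 ∂G).toNNReal : ℝ) : ℂ) * ((1 : ℝ) : ℂ) ^ 2 / 2)
        = Complex.exp (-(((∫ x, ζ x ^ 2 ∂G) / 2 : ℝ) : ℂ)) := by
      rw [Real.coe_toNNReal _ (integral_nonneg fun x => sq_nonneg _)]
      congr 1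
      push_cast
      ring
    rw [← e]
    refine hch.congr fun n => ?_
    rw [charFun_apply_real, integral_map]
    · simp
    · exact ((integrable_finsetSum _ fun i _ => hY.integrable_comp i
        (hζ.integrable one_le_two)).const_mul _).1.aemeasurable
    · fun_prop
  -- Replacing the summands changes the normalized sums by a term that is small in `L²`.
  have hdiff : Tendsto (fun n : ℕ => ∫ ω, Complex.exp ((((√n)⁻¹ * ∑ i ∈ Finset.range n,
      ζ' n (Y i ω) : ℝ) : ℂ) * Complex.I) ∂P - ∫ ω, Complex.exp ((((√n)⁻¹ *
        ∑ i ∈ Finset.range n, ζ (Y i ω) : ℝ) : ℂ) * Complex.I) ∂P) atTop (𝓝 0) := by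
    have hsq : Tendsto (fun n => √(∫ x, (ζ' n x - ζ x) ^ 2 ∂G)) atTop (𝓝 0) := by
      have := (Real.continuous_sqrt.tendsto 0).comp hlim
      rwa [Real.sqrt_zero] at this
    refine squeeze_zero_norm (fun n => ?_) hsq
    have hSL : ∀ {g : α → ℝ}, MemLp g 2 G →
        MemLp (fun ω => (√n)⁻¹ * ∑ i ∈ Finset.range n, g (Y i ω)) 2 P := fun {g} hg =>
      (memLp_finsetSum _ fun i _ => hY.memLp_comp i hg).const_mul _
    have hint : ∀ {g : α → ℝ}, MemLp g 2 G → Integrable (fun ω => Complex.exp ((((√n)⁻¹ *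
        ∑ i ∈ Finset.range n, g (Y i ω) : ℝ) : ℂ) * Complex.I)) P := by
      intro g hg
      refine Integrable.of_bound (C := 1) ?_ (ae_of_all _ fun ω => ?_)
      · have h1 := (hSL hg).1
        have h2 : Continuous fun x : ℝ => Complex.exp ((x : ℂ) * Complex.I) := by fun_prop
        exact h2.comp_aestronglyMeasurable h1
      · rw [Complex.norm_exp_ofReal_mul_I]
    have hd := (hζ' n).sub hζ
    rw [← integral_sub (hint (hζ' n)) (hint hζ)]
    have hpt : ∀ x y : ℝ, ‖Complex.exp ((x : ℂ) * Complex.I) - Complex.exp ((y : ℂ) * Complex.I)‖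
        ≤ |x - y| := by
      intro x y
      have e : Complex.exp ((x : ℂ) * Complex.I) - Complex.exp ((y : ℂ) * Complex.I)
          = Complex.exp ((y : ℂ) * Complex.I)
            * (Complex.exp (Complex.I * ((x - y : ℝ) : ℂ)) - 1) := by
        rw [mul_sub, mul_one, ← Complex.exp_add]
        congr 2
        push_cast
        ring
      rw [e, norm_mul, Complex.norm_exp_ofReal_mul_I, one_mul]
      exact Real.norm_exp_I_mul_ofReal_sub_one_le
    set S : Ω → ℝ := fun ω => (√n)⁻¹ * ∑ i ∈ Finset.range n, (ζ' n - ζ) (Y i ω) with hS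
    have hSm : MemLp S 2 P := hSL hd
    calc ‖∫ ω, _ ∂P‖ ≤ ∫ ω, |S ω| ∂P := by
          refine norm_integral_le_of_norm_le (hSm.integrable one_le_two).abs
            (ae_of_all _ fun ω => ?_)
          refine (hpt _ _).trans (le_of_eq ?_)
          rw [hS]
          simp only [Pi.sub_apply, Finset.sum_sub_distrib, mul_sub]
      _ ≤ √(∫ ω, S ω ^ 2 ∂P) := by
          have := integral_abs_mul_le hSm (memLp_const (1 : ℝ))
          simpa using this
      _ ≤ √(∫ x, (ζ' n x - ζ x) ^ 2 ∂G) := by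
          refine Real.sqrt_le_sqrt ?_
          have h0 : ∫ x, (ζ' n - ζ) x ∂G = 0 := by
            simp only [Pi.sub_apply]
            rw [integral_sub ((hζ' n).integrable one_le_two) (hζ.integrable one_le_two), hζ'0, hζ0,
              sub_zero]
          have hs := hY.integral_sum_sq hd h0 n
          simp only [hS, mul_pow]
          rw [integral_const_mul, hs, inv_pow, Real.sq_sqrt (Nat.cast_nonneg n)]
          rcases Nat.eq_zero_or_pos n with h | h
          · rw [h]
            simp only [Nat.cast_zero, zero_mul, mul_zero]
            exact integral_nonneg fun x => sq_nonneg _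
          · rw [← mul_assoc, inv_mul_cancel₀ (Nat.cast_pos.2 h).ne', one_mul]
            simp only [Pi.sub_apply]
            exact le_rfl
  have := hdiff.add hbase
  simpa using this

end LocalAsymptoticNormality

/-! ### Moments of spherically symmetric measures -/

section SphericalMoments

variable {E : Type*} [NormedAddCommGroup E] [InnerProductSpace ℝ E] [FiniteDimensional ℝ E]
  [MeasurableSpace E] [BorelSpace E] {μ : Measure E} {F : ℝ → ℝ}

/-- Invariance under all linear isometries. -/
def IsSpherical (μ : Measure E) : Prop := ∀ L : E ≃ₗᵢ[ℝ] E, MeasurePreserving L μ μ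

lemma IsSpherical.integral_comp (hμ : IsSpherical μ) (L : E ≃ₗᵢ[ℝ] E) (Ψ : E → ℝ) :
    ∫ y, Ψ (L y) ∂μ = ∫ y, Ψ y ∂μ :=
  (hμ L).integral_comp L.toHomeomorph.measurableEmbedding Ψ

lemma IsSpherical.integral_odd (hμ : IsSpherical μ) {Ψ : E → ℝ} (h : ∀ y, Ψ (-y) = -Ψ y) :
    ∫ y, Ψ y ∂μ = 0 := by
  have h1 := hμ.integral_comp (LinearIsometryEquiv.neg ℝ) Ψ
  simp only [LinearIsometryEquiv.coe_neg, h, integral_neg] at h1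
  linarith

/-- Moments in one direction depend only on the norm of the direction: a reflection exchanges two
directions of equal norm. -/
lemma IsSpherical.integral_inner_pow (hμ : IsSpherical μ) (F : ℝ → ℝ) (p : ℕ) {v w : E}
    (h : ‖v‖ = ‖w‖) :
    ∫ y, F ‖y‖ * inner ℝ v y ^ p ∂μ = ∫ y, F ‖y‖ * inner ℝ w y ^ p ∂μ := by
  set L := (ℝ ∙ (v - w))ᗮ.reflection with hL
  have hLv : L v = w := Submodule.reflection_sub h
  rw [← hμ.integral_comp L]
  refine integral_congr_ae (ae_of_all _ fun y => ?_)
  simp only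
  rw [L.norm_map]
  have : inner ℝ v (L y) = inner ℝ w y := by
    rw [← hLv, ← L.inner_map_map (L v) y, hL, Submodule.reflection_reflection]
  rw [this]

lemma integrable_mul_of_norm_le {g : E → ℝ} (hF : Integrable (fun y => F ‖y‖) μ)
    (hg : Measurable g) {C : ℝ} (hC : ∀ y, |g y| ≤ C) : Integrable (fun y => F ‖y‖ * g y) μ :=
  hF.mul_bdd hg.aestronglyMeasurable (c := C) (ae_of_all _ hC)

lemma abs_inner_div_norm_le (v y : E) : |inner ℝ v y / ‖y‖| ≤ ‖v‖ := by
  rw [abs_div, abs_norm]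
  rcases eq_or_ne y 0 with rfl | hy
  · simp
  · rw [div_le_iff₀ (norm_pos_iff.2 hy)]
    exact abs_real_inner_le_norm _ _

lemma integrable_inner_div_pow (hF : Integrable (fun y => F ‖y‖) μ) (v w : E) (p q : ℕ) :
    Integrable (fun y => F ‖y‖ * ((inner ℝ v y / ‖y‖) ^ p * (inner ℝ w y / ‖y‖) ^ q)) μ := by
  refine integrable_mul_of_norm_le hF (by fun_prop) (C := ‖v‖ ^ p * ‖w‖ ^ q) fun y => ?_
  rw [abs_mul, abs_pow, abs_pow]
  gcongr
  · exact abs_inner_div_norm_le v y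
  · exact abs_inner_div_norm_le w y

lemma IsSpherical.integral_inner_div_pow (hμ : IsSpherical μ) (F : ℝ → ℝ) (p : ℕ) {v w : E}
    (h : ‖v‖ = ‖w‖) : ∫ y, F ‖y‖ * (inner ℝ v y / ‖y‖) ^ p ∂μ
      = ∫ y, F ‖y‖ * (inner ℝ w y / ‖y‖) ^ p ∂μ := by
  have e : ∀ v : E, (fun y => F ‖y‖ * (inner ℝ v y / ‖y‖) ^ p)
      = fun y => (fun r => F r / r ^ p) ‖y‖ * inner ℝ v y ^ p := fun v => by
    funext y
    simp only [div_pow]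
    ring
  rw [e v, e w]
  exact hμ.integral_inner_pow (fun r => F r / r ^ p) p h

variable {k : ℕ} [NeZero k]

lemma sum_sq_inner_div_norm {ι : Type*} [Fintype ι] (e : OrthonormalBasis ι ℝ E) {y : E}
    (hy : y ≠ 0) : ∑ i, (inner ℝ (e i) y / ‖y‖) ^ 2 = 1 := by
  have h : ∑ i, inner ℝ (e i) y ^ 2 = ‖y‖ ^ 2 := by
    have := e.sum_sq_norm_inner_right y
    simpa using this
  simp only [div_pow]
  rw [← Finset.sum_div, h, div_self]
  positivity

lemma IsSpherical.integral_inner_sq (hμ : IsSpherical μ) (hμ0 : μ {0} = 0)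
    (hk : Module.finrank ℝ E = k) (hF : Integrable (fun y => F ‖y‖) μ)
    (v : E) : ∫ y, F ‖y‖ * (inner ℝ v y / ‖y‖) ^ 2 ∂μ = ‖v‖ ^ 2 / k * ∫ y, F ‖y‖ ∂μ := by
  have hk0 : (k : ℝ) ≠ 0 := Nat.cast_ne_zero.2 (NeZero.ne k)
  set e := (stdOrthonormalBasis ℝ E).reindex (finCongr hk) with he
  have hne : ∀ᵐ y ∂μ, y ≠ 0 := measure_eq_zero_iff_ae_notMem.1 hμ0
  have hint : ∀ v : E, Integrable (fun y => F ‖y‖ * (inner ℝ v y / ‖y‖) ^ 2) μ := fun v => by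
    simpa using integrable_inner_div_pow hF v v 2 0
  have h1 : ∫ y, F ‖y‖ ∂μ = ∑ i, ∫ y, F ‖y‖ * (inner ℝ (e i) y / ‖y‖) ^ 2 ∂μ := by
    rw [← integral_finsetSum _ fun i _ => hint (e i)]
    refine integral_congr_ae ?_
    filter_upwards [hne] with y hy
    rw [← Finset.mul_sum, sum_sq_inner_div_norm e hy, mul_one]
  have h2 : ∀ i, ∫ y, F ‖y‖ * (inner ℝ v y / ‖y‖) ^ 2 ∂μ
      = ‖v‖ ^ 2 * ∫ y, F ‖y‖ * (inner ℝ (e i) y / ‖y‖) ^ 2 ∂μ := fun i => by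
    rw [hμ.integral_inner_div_pow F 2 (w := ‖v‖ • e i) (by simp [norm_smul]), ← integral_const_mul]
    refine integral_congr_ae (ae_of_all _ fun y => ?_)
    simp only [real_inner_smul_left]
    ring
  have h3 : (k : ℝ) * ∫ y, F ‖y‖ * (inner ℝ v y / ‖y‖) ^ 2 ∂μ = ‖v‖ ^ 2 * ∫ y, F ‖y‖ ∂μ := by
    rw [h1, Finset.mul_sum, ← Finset.sum_congr rfl fun i _ => h2 i]
    simp
  rw [div_mul_eq_mul_div, eq_div_iff hk0, mul_comm]
  exact h3

/-- A mixed fourth moment, from the equality of the fourth moments in the directions `v + w`, `v - w`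
and `√2 v`. -/
lemma IsSpherical.integral_inner_sq_mul_inner_sq (hμ : IsSpherical μ)
    (hF : Integrable (fun y => F ‖y‖) μ) {v w : E} (hv : ‖v‖ = 1) (hw : ‖w‖ = 1)
    (hvw : inner ℝ v w = 0) :
    ∫ y, F ‖y‖ * ((inner ℝ v y / ‖y‖) ^ 2 * (inner ℝ w y / ‖y‖) ^ 2) ∂μ
      = 1 / 3 * ∫ y, F ‖y‖ * (inner ℝ v y / ‖y‖) ^ 4 ∂μ := by
  set a := ∫ y, F ‖y‖ * (inner ℝ v y / ‖y‖) ^ 4 ∂μ with ha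
  set m := ∫ y, F ‖y‖ * ((inner ℝ v y / ‖y‖) ^ 2 * (inner ℝ w y / ‖y‖) ^ 2) ∂μ with hm
  have hint4 : ∀ v : E, Integrable (fun y => F ‖y‖ * (inner ℝ v y / ‖y‖) ^ 4) μ := fun v => by
    simpa using integrable_inner_div_pow hF v v 4 0
  have hint2 := integrable_inner_div_pow hF v w 2 2
  have hw4 : ∫ y, F ‖y‖ * (inner ℝ w y / ‖y‖) ^ 4 ∂μ = a :=
    hμ.integral_inner_div_pow F 4 (hw.trans hv.symm)
  have hn : ∀ s : ℝ, s ^ 2 = 1 → ‖v + s • w‖ = ‖(√2 : ℝ) • v‖ := fun s hs => by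
    rw [← pow_left_inj₀ (norm_nonneg _) (norm_nonneg _) two_ne_zero, norm_add_sq_real,
      real_inner_smul_right, hvw, norm_smul, norm_smul, mul_pow, mul_pow, hv, hw,
      Real.norm_eq_abs, sq_abs, hs, Real.norm_eq_abs, sq_abs, Real.sq_sqrt two_pos.le]
    norm_num
  have h4 : ∀ s : ℝ, s ^ 2 = 1 → ∫ y, F ‖y‖ * (inner ℝ (v + s • w) y / ‖y‖) ^ 4 ∂μ = 4 * a :=
    fun s hs => by
    rw [hμ.integral_inner_div_pow F 4 (hn s hs), ha, ← integral_const_mul]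
    refine integral_congr_ae (ae_of_all _ fun y => ?_)
    simp only [real_inner_smul_left]
    have : (√2 : ℝ) ^ 4 = 4 := by
      rw [show (4 : ℕ) = 2 * 2 by norm_num, pow_mul, Real.sq_sqrt two_pos.le]; norm_num
    rw [mul_div_assoc, mul_pow, this]
    ring
  have hsum : (∫ y, F ‖y‖ * (inner ℝ (v + (1 : ℝ) • w) y / ‖y‖) ^ 4 ∂μ)
      + ∫ y, F ‖y‖ * (inner ℝ (v + (-1 : ℝ) • w) y / ‖y‖) ^ 4 ∂μ = 2 * a + 12 * m + 2 * a := by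
    rw [← integral_add (hint4 _) (hint4 _)]
    have e : (fun y => F ‖y‖ * (inner ℝ (v + (1 : ℝ) • w) y / ‖y‖) ^ 4
        + F ‖y‖ * (inner ℝ (v + (-1 : ℝ) • w) y / ‖y‖) ^ 4)
        = fun y => 2 * (F ‖y‖ * (inner ℝ v y / ‖y‖) ^ 4)
          + 12 * (F ‖y‖ * ((inner ℝ v y / ‖y‖) ^ 2 * (inner ℝ w y / ‖y‖) ^ 2))
          + 2 * (F ‖y‖ * (inner ℝ w y / ‖y‖) ^ 4) := by
      funext y
      rw [inner_add_left, inner_add_left, real_inner_smul_left, real_inner_smul_left]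
      ring
    have hi : Integrable (fun y => 2 * (F ‖y‖ * (inner ℝ v y / ‖y‖) ^ 4)
        + 12 * (F ‖y‖ * ((inner ℝ v y / ‖y‖) ^ 2 * (inner ℝ w y / ‖y‖) ^ 2))) μ :=
      ((hint4 v).const_mul 2).add (hint2.const_mul 12)
    rw [e, integral_add hi ((hint4 w).const_mul 2),
      integral_add ((hint4 v).const_mul 2) (hint2.const_mul 12), integral_const_mul,
      integral_const_mul, integral_const_mul, hw4]
  rw [h4 1 (by norm_num), h4 (-1) (by norm_num)] at hsum
  linarith

lemma IsSpherical.integral_inner_pow_four (hμ : IsSpherical μ) (hμ0 : μ {0} = 0)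
    (hk : Module.finrank ℝ E = k) (hF : Integrable (fun y => F ‖y‖) μ) {v : E} (hv : ‖v‖ = 1) :
    ∫ y, F ‖y‖ * (inner ℝ v y / ‖y‖) ^ 4 ∂μ = 3 / (k * (k + 2)) * ∫ y, F ‖y‖ ∂μ := by
  have hk0 : (0 : ℝ) < k := Nat.cast_pos.2 (Nat.pos_of_ne_zero (NeZero.ne k))
  set e := (stdOrthonormalBasis ℝ E).reindex (finCongr hk) with he
  have hne : ∀ᵐ y ∂μ, y ≠ 0 := measure_eq_zero_iff_ae_notMem.1 hμ0
  set a := ∫ y, F ‖y‖ * (inner ℝ v y / ‖y‖) ^ 4 ∂μ with ha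
  have hea : ∀ i, ∫ y, F ‖y‖ * (inner ℝ (e i) y / ‖y‖) ^ 4 ∂μ = a := fun i =>
    hμ.integral_inner_div_pow F 4 (by rw [hv, e.norm_eq_one])
  have h1 : ∫ y, F ‖y‖ ∂μ = ∑ i, ∑ j,
      ∫ y, F ‖y‖ * ((inner ℝ (e i) y / ‖y‖) ^ 2 * (inner ℝ (e j) y / ‖y‖) ^ 2) ∂μ := by
    have e1 : ∀ i, ∑ j, ∫ y, F ‖y‖ * ((inner ℝ (e i) y / ‖y‖) ^ 2 * (inner ℝ (e j) y / ‖y‖) ^ 2) ∂μ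
        = ∫ y, ∑ j, F ‖y‖ * ((inner ℝ (e i) y / ‖y‖) ^ 2 * (inner ℝ (e j) y / ‖y‖) ^ 2) ∂μ :=
      fun i => (integral_finsetSum _ fun j _ => integrable_inner_div_pow hF _ _ 2 2).symm
    rw [Finset.sum_congr rfl fun i _ => e1 i, ← integral_finsetSum _ fun i _ =>
      integrable_finsetSum _ fun j _ => integrable_inner_div_pow hF _ _ 2 2]
    refine integral_congr_ae ?_
    filter_upwards [hne] with y hy
    simp only [← Finset.mul_sum]
    rw [sum_sq_inner_div_norm e hy]
    simp only [mul_one]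
    rw [sum_sq_inner_div_norm e hy, mul_one]
  have h2 : ∀ i j, ∫ y, F ‖y‖ * ((inner ℝ (e i) y / ‖y‖) ^ 2 * (inner ℝ (e j) y / ‖y‖) ^ 2) ∂μ
      = 1 / 3 * a + if i = j then 2 / 3 * a else 0 := by
    intro i j
    split_ifs with hij
    · subst hij
      have : ∀ y : E, (inner ℝ (e i) y / ‖y‖) ^ 2 * (inner ℝ (e i) y / ‖y‖) ^ 2
          = (inner ℝ (e i) y / ‖y‖) ^ 4 := fun y => by ring
      simp only [this, hea]
      ring
    · rw [hμ.integral_inner_sq_mul_inner_sq hF (e.norm_eq_one i) (e.norm_eq_one j)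
        (e.inner_eq_zero hij), hea, add_zero]
  simp only [h2, Finset.sum_add_distrib, Finset.sum_ite_eq, Finset.mem_univ, if_true,
    Finset.sum_const, Finset.card_univ, Fintype.card_fin, nsmul_eq_mul] at h1
  rw [h1]
  field_simp

/-- The first moment of a quadratic form in the direction of a spherically distributed vector. -/
lemma IsSpherical.integral_quadratic (hμ : IsSpherical μ) (hμ0 : μ {0} = 0)
    (hk : Module.finrank ℝ E = k) (hF : Integrable (fun y => F ‖y‖) μ) {W : E →ₗ[ℝ] E}
    (hW : W.IsSymmetric) :
    ∫ y, F ‖y‖ * (inner ℝ y (W y) / ‖y‖ ^ 2) ∂μ = W.trace ℝ E / k * ∫ y, F ‖y‖ ∂μ := by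
  set e := hW.eigenvectorBasis hk with he
  set c := hW.eigenvalues hk with hc
  have hWe : ∀ i, W (e i) = c i • e i := fun i => hW.apply_eigenvectorBasis hk i
  have hq : ∀ y : E, F ‖y‖ * (inner ℝ y (W y) / ‖y‖ ^ 2)
      = ∑ i, c i * (F ‖y‖ * (inner ℝ (e i) y / ‖y‖) ^ 2) := fun y => by
    rw [← e.sum_inner_mul_inner y (W y), Finset.sum_div, Finset.mul_sum]
    refine Finset.sum_congr rfl fun i _ => ?_
    rw [← hW (e i) y, hWe, real_inner_smul_left, real_inner_comm (e i) y]
    ring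
  have htr : W.trace ℝ E = ∑ i, c i := by
    rw [W.trace_eq_sum_inner e]
    refine Finset.sum_congr rfl fun i _ => ?_
    rw [hWe, real_inner_smul_right, real_inner_self_eq_norm_sq, e.norm_eq_one]
    ring
  have hint : ∀ i, Integrable (fun y => F ‖y‖ * (inner ℝ (e i) y / ‖y‖) ^ 2) μ := fun i => by
    simpa using integrable_inner_div_pow hF (e i) (e i) 2 0
  simp only [hq]
  rw [integral_finsetSum _ fun i _ => (hint i).const_mul _, htr, Finset.sum_div, Finset.sum_mul]
  refine Finset.sum_congr rfl fun i _ => ?_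
  rw [integral_const_mul, hμ.integral_inner_sq hμ0 hk hF, e.norm_eq_one]
  ring

/-- The second moment of a quadratic form in the direction of a spherically distributed vector. -/
lemma IsSpherical.integral_quadratic_sq (hμ : IsSpherical μ) (hμ0 : μ {0} = 0)
    (hk : Module.finrank ℝ E = k) (hF : Integrable (fun y => F ‖y‖) μ) {W : E →ₗ[ℝ] E}
    (hW : W.IsSymmetric) :
    ∫ y, F ‖y‖ * (inner ℝ y (W y) / ‖y‖ ^ 2) ^ 2 ∂μ
      = (2 * (W * W).trace ℝ E + W.trace ℝ E ^ 2) / (k * (k + 2)) * ∫ y, F ‖y‖ ∂μ := by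
  have hk0 : (0 : ℝ) < k := Nat.cast_pos.2 (Nat.pos_of_ne_zero (NeZero.ne k))
  set e := hW.eigenvectorBasis hk with he
  set c := hW.eigenvalues hk with hc
  have hWe : ∀ i, W (e i) = c i • e i := fun i => hW.apply_eigenvectorBasis hk i
  have hq : ∀ y : E, F ‖y‖ * (inner ℝ y (W y) / ‖y‖ ^ 2) ^ 2
      = ∑ i, ∑ j, c i * c j * (F ‖y‖ * ((inner ℝ (e i) y / ‖y‖) ^ 2
        * (inner ℝ (e j) y / ‖y‖) ^ 2)) := fun y => by
    have : inner ℝ y (W y) / ‖y‖ ^ 2 = ∑ i, c i * (inner ℝ (e i) y / ‖y‖) ^ 2 := by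
      rw [← e.sum_inner_mul_inner y (W y), Finset.sum_div]
      refine Finset.sum_congr rfl fun i _ => ?_
      rw [← hW (e i) y, hWe, real_inner_smul_left, real_inner_comm (e i) y]
      ring
    rw [this, sq, Finset.sum_mul_sum, Finset.mul_sum]
    refine Finset.sum_congr rfl fun i _ => ?_
    rw [Finset.mul_sum]
    exact Finset.sum_congr rfl fun j _ => by ring
  have htr : W.trace ℝ E = ∑ i, c i := by
    rw [W.trace_eq_sum_inner e]
    refine Finset.sum_congr rfl fun i _ => ?_
    rw [hWe, real_inner_smul_right, real_inner_self_eq_norm_sq, e.norm_eq_one]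
    ring
  have htr2 : (W * W).trace ℝ E = ∑ i, c i ^ 2 := by
    rw [(W * W).trace_eq_sum_inner e]
    refine Finset.sum_congr rfl fun i _ => ?_
    rw [Module.End.mul_apply, hWe, map_smul, hWe, real_inner_smul_right, real_inner_smul_right,
      real_inner_self_eq_norm_sq, e.norm_eq_one]
    ring
  have h4 : ∀ i j, ∫ y, F ‖y‖ * ((inner ℝ (e i) y / ‖y‖) ^ 2 * (inner ℝ (e j) y / ‖y‖) ^ 2) ∂μ
      = (1 + if i = j then 2 else 0) * (1 / (k * (k + 2)) * ∫ y, F ‖y‖ ∂μ) := by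
    intro i j
    have h5 := hμ.integral_inner_pow_four hμ0 hk hF (e.norm_eq_one i)
    split_ifs with hij
    · subst hij
      have : ∀ y : E, (inner ℝ (e i) y / ‖y‖) ^ 2 * (inner ℝ (e i) y / ‖y‖) ^ 2
          = (inner ℝ (e i) y / ‖y‖) ^ 4 := fun y => by ring
      simp only [this, h5]
      ring
    · rw [hμ.integral_inner_sq_mul_inner_sq hF (e.norm_eq_one i) (e.norm_eq_one j)
        (e.inner_eq_zero hij), h5]
      ring
  have hint : ∀ i j, Integrable (fun y => c i * c j * (F ‖y‖ * ((inner ℝ (e i) y / ‖y‖) ^ 2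
        * (inner ℝ (e j) y / ‖y‖) ^ 2))) μ := fun i j =>
    (integrable_inner_div_pow hF (e i) (e j) 2 2).const_mul _
  simp only [hq]
  rw [integral_finsetSum _ fun i _ => integrable_finsetSum _ fun j _ => hint i j]
  simp only [integral_finsetSum _ fun j _ => hint _ j, integral_const_mul, h4]
  set Q := 1 / ((k : ℝ) * (k + 2)) * ∫ y, F ‖y‖ ∂μ with hQ
  have hsum : ∑ i, ∑ j, c i * c j * ((1 + if i = j then (2 : ℝ) else 0) * Q)
      = (2 * ∑ i, c i ^ 2 + (∑ i, c i) ^ 2) * Q := by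
    have : ∀ i j, c i * c j * ((1 + if i = j then (2 : ℝ) else 0) * Q)
        = c i * c j * Q + if i = j then 2 * c i * c j * Q else 0 := fun i j => by
      split_ifs <;> ring
    simp only [this, Finset.sum_add_distrib, Finset.sum_ite_eq, Finset.mem_univ, if_true]
    rw [sq (∑ i, c i), Finset.sum_mul_sum, add_mul, Finset.mul_sum, Finset.sum_mul, Finset.sum_mul,
      add_comm]
    simp only [Finset.sum_mul]
    congr 1
    exact Finset.sum_congr rfl fun i _ => by ring
  rw [hsum, htr, htr2, hQ]
  ring

end SphericalMoments

/-! ### Normalization in a Hilbert space -/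

/-- The derivative of the normalization `v ↦ ‖v‖⁻¹ • v` at a unit vector, along sequences. The
normalizing factors are given as `κ`, and their expansion is part of the conclusion. -/
lemma tendsto_smul_normalized_sub {H ι : Type*} [NormedAddCommGroup H] [InnerProductSpace ℝ H]
    {l : Filter ι} {u D : H} (hu : ‖u‖ = 1) {v : ι → H} {s κ : ι → ℝ}
    (hs : Tendsto (fun n => (s n)⁻¹) l (𝓝 0)) (hs0 : ∀ᶠ n in l, 0 < s n)
    (hv : Tendsto (fun n => s n • (v n - u)) l (𝓝 D)) (hκ0 : ∀ᶠ n in l, 0 ≤ κ n)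
    (hκ : ∀ᶠ n in l, κ n * ‖v n‖ = 1) :
    Tendsto (fun n => s n * (κ n - 1)) l (𝓝 (-inner ℝ u D)) ∧
    Tendsto (fun n => s n • (κ n • v n - u)) l (𝓝 (D - inner ℝ u D • u)) := by
  have hd : Tendsto (fun n => v n - u) l (𝓝 0) := by
    have := hs.smul hv
    rw [zero_smul] at this
    refine this.congr' ?_
    filter_upwards [hs0] with n hn
    rw [smul_smul, inv_mul_cancel₀ hn.ne', one_smul]
  have hvu : Tendsto v l (𝓝 u) := by
    have := hd.add_const u
    simpa using this
  have hnv : Tendsto (fun n => ‖v n‖) l (𝓝 1) := by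
    have := hvu.norm
    rwa [hu] at this
  have h1 : Tendsto (fun n => s n * (κ n - 1)) l (𝓝 (-inner ℝ u D)) := by
    have h2 : Tendsto (fun n => -(2 * inner ℝ u (s n • (v n - u))
        + inner ℝ (v n - u) (s n • (v n - u))) / (‖v n‖ * (1 + ‖v n‖))) l
        (𝓝 (-(2 * inner ℝ u D + inner ℝ (0 : H) D) / (1 * (1 + 1)))) := by
      refine Tendsto.div ?_ (hnv.mul (hnv.const_add 1)) (by norm_num)
      exact (((tendsto_const_nhds.inner hv).const_mul 2).add (hd.inner hv)).neg
    have e : -(2 * inner ℝ u D + inner ℝ (0 : H) D) / (1 * (1 + 1)) = -inner ℝ u D := by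
      rw [inner_zero_left]; ring
    rw [e] at h2
    refine h2.congr' ?_
    filter_upwards [hκ, hκ0] with n hn hn0
    have hvpos : 0 < ‖v n‖ := by
      rcases (norm_nonneg (v n)).lt_or_eq with h | h
      · exact h
      · rw [← h, mul_zero] at hn; exact absurd hn zero_ne_one
    have hk : κ n = 1 / ‖v n‖ := by rw [eq_div_iff hvpos.ne', hn]
    have hsq : ‖v n‖ ^ 2 = 1 + 2 * inner ℝ u (v n - u) + inner ℝ (v n - u) (v n - u) := by
      have : ‖u + (v n - u)‖ ^ 2 = _ := norm_add_sq_real u (v n - u)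
      rw [add_sub_cancel, hu] at this
      rw [this, real_inner_self_eq_norm_sq]
      ring
    rw [real_inner_smul_right, real_inner_smul_right, hk]
    field_simp
    linear_combination s n * hsq
  refine ⟨h1, ?_⟩
  have h3 := (h1.smul hvu).add hv
  have e : -inner ℝ u D • u + D = D - inner ℝ u D • u := by rw [neg_smul]; abel
  rw [e] at h3
  refine h3.congr fun n => ?_
  rw [mul_smul, ← smul_add]
  congr 1
  rw [sub_smul, one_smul]
  abel

/-! ### Spherical laws and their scores -/

/-- The equation `r η' = -m η` forces `η` to be a power, and no power is square integrable for the
weight `r ^ (k - 1)`. -/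
lemma IsRegularRoot.not_ae_mul_deriv_eq {k : ℕ} {η T : ℝ → ℝ} (hR : IsRegularRoot k η T)
    (hk : 0 < k)
    (hpos : ∀ᵐ r ∂(volume.restrict (Ioi 0)), 0 < η r) (m : ℝ) :
    ¬ ∀ᵐ r ∂(volume.restrict (Ioi 0)), r * T r = -m * η r := by
  intro h
  have hrad : ∀ r : ℝ, 0 < r → r ∈ radii k := fun r hr => Ioi_subset_radii k hr
  have hηc : ∀ r : ℝ, 0 < r → ContinuousAt η r := by
    intro r hr
    have hi := hR.intervalIntegrable (r / 2) (hrad _ (half_pos hr)) (2 * r)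
      (hrad _ (by linarith))
    have h1 := intervalIntegral.continuousOn_primitive_interval'
      (b₁ := r / 2) (b₂ := 2 * r) (a := r / 2) hi left_mem_uIcc
    have h2 : ContinuousOn η (Icc (r / 2) (2 * r)) := by
      rw [← uIcc_of_le (by linarith)]
      refine (h1.add_const (η (r / 2))).congr fun x hx => ?_
      rw [uIcc_of_le (by linarith)] at hx
      have := hR.integral_eq (r / 2) (hrad _ (half_pos hr)) x (hrad _ (by linarith [hx.1]))
      simp only
      rw [this]; ring
    exact h2.continuousAt (Icc_mem_nhds (by linarith) (by linarith))
  have hd : ∀ r : ℝ, 0 < r → HasDerivAt η (-m * η r / r) r := by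
    intro r hr
    have hc : ContinuousOn (fun t => -m * η t / t) (Ioi 0) := fun t ht =>
      ((((hηc t ht).const_mul (-m)).div continuousAt_id (ne_of_gt ht))).continuousWithinAt
    have hI : ∀ x : ℝ, 0 < x → η x = (∫ t in r..x, -m * η t / t) + η r := by
      intro x hx
      rw [← sub_eq_iff_eq_add, ← hR.integral_eq r (hrad r hr) x (hrad x hx)]
      refine intervalIntegral.integral_congr_ae ?_
      rw [ae_restrict_iff' measurableSet_Ioi] at h
      filter_upwards [h] with t ht htm
      have ht0 : 0 < t := lt_of_le_of_lt (le_min hr.le hx.le) htm.1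
      rw [← ht ht0, mul_div_cancel_left₀ _ ht0.ne']
    have h1 : HasDerivAt (fun x => (∫ t in r..x, -m * η t / t) + η r) (-m * η r / r) r := by
      refine HasDerivAt.add_const _ (intervalIntegral.integral_hasDerivAt_right (by simp) ?_
        (hc.continuousAt (Ioi_mem_nhds hr)))
      exact ContinuousOn.stronglyMeasurableAtFilter isOpen_Ioi hc r hr
    refine h1.congr_of_eventuallyEq ?_
    filter_upwards [Ioi_mem_nhds hr] with x hx using hI x hx
  have hconst : ∀ r : ℝ, 0 < r → r ^ m * η r = η 1 := by
    have hdz : ∀ r ∈ Ioi (0 : ℝ), HasDerivAt (fun r => r ^ m * η r) 0 r := fun r hr => by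
      have hr' : (0 : ℝ) < r := hr
      have := (Real.hasDerivAt_rpow_const (p := m) (Or.inl hr'.ne')).mul (hd r hr)
      have e : m * r ^ (m - 1) * η r + r ^ m * (-m * η r / r) = 0 := by
        rw [Real.rpow_sub_one hr'.ne']
        field_simp
        ring
      rw [e] at this
      exact this
    intro r hr
    have h1 := (convex_Ioi (0 : ℝ)).is_const_of_fderivWithin_eq_zero (𝕜 := ℝ)
      (f := fun r => r ^ m * η r)
      (fun x hx => (hdz x hx).differentiableAt.differentiableWithinAt)
      (fun x hx => by
        rw [fderivWithin_of_isOpen isOpen_Ioi hx]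
        have := (hdz x hx).hasFDerivAt.fderiv
        rw [this]
        ext
        simp) (mem_Ioi.2 hr) (mem_Ioi.2 one_pos)
    simpa using h1
  have hη1 : η 1 ≠ 0 := by
    intro h0
    have : ∀ᵐ r ∂(volume.restrict (Ioi (0 : ℝ))), False := by
      filter_upwards [hpos, ae_restrict_mem measurableSet_Ioi] with r hr hr0
      have hr0' : (0 : ℝ) < r := hr0
      have h2 := hconst r hr0'
      rw [h0] at h2
      exact (mul_pos (Real.rpow_pos_of_pos hr0' m) hr).ne' h2
    rw [ae_iff] at this
    simp at this
  refine not_integrableOn_Ioi_rpow ((k : ℝ) - 1 - 2 * m) ?_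
  have h3 : IntegrableOn (fun r => (η 1 ^ 2)⁻¹ * (r ^ (k - 1) * η r ^ 2)) (Ioi 0) :=
    hR.integrableOn_sq.const_mul _
  refine h3.congr_fun (fun r hr => ?_) measurableSet_Ioi
  have hr0 : (0 : ℝ) < r := hr
  have h4 := hconst r hr0
  have hrm := Real.rpow_pos_of_pos hr0 m
  have h5 : η r = η 1 / r ^ m := by rw [eq_div_iff hrm.ne', ← h4]; ring
  have h6 : r ^ ((k : ℝ) - 1 - 2 * m) = r ^ (k - 1) / (r ^ m) ^ 2 := by
    rw [Real.rpow_sub hr0, mul_comm 2 m, Real.rpow_mul hr0.le, ← Nat.cast_pred hk,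
      Real.rpow_natCast]
    norm_num
  simp only
  rw [h6, h5]
  field_simp

section SphericalLaw

variable {E : Type*} [NormedAddCommGroup E] [InnerProductSpace ℝ E] [FiniteDimensional ℝ E]
  [MeasurableSpace E] [BorelSpace E] {k : ℕ} [NeZero k] {η T : ℝ → ℝ}

lemma nontrivial_of_finrank_eq (hk : Module.finrank ℝ E = k) : Nontrivial E :=
  Module.nontrivial_of_finrank_pos (R := ℝ) (by rw [hk]; exact Nat.pos_of_ne_zero (NeZero.ne k))

/-- A property of almost every radius holds for the modulus of almost every point. -/
lemma ae_comp_norm [Nontrivial E] {p : ℝ → Prop}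
    (hp : ∀ᵐ r ∂(volume.restrict (Ioi (0 : ℝ))), p r) : ∀ᵐ y : E, p ‖y‖ := by
  set N := toMeasurable (volume.restrict (Ioi (0 : ℝ))) {r | ¬ p r} with hN
  have hN0 : volume.restrict (Ioi (0 : ℝ)) N = 0 := by rw [hN, measure_toMeasurable]; exact hp
  have hNm : MeasurableSet N := measurableSet_toMeasurable _ _
  have hz : (fun r : ℝ => r ^ (Module.finrank ℝ E - 1) • N.indicator (fun _ => (1 : ℝ)) r)
      =ᵐ[volume.restrict (Ioi 0)] 0 := by
    filter_upwards [measure_eq_zero_iff_ae_notMem.1 hN0] with r hr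
    simp [hr]
  have hint : Integrable (fun y : E => N.indicator (fun _ => (1 : ℝ)) ‖y‖) volume := by
    rw [integrable_fun_norm_addHaar volume (f := N.indicator fun _ => (1 : ℝ))]
    exact (integrable_congr hz).2 (integrable_zero _ _ _)
  have h0 : ∫ y : E, N.indicator (fun _ => (1 : ℝ)) ‖y‖ = 0 := by
    rw [integral_fun_norm_addHaar volume (N.indicator fun _ => (1 : ℝ)), integral_congr_ae hz]
    simp
  rw [integral_eq_zero_iff_of_nonneg (fun y => indicator_nonneg (fun _ _ => zero_le_one) _) hint]
    at h0
  filter_upwards [h0] with y hy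
  by_contra hpy
  have hyN : ‖y‖ ∈ N := subset_toMeasurable _ _ hpy
  simp [hyN] at hy

lemma isSpherical_volume : IsSpherical (volume : Measure E) := fun L => L.measurePreserving

/-- The spherical law whose density is proportional to `y ↦ η ‖y‖ ^ 2`. -/
def rootLaw (η : ℝ → ℝ) : Measure E :=
  volume.withDensity fun y => ENNReal.ofReal ((∫ z : E, η ‖z‖ ^ 2)⁻¹ * η ‖y‖ ^ 2)

/-- The second moment of the location score `-2 T / η` under the law with root density `η`. -/
def rootLocInfo (E : Type*) [NormedAddCommGroup E] [InnerProductSpace ℝ E] [FiniteDimensional ℝ E]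
    [MeasurableSpace E] [BorelSpace E] (η T : ℝ → ℝ) : ℝ :=
  (∫ z : E, η ‖z‖ ^ 2)⁻¹ * ∫ y : E, (2 * T ‖y‖) ^ 2

/-- The second moment of `-2 r T(r) / η(r)` under the law with root density `η`. -/
def rootShapeInfo (E : Type*) [NormedAddCommGroup E] [InnerProductSpace ℝ E]
    [FiniteDimensional ℝ E] [MeasurableSpace E] [BorelSpace E] (η T : ℝ → ℝ) : ℝ :=
  (∫ z : E, η ‖z‖ ^ 2)⁻¹ * ∫ y : E, (2 * (‖y‖ * T ‖y‖)) ^ 2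

/-- The score of the law with root density `η` in the direction of the infinitesimal affine
deformation `y ↦ a y - b`. -/
def rootScore (η T : ℝ → ℝ) (a : E →L[ℝ] E) (b y : E) : ℝ :=
  2 * deformDeriv T a b y / η ‖y‖ + LinearMap.trace ℝ E a

lemma measurable_rootScore (hR : IsRegularRoot k η T) (a : E →L[ℝ] E) (b : E) :
    Measurable (rootScore η T a b) := by
  have h1 := measurable_deformDeriv hR.measurable_deriv a b
  have h2 : Measurable fun y : E => η ‖y‖ := hR.measurable.comp measurable_norm
  exact ((h1.const_mul 2).div h2).add_const _

lemma IsRegularRoot.integral_sq_pos (hR : IsRegularRoot k η T) (hk : Module.finrank ℝ E = k)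
    (hpos : ∀ᵐ r ∂(volume.restrict (Ioi (0 : ℝ))), 0 < η r) : 0 < ∫ y : E, η ‖y‖ ^ 2 := by
  have := nontrivial_of_finrank_eq hk
  rw [integral_pos_iff_support_of_nonneg (fun y => sq_nonneg _) (hR.memLp_root hk).integrable_sq]
  refine pos_iff_ne_zero.2 fun h0 => ?_
  have h1 : ∀ᵐ y : E, False := by
    filter_upwards [ae_comp_norm (E := E) hpos, measure_eq_zero_iff_ae_notMem.1 h0] with y hy h2
    exact h2 (pow_ne_zero 2 hy.ne')
  rw [ae_iff] at h1
  simp only [not_false_eq_true, ofPred_true] at h1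
  exact (NeZero.ne (volume : Measure E)) (Measure.measure_univ_eq_zero.1 h1)

lemma IsRegularRoot.integral_rootLaw (hR : IsRegularRoot k η T) (g : E → ℝ) :
    ∫ y, g y ∂(rootLaw η) = (∫ z : E, η ‖z‖ ^ 2)⁻¹ * ∫ y, g y * η ‖y‖ ^ 2 := by
  have hm : Measurable fun y : E => η ‖y‖ := hR.measurable.comp measurable_norm
  have hc : 0 ≤ (∫ z : E, η ‖z‖ ^ 2)⁻¹ := inv_nonneg.2 (integral_nonneg fun _ => sq_nonneg _)
  rw [rootLaw, integral_withDensity_eq_integral_toReal_smul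
    ((hm.pow_const 2).const_mul _).ennreal_ofReal
    (ae_of_all _ fun _ => ENNReal.ofReal_lt_top), ← integral_const_mul]
  refine integral_congr_ae (ae_of_all _ fun y => ?_)
  simp only
  rw [ENNReal.toReal_ofReal (mul_nonneg hc (sq_nonneg _)), smul_eq_mul]
  ring

lemma IsRegularRoot.isProbabilityMeasure_rootLaw (hR : IsRegularRoot k η T)
    (hk : Module.finrank ℝ E = k)
    (hpos : ∀ᵐ r ∂(volume.restrict (Ioi (0 : ℝ))), 0 < η r) :
    IsProbabilityMeasure (rootLaw η : Measure E) := by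
  have hp := hR.integral_sq_pos hk hpos
  refine ⟨?_⟩
  rw [rootLaw, withDensity_apply _ MeasurableSet.univ, Measure.restrict_univ,
    ← ofReal_integral_eq_lintegral_ofReal ((hR.memLp_root hk).integrable_sq.const_mul _)
      (ae_of_all _ fun y => mul_nonneg (inv_nonneg.2 hp.le) (sq_nonneg _)), integral_const_mul,
    inv_mul_cancel₀ hp.ne', ENNReal.ofReal_one]

lemma IsRegularRoot.memLp_rootLaw (hR : IsRegularRoot k η T) {g : E → ℝ} (hg : Measurable g)
    (h : MemLp (fun y => g y * η ‖y‖) 2 volume) : MemLp g 2 (rootLaw η) := by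
  have hm : Measurable fun y : E => η ‖y‖ := hR.measurable.comp measurable_norm
  have hc : 0 ≤ (∫ z : E, η ‖z‖ ^ 2)⁻¹ := inv_nonneg.2 (integral_nonneg fun _ => sq_nonneg _)
  rw [memLp_two_iff_integrable_sq hg.aestronglyMeasurable, rootLaw,
    integrable_withDensity_iff_integrable_smul' ((hm.pow_const 2).const_mul _).ennreal_ofReal
      (ae_of_all _ fun _ => ENNReal.ofReal_lt_top)]
  refine (h.integrable_sq.const_mul (∫ z : E, η ‖z‖ ^ 2)⁻¹).congr (ae_of_all _ fun y => ?_)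
  simp only
  rw [ENNReal.toReal_ofReal (mul_nonneg hc (sq_nonneg _)), smul_eq_mul]
  ring

lemma rootScore_mul_root (hk : Module.finrank ℝ E = k)
    (hpos : ∀ᵐ r ∂(volume.restrict (Ioi (0 : ℝ))), 0 < η r)
    (a : E →L[ℝ] E) (b : E) :
    (fun y => rootScore η T a b y * η ‖y‖)
      =ᵐ[volume] fun y => 2 * deformDeriv T a b y + LinearMap.trace ℝ E a * η ‖y‖ := by
  have := nontrivial_of_finrank_eq hk
  filter_upwards [ae_comp_norm (E := E) hpos] with y hy
  rw [rootScore]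
  field_simp

lemma IsRegularRoot.memLp_rootScore (hR : IsRegularRoot k η T) (hk : Module.finrank ℝ E = k)
    (hpos : ∀ᵐ r ∂(volume.restrict (Ioi (0 : ℝ))), 0 < η r)
    (a : E →L[ℝ] E) (b : E) :
    MemLp (rootScore η T a b) 2 (rootLaw η) := by
  refine hR.memLp_rootLaw (measurable_rootScore hR a b) ?_
  rw [memLp_congr_ae (rootScore_mul_root hk hpos a b)]
  exact ((hR.memLp_deformDeriv hk a b).const_mul 2).add ((hR.memLp_root hk).const_mul _)

lemma IsRegularRoot.eLpNorm_deformDeriv_le (hR : IsRegularRoot k η T) (hk : Module.finrank ℝ E = k)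
    (a : E →L[ℝ] E) (b : E) :
    eLpNorm (deformDeriv T a b) 2 volume
      ≤ ENNReal.ofReal ‖a‖ * eLpNorm (fun y : E => ‖y‖ * T ‖y‖) 2 volume
        + ENNReal.ofReal ‖b‖ * eLpNorm (fun y : E => T ‖y‖) 2 volume := by
  have h1 := (hR.memLp_norm_mul_deriv (E := E) hk).norm.const_mul ‖a‖
  have h2 := (hR.memLp_deriv (E := E) hk).norm.const_mul ‖b‖
  have h3 : eLpNorm (deformDeriv T a b) 2 volume
      ≤ eLpNorm ((fun y : E => ‖a‖ * ‖‖y‖ * T ‖y‖‖) + fun y : E => ‖b‖ * ‖T ‖y‖‖) 2 volume := by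
    refine eLpNorm_mono_real fun y => ?_
    rw [Real.norm_eq_abs]
    refine (abs_deformDeriv_le T a b y).trans ?_
    simp only [Pi.add_apply, norm_mul, Real.norm_eq_abs, abs_norm]
    rw [← mul_assoc, ← add_mul]
    gcongr
    exact (norm_sub_le _ _).trans (by gcongr; exact a.le_opNorm y)
  refine h3.trans ((eLpNorm_add_le h1.1 h2.1 one_le_two).trans (le_of_eq ?_))
  have e : ∀ (c : ℝ) (g : E → ℝ), 0 ≤ c → eLpNorm (fun y => c * ‖g y‖) 2 volume
      = ENNReal.ofReal c * eLpNorm g 2 volume := fun c g hc => by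
    have := eLpNorm_const_smul c (fun y => ‖g y‖) 2 (volume : Measure E)
    simp only [Pi.smul_def, smul_eq_mul] at this
    rw [this, eLpNorm_norm, Real.enorm_eq_ofReal hc]
  rw [e _ _ (norm_nonneg _), e _ _ (norm_nonneg _)]

end SphericalLaw

section DeformedRoot

lemma norm_toLp_sq {α : Type*} [MeasurableSpace α] {μ : Measure α} {f : α → ℝ}
    (hf : MemLp f 2 μ) : ‖hf.toLp f‖ ^ 2 = ∫ x, f x ^ 2 ∂μ := by
  rw [← real_inner_self_eq_norm_sq, L2.inner_def]
  refine integral_congr_ae ?_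
  filter_upwards [hf.coeFn_toLp] with x hx
  rw [hx]
  simp [sq]

lemma inner_toLp {α : Type*} [MeasurableSpace α] {μ : Measure α} {f g : α → ℝ}
    (hf : MemLp f 2 μ) (hg : MemLp g 2 μ) :
    inner ℝ (hf.toLp f) (hg.toLp g) = ∫ x, f x * g x ∂μ := by
  rw [L2.inner_def]
  refine integral_congr_ae ?_
  filter_upwards [hf.coeFn_toLp, hg.coeFn_toLp] with x hx hx'
  rw [hx, hx']
  simp [mul_comm]

variable {E : Type*} [NormedAddCommGroup E] [InnerProductSpace ℝ E] [FiniteDimensional ℝ E]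
  [MeasurableSpace E] [BorelSpace E] {k : ℕ} [NeZero k] {η T : ℝ → ℝ}

lemma IsRegularRoot.memLp_comp_deform (hR : IsRegularRoot k η T) (hk : Module.finrank ℝ E = k)
    {A : E →L[ℝ] E} (b : E) (h : (1 + A).det ≠ 0) :
    MemLp (fun y => η ‖y + (A y - b)‖) 2 volume := by
  have h1 : MemLp (fun y : E => η ‖y‖) 2
      (Measure.map (fun y : E => y + (A y - b)) volume) := by
    rw [map_deform_volume A b h]
    exact (hR.memLp_root hk).smul_measure ENNReal.ofReal_ne_top
  exact h1.comp_of_map (measurable_deform A b).aemeasurable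

lemma integral_comp_deform {A : E →L[ℝ] E} (b : E) (h : (1 + A).det ≠ 0) {g : E → ℝ}
    (hg : Measurable g) :
    ∫ y, g (y + (A y - b)) = |((1 + A).det)⁻¹| * ∫ y, g y := by
  have h1 := integral_map (μ := volume) (measurable_deform A b).aemeasurable
    (f := g) hg.aestronglyMeasurable
  rw [← h1, map_deform_volume A b h, integral_smul_measure, ENNReal.toReal_ofReal (abs_nonneg _),
    smul_eq_mul]

/-- Differentiability of `η ‖·‖` along deformations, for the norm of `L²`. -/
lemma IsRegularRoot.isLittleO_deform (hR : IsRegularRoot k η T) (hk : Module.finrank ℝ E = k) :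
    (fun p : (E →L[ℝ] E) × E => (eLpNorm (fun y => η ‖y + (p.1 y - p.2)‖ - η ‖y‖
      - deformDeriv T p.1 p.2 y) 2 volume).toReal) =o[𝓝 0] fun p => ‖p.1‖ + ‖p.2‖ := by
  rw [Asymptotics.isLittleO_iff]
  intro ε hε
  filter_upwards [hR.eventually_eLpNorm_sub_deformDeriv hk hε] with p hp
  rw [Real.norm_eq_abs, abs_of_nonneg ENNReal.toReal_nonneg, Real.norm_eq_abs,
    abs_of_nonneg (by positivity)]
  exact ENNReal.toReal_le_of_le_ofReal (by positivity) hp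

/-- Quadratic mean expansion of the normalized deformed root: the coefficient `q` makes the
derivative orthogonal to `η ‖·‖`, because all the deformed roots have the same norm. -/
theorem IsRegularRoot.tendsto_normalized_deform {ι : Type*} {l : Filter ι}
    (hR : IsRegularRoot k η T) (hk : Module.finrank ℝ E = k)
    (hpos : ∀ᵐ r ∂(volume.restrict (Ioi (0 : ℝ))), 0 < η r)
    {s : ι → ℝ} (hs : Tendsto (fun n => (s n)⁻¹) l (𝓝 0)) (hs0 : ∀ᶠ n in l, 0 < s n)
    {A : ι → E →L[ℝ] E} {b : ι → E} {a : E →L[ℝ] E} {β : E}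
    (hA : Tendsto (fun n => s n • A n) l (𝓝 a)) (hb : Tendsto (fun n => s n • b n) l (𝓝 β)) :
    let c := (∫ z : E, η ‖z‖ ^ 2)⁻¹
    let q := c * ∫ y, η ‖y‖ * deformDeriv T a β y
    Tendsto (fun n => s n * (√|(1 + A n).det| - 1)) l (𝓝 (-q)) ∧
    Tendsto (fun n => s n ^ 2 * (c * ∫ y, (√|(1 + A n).det| * η ‖y + (A n y - b n)‖ - η ‖y‖
      - (s n)⁻¹ * (deformDeriv T a β y - q * η ‖y‖)) ^ 2)) l (𝓝 0) := by
  intro c q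
  have hm := hR.integral_sq_pos hk hpos
  have hc : 0 < c := inv_pos.2 hm
  have hcm : c * ∫ z : E, η ‖z‖ ^ 2 = 1 := inv_mul_cancel₀ hm.ne'
  have hA0 : Tendsto A l (𝓝 0) := by
    have := hs.smul hA
    rw [zero_smul] at this
    refine this.congr' ?_
    filter_upwards [hs0] with n hn
    rw [smul_smul, inv_mul_cancel₀ hn.ne', one_smul]
  have hb0 : Tendsto b l (𝓝 0) := by
    have := hs.smul hb
    rw [zero_smul] at this
    refine this.congr' ?_
    filter_upwards [hs0] with n hn
    rw [smul_smul, inv_mul_cancel₀ hn.ne', one_smul]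
  have hdet : ∀ᶠ n in l, (1 + A n).det ≠ 0 := by
    filter_upwards [hA0.eventually (eventually_deform_le (E := E))] with n hn using (hn 0).1
  have hηL := hR.memLp_root (E := E) hk
  have hDL := fun (A : E →L[ℝ] E) b => hR.memLp_deformDeriv hk A b
  set e := hηL.toLp with he
  set DD : (E →L[ℝ] E) → E → Lp ℝ 2 (volume : Measure E) := fun A b => (hDL A b).toLp with hDD
  classical
  set F : ι → Lp ℝ 2 (volume : Measure E) := fun n =>
    if h : (1 + A n).det ≠ 0 then (hR.memLp_comp_deform hk (b n) h).toLp else 0 with hF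
  have hFn : ∀ n (h : (1 + A n).det ≠ 0), F n = (hR.memLp_comp_deform hk (b n) h).toLp :=
    fun n h => dif_pos h
  -- The derivative depends continuously on the direction.
  have hDDlim : Tendsto (fun n => DD (s n • A n - a) (s n • b n - β)) l (𝓝 0) := by
    rw [tendsto_zero_iff_norm_tendsto_zero]
    set C1 := (eLpNorm (fun y : E => ‖y‖ * T ‖y‖) 2 volume).toReal
    set C2 := (eLpNorm (fun y : E => T ‖y‖) 2 volume).toReal
    have h1 : Tendsto (fun n => ‖s n • A n - a‖ * C1 + ‖s n • b n - β‖ * C2) l (𝓝 0) := by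
      have ha := (tendsto_iff_norm_sub_tendsto_zero.1 hA).mul_const C1
      have hb := (tendsto_iff_norm_sub_tendsto_zero.1 hb).mul_const C2
      simpa using ha.add hb
    refine squeeze_zero (fun n => norm_nonneg _) (fun n => ?_) h1
    rw [hDD, Lp.norm_toLp]
    refine ENNReal.toReal_le_of_le_ofReal (by positivity)
      ((hR.eLpNorm_deformDeriv_le hk _ _).trans (le_of_eq ?_))
    rw [ENNReal.ofReal_add (by positivity) (by positivity), ENNReal.ofReal_mul (norm_nonneg _),
      ENNReal.ofReal_mul (norm_nonneg _), ENNReal.ofReal_toReal (hR.memLp_norm_mul_deriv hk).2.ne,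
      ENNReal.ofReal_toReal (hR.memLp_deriv hk).2.ne]
  -- Differentiability in quadratic mean along the sequence `(A n, b n)`.
  have hrem : Tendsto (fun n => s n • (F n - e - DD (A n) (b n))) l (𝓝 0) := by
    rw [tendsto_zero_iff_norm_tendsto_zero]
    have h1 := (hR.isLittleO_deform (E := E) hk).comp_tendsto
      (k := fun n => (A n, b n)) (hA0.prodMk_nhds hb0)
    have h2 : (fun n => ‖A n‖ + ‖b n‖) =O[l] fun n => (s n)⁻¹ := by
      have hA1 : (fun n => s n • A n) =O[l] fun _ => (1 : ℝ) := hA.isBigO_one ℝ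
      have hb1 : (fun n => s n • b n) =O[l] fun _ => (1 : ℝ) := hb.isBigO_one ℝ
      have hsO : (fun n => (s n)⁻¹) =O[l] fun n => (s n)⁻¹ := Asymptotics.isBigO_refl _ _
      have hA2 := hsO.smul hA1
      have hb2 := hsO.smul hb1
      have key := hA2.norm_left.add hb2.norm_left
      refine (key.congr' ?_ ?_)
      · filter_upwards [hs0] with n hn
        rw [smul_smul, smul_smul, inv_mul_cancel₀ hn.ne', one_smul, one_smul]
      · exact Eventually.of_forall fun n => by simp
    have h3 := (h1.trans_isBigO h2).tendsto_div_nhds_zero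
    refine h3.congr' ?_
    filter_upwards [hs0, hdet] with n hn hd
    rw [hFn n hd, he, hDD, ← MemLp.toLp_sub, ← MemLp.toLp_sub, norm_smul, Lp.norm_toLp,
      Real.norm_eq_abs, abs_of_pos hn, div_inv_eq_mul, mul_comm]
    rfl
  have hDDadd : ∀ A' b' A'' b'', DD (A' - A'') (b' - b'') = DD A' b' - DD A'' b'' := by
    intro A' b' A'' b''
    rw [eq_sub_iff_add_eq, hDD, ← MemLp.toLp_add, MemLp.toLp_eq_toLp_iff]
    refine ae_of_all _ fun y => ?_
    rw [Pi.add_apply, ← deformDeriv_add, sub_add_cancel, sub_add_cancel]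
  have hDDsmul : ∀ (r : ℝ) A' b', DD (r • A') (r • b') = r • DD A' b' := by
    intro r A' b'
    rw [hDD, ← MemLp.toLp_const_smul, MemLp.toLp_eq_toLp_iff]
    exact ae_of_all _ fun y => deformDeriv_smul T r A' b' y
  have hFlim : Tendsto (fun n => s n • (F n - e)) l (𝓝 (DD a β)) := by
    have h1 := (hrem.add hDDlim).add_const (DD a β)
    rw [add_zero, zero_add] at h1
    refine h1.congr fun n => ?_
    rw [hDDadd, hDDsmul, smul_sub]
    abel
  have hsc : √c ^ 2 = c := Real.sq_sqrt hc.le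
  have hscn : ‖√c‖ = √c := by rw [Real.norm_eq_abs, abs_of_nonneg (Real.sqrt_nonneg _)]
  have hu : ‖√c • e‖ = 1 := by
    rw [← pow_left_inj₀ (norm_nonneg _) zero_le_one two_ne_zero, norm_smul, mul_pow, hscn, hsc, he,
      norm_toLp_sq, one_pow, hcm]
  have hv : Tendsto (fun n => s n • (√c • F n - √c • e)) l (𝓝 (√c • DD a β)) := by
    refine (hFlim.const_smul √c).congr fun n => ?_
    rw [← smul_sub, smul_comm]
  have hκ : ∀ᶠ n in l, √|(1 + A n).det| * ‖√c • F n‖ = 1 := by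
    filter_upwards [hdet] with n hn
    rw [← pow_left_inj₀ (by positivity) zero_le_one two_ne_zero, mul_pow,
      Real.sq_sqrt (abs_nonneg _), norm_smul, mul_pow, hscn, hsc, hFn n hn, norm_toLp_sq, one_pow,
      integral_comp_deform (b n) hn (g := fun y => η ‖y‖ ^ 2)
        ((hR.measurable.comp measurable_norm).pow_const 2), abs_inv]
    have : |(1 + A n).det| ≠ 0 := abs_ne_zero.2 hn
    rw [mul_left_comm c, hcm, mul_one, mul_inv_cancel₀ this]
  obtain ⟨hi, hii⟩ := tendsto_smul_normalized_sub hu hs hs0 hv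
    (Eventually.of_forall fun n => Real.sqrt_nonneg _) hκ
  have hq : inner ℝ (√c • e) (√c • DD a β) = q := by
    rw [real_inner_smul_left, real_inner_smul_right, ← mul_assoc, ← sq, hsc, he, hDD, inner_toLp]
  rw [hq] at hi hii
  refine ⟨hi, ?_⟩
  have h4 := (tendsto_iff_norm_sub_tendsto_zero.1 hii).pow 2
  rw [zero_pow two_ne_zero] at h4
  refine h4.congr' ?_
  filter_upwards [hs0, hdet] with n hn hd
  have e1 : s n • (√|(1 + A n).det| • √c • F n - √c • e) - (√c • DD a β - q • √c • e)
      = (s n * √c) • (√|(1 + A n).det| • F n - e - (s n)⁻¹ • (DD a β - q • e)) := by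
    have : (s n * √c) • (s n)⁻¹ • (DD a β - q • e) = √c • (DD a β - q • e) := by
      rw [smul_smul, mul_right_comm, mul_inv_cancel₀ hn.ne', one_mul]
    rw [smul_sub (s n * √c), this]
    module
  rw [e1, norm_smul, mul_pow, norm_mul, hscn, mul_pow, hsc, Real.norm_eq_abs, sq_abs, hFn n hd, he,
    hDD, ← MemLp.toLp_const_smul, ← MemLp.toLp_sub, ← MemLp.toLp_const_smul q, ← MemLp.toLp_sub,
    ← MemLp.toLp_const_smul, ← MemLp.toLp_sub, norm_toLp_sq, mul_assoc]
  rfl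

end DeformedRoot

section ScoreMoments

variable {E : Type*} [NormedAddCommGroup E] [InnerProductSpace ℝ E] [FiniteDimensional ℝ E]
  [MeasurableSpace E] [BorelSpace E] {k : ℕ} [NeZero k] {η T : ℝ → ℝ}

/-- Integration by parts in polar coordinates, obtained by differentiating the norm of the root
under dilations. -/
lemma IsRegularRoot.integral_root_mul_norm_mul_deriv (hR : IsRegularRoot k η T)
    (hk : Module.finrank ℝ E = k)
    (hpos : ∀ᵐ r ∂(volume.restrict (Ioi (0 : ℝ))), 0 < η r) :
    (∫ z : E, η ‖z‖ ^ 2)⁻¹ * ∫ y : E, ‖y‖ * T ‖y‖ * η ‖y‖ = -k / 2 := by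
  have hs : Tendsto (fun n : ℕ => (n : ℝ)⁻¹) atTop (𝓝 0) := tendsto_inv_atTop_nhds_zero_nat
  have hs0 : ∀ᶠ n : ℕ in atTop, (0 : ℝ) < n := by
    filter_upwards [eventually_gt_atTop 0] with n hn using Nat.cast_pos.2 hn
  have hA : Tendsto (fun n : ℕ => (n : ℝ) • ((n : ℝ)⁻¹ • (1 : E →L[ℝ] E))) atTop (𝓝 1) := by
    refine tendsto_const_nhds.congr' ?_
    filter_upwards [hs0] with n hn
    rw [smul_smul, mul_inv_cancel₀ hn.ne', one_smul]
  have h := (hR.tendsto_normalized_deform (E := E) hk hpos hs hs0 hA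
    (b := fun _ => 0) (β := 0) (by simp)).1
  have hdet : ∀ n : ℕ, (1 + (n : ℝ)⁻¹ • (1 : E →L[ℝ] E)).det = (1 + (n : ℝ)⁻¹) ^ k := fun n => by
    have : (1 + (n : ℝ)⁻¹ • (1 : E →L[ℝ] E)) = (1 + (n : ℝ)⁻¹) • (1 : E →L[ℝ] E) := by
      rw [add_smul, one_smul]
    rw [this, ContinuousLinearMap.det]
    have e : (((1 + (n : ℝ)⁻¹) • (1 : E →L[ℝ] E) : E →L[ℝ] E) : E →ₗ[ℝ] E)
        = (1 + (n : ℝ)⁻¹) • LinearMap.id := rfl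
    rw [e, LinearMap.det_smul, hk, LinearMap.det_id, mul_one]
  have hder : HasDerivAt (fun x : ℝ => √|(1 + x) ^ k|) (k / 2) 0 := by
    have h1 : HasDerivAt (fun x : ℝ => √((1 + x) ^ k)) (k / 2) 0 := by
      have h2 : HasDerivAt (fun x : ℝ => (1 + x) ^ k) (k * (1 + 0) ^ (k - 1) * 1) 0 :=
        ((hasDerivAt_id (0 : ℝ)).const_add 1).pow k
      have h3 := h2.sqrt (by simp)
      simpa using h3
    refine h1.congr_of_eventuallyEq ?_
    filter_upwards [Ioi_mem_nhds (show (-1 : ℝ) < 0 by norm_num)] with x hx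
    have : (0 : ℝ) < 1 + x := by linarith [mem_Ioi.1 hx]
    rw [abs_of_pos (pow_pos this k)]
  have h5 : Tendsto (fun n : ℕ => (n : ℝ) * (√|(1 + (n : ℝ)⁻¹ • (1 : E →L[ℝ] E)).det| - 1)) atTop
      (𝓝 (k / 2)) := by
    have h6 := (hasDerivAt_iff_tendsto_slope_zero.1 hder).comp (f := fun n : ℕ => (n : ℝ)⁻¹)
      (x := atTop) (tendsto_nhdsWithin_iff.2 ⟨hs, by
        filter_upwards [hs0] with n hn
        exact inv_ne_zero hn.ne'⟩)
    refine h6.congr fun n => ?_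
    rw [hdet]
    simp
  have h7 := tendsto_nhds_unique h h5
  have h8 : ∀ y : E, η ‖y‖ * deformDeriv T 1 0 y = ‖y‖ * T ‖y‖ * η ‖y‖ := fun y => by
    rw [deformDeriv, one_apply_eq_self, sub_zero, real_inner_self_eq_norm_sq]
    rcases eq_or_ne ‖y‖ 0 with hy | hy
    · simp [hy]
    · field_simp
  simp only [h8] at h7
  linarith

lemma integral_comp_norm_mul_inner (F : ℝ → ℝ) (b : E) :
    ∫ y, F ‖y‖ * (inner ℝ b y / ‖y‖) = 0 :=
  isSpherical_volume.integral_odd fun y => by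
    rw [norm_neg, inner_neg_right]; ring

lemma integrable_comp_norm_mul_inner {F : ℝ → ℝ} (hF : Integrable fun y : E => F ‖y‖) (b : E) :
    Integrable fun y => F ‖y‖ * (inner ℝ b y / ‖y‖) :=
  integrable_mul_of_norm_le hF (by fun_prop) (abs_inner_div_norm_le b)

lemma abs_quadratic_div_le (a : E →L[ℝ] E) (y : E) : |inner ℝ y (a y) / ‖y‖ ^ 2| ≤ ‖a‖ := by
  rw [abs_div, abs_pow, abs_norm]
  rcases eq_or_ne y 0 with rfl | hy
  · simp
  · rw [div_le_iff₀ (by positivity)]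
    refine (abs_real_inner_le_norm _ _).trans ?_
    nlinarith [a.le_opNorm y, norm_nonneg y]

lemma measurable_quadratic_div (a : E →L[ℝ] E) :
    Measurable fun y : E => inner ℝ y (a y) / ‖y‖ ^ 2 := by
  fun_prop

lemma deformDeriv_eq (T : ℝ → ℝ) (a : E →L[ℝ] E) (b y : E) :
    deformDeriv T a b y = ‖y‖ * T ‖y‖ * (inner ℝ y (a y) / ‖y‖ ^ 2)
      - T ‖y‖ * (inner ℝ b y / ‖y‖) := by
  rw [deformDeriv, inner_sub_right, real_inner_comm b y]
  rcases eq_or_ne ‖y‖ 0 with hy | hy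
  · simp [hy]
  · field_simp

lemma IsRegularRoot.integral_root_mul_deformDeriv (hR : IsRegularRoot k η T)
    (hk : Module.finrank ℝ E = k)
    (hpos : ∀ᵐ r ∂(volume.restrict (Ioi (0 : ℝ))), 0 < η r) {a : E →L[ℝ] E}
    (ha : (a : E →ₗ[ℝ] E).IsSymmetric) (b : E) :
    (∫ z : E, η ‖z‖ ^ 2)⁻¹ * ∫ y, η ‖y‖ * deformDeriv T a b y
      = -(LinearMap.trace ℝ E a) / 2 := by
  have hk0 : (k : ℝ) ≠ 0 := Nat.cast_ne_zero.2 (NeZero.ne k)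
  have := nontrivial_of_finrank_eq hk
  have hF1 : Integrable fun y : E => ‖y‖ * T ‖y‖ * η ‖y‖ :=
    (hR.memLp_norm_mul_deriv hk).integrable_mul (hR.memLp_root hk)
  have hF2 : Integrable fun y : E => T ‖y‖ * η ‖y‖ :=
    (hR.memLp_deriv hk).integrable_mul (hR.memLp_root hk)
  have e : ∀ y : E, η ‖y‖ * deformDeriv T a b y
      = ‖y‖ * T ‖y‖ * η ‖y‖ * (inner ℝ y (a y) / ‖y‖ ^ 2)
        - T ‖y‖ * η ‖y‖ * (inner ℝ b y / ‖y‖) := fun y => by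
    rw [deformDeriv_eq]
    ring
  have i1 : Integrable fun y : E => ‖y‖ * T ‖y‖ * η ‖y‖ * (inner ℝ y (a y) / ‖y‖ ^ 2) :=
    integrable_mul_of_norm_le (F := fun r => r * T r * η r) hF1 (measurable_quadratic_div a)
      (abs_quadratic_div_le a)
  have i2 : Integrable fun y : E => T ‖y‖ * η ‖y‖ * (inner ℝ b y / ‖y‖) :=
    integrable_comp_norm_mul_inner (F := fun r => T r * η r) hF2 b
  have h1 : ∫ y : E, ‖y‖ * T ‖y‖ * η ‖y‖ * (inner ℝ y (a y) / ‖y‖ ^ 2)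
      = LinearMap.trace ℝ E a / k * ∫ y : E, ‖y‖ * T ‖y‖ * η ‖y‖ :=
    isSpherical_volume.integral_quadratic (F := fun r => r * T r * η r) (by simp) hk hF1 ha
  have h2 : ∫ y : E, T ‖y‖ * η ‖y‖ * (inner ℝ b y / ‖y‖) = 0 :=
    integral_comp_norm_mul_inner (fun r => T r * η r) b
  simp only [e]
  rw [integral_sub i1 i2, h1, h2, sub_zero, mul_left_comm]
  have := hR.integral_root_mul_norm_mul_deriv (E := E) hk hpos
  rw [this]
  field_simp

lemma IsRegularRoot.integral_deformDeriv_sq (hR : IsRegularRoot k η T)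
    (hk : Module.finrank ℝ E = k) {a : E →L[ℝ] E}
    (ha : (a : E →ₗ[ℝ] E).IsSymmetric) (b : E) :
    (∫ z : E, η ‖z‖ ^ 2)⁻¹ * ∫ y, (2 * deformDeriv T a b y) ^ 2
      = rootLocInfo E η T / k * ‖b‖ ^ 2 + rootShapeInfo E η T / (k * (k + 2))
        * (2 * LinearMap.trace ℝ E ((a : E →ₗ[ℝ] E) * a) + LinearMap.trace ℝ E a ^ 2) := by
  have := nontrivial_of_finrank_eq hk
  have hF1 : Integrable fun y : E => (2 * (‖y‖ * T ‖y‖)) ^ 2 :=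
    ((hR.memLp_norm_mul_deriv hk).const_mul 2).integrable_sq
  have hF2 : Integrable fun y : E => (2 * T ‖y‖) ^ 2 :=
    ((hR.memLp_deriv hk).const_mul 2).integrable_sq
  have i1 : Integrable fun y : E => (2 * (‖y‖ * T ‖y‖)) ^ 2 * (inner ℝ y (a y) / ‖y‖ ^ 2) ^ 2 :=
    integrable_mul_of_norm_le (F := fun r => (2 * (r * T r)) ^ 2) (C := ‖a‖ ^ 2) hF1
      ((measurable_quadratic_div a).pow_const 2) fun y => by
        rw [abs_pow]
        exact pow_le_pow_left₀ (abs_nonneg _) (abs_quadratic_div_le a y) 2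
  have i2 : Integrable fun y : E => (2 * T ‖y‖) ^ 2 * (inner ℝ b y / ‖y‖) ^ 2 := by
    simpa using integrable_inner_div_pow (F := fun r => (2 * T r) ^ 2) hF2 b b 2 0
  have h1 : ∫ y : E, (2 * (‖y‖ * T ‖y‖)) ^ 2 * (inner ℝ y (a y) / ‖y‖ ^ 2) ^ 2
      = (2 * LinearMap.trace ℝ E ((a : E →ₗ[ℝ] E) * a) + LinearMap.trace ℝ E a ^ 2)
        / (k * (k + 2)) * ∫ y : E, (2 * (‖y‖ * T ‖y‖)) ^ 2 :=
    isSpherical_volume.integral_quadratic_sq (F := fun r => (2 * (r * T r)) ^ 2) (by simp) hk hF1 ha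
  have h2 : ∫ y : E, (2 * T ‖y‖) ^ 2 * (inner ℝ b y / ‖y‖) ^ 2
      = ‖b‖ ^ 2 / k * ∫ y : E, (2 * T ‖y‖) ^ 2 :=
    isSpherical_volume.integral_inner_sq (F := fun r => (2 * T r) ^ 2) (by simp) hk hF2 b
  have hsq := (((hR.memLp_deformDeriv hk a b).const_mul 2).integrable_sq)
  -- The product of the quadratic and the linear part is odd.
  have hodd : ∫ y, (2 * (2 * (‖y‖ * T ‖y‖ * (inner ℝ y (a y) / ‖y‖ ^ 2)))
      * (2 * (T ‖y‖ * (inner ℝ b y / ‖y‖)))) = 0 :=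
    isSpherical_volume.integral_odd fun y => by
      simp only [norm_neg, inner_neg_right, inner_neg_left, map_neg]
      ring
  have e : ∀ y : E, (2 * (‖y‖ * T ‖y‖)) ^ 2 * (inner ℝ y (a y) / ‖y‖ ^ 2) ^ 2
      + (2 * T ‖y‖) ^ 2 * (inner ℝ b y / ‖y‖) ^ 2
      = (2 * deformDeriv T a b y) ^ 2 + (2 * (2 * (‖y‖ * T ‖y‖ * (inner ℝ y (a y) / ‖y‖ ^ 2)))
      * (2 * (T ‖y‖ * (inner ℝ b y / ‖y‖)))) := fun y => by
    rw [deformDeriv_eq]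
    ring
  have i3 : Integrable fun y => (2 * (2 * (‖y‖ * T ‖y‖ * (inner ℝ y (a y) / ‖y‖ ^ 2)))
      * (2 * (T ‖y‖ * (inner ℝ b y / ‖y‖)))) := by
    refine ((i1.add i2).sub hsq).congr (ae_of_all _ fun y => ?_)
    have := e y
    simp only [Pi.sub_apply, Pi.add_apply]
    rw [this]
    ring
  have h := integral_add i1 i2
  simp only [e] at h
  rw [integral_add hsq i3, hodd, add_zero, h1, h2] at h
  rw [h, rootLocInfo, rootShapeInfo]
  ring

/-- The second moment of the score in the direction of the deformation `(a, b)`. -/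
def scoreInfo (E : Type*) [NormedAddCommGroup E] [InnerProductSpace ℝ E] [FiniteDimensional ℝ E]
    [MeasurableSpace E] [BorelSpace E] (k : ℕ) (η T : ℝ → ℝ) (a : E →L[ℝ] E) (b : E) : ℝ :=
  rootLocInfo E η T / k * ‖b‖ ^ 2 + (rootShapeInfo E η T / (k * (k + 2))
    * (2 * LinearMap.trace ℝ E ((a : E →ₗ[ℝ] E) * a) + LinearMap.trace ℝ E a ^ 2)
      - LinearMap.trace ℝ E a ^ 2)

lemma IsRegularRoot.integral_rootScore_sq (hR : IsRegularRoot k η T)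
    (hk : Module.finrank ℝ E = k)
    (hpos : ∀ᵐ r ∂(volume.restrict (Ioi (0 : ℝ))), 0 < η r) {a : E →L[ℝ] E}
    (ha : (a : E →ₗ[ℝ] E).IsSymmetric) (b : E) :
    ∫ y, rootScore η T a b y ^ 2 ∂(rootLaw η) = scoreInfo E k η T a b := by
  have hm := hR.integral_sq_pos (E := E) hk hpos
  have hD := hR.memLp_deformDeriv hk a b
  have hη := hR.memLp_root (E := E) hk
  set t := LinearMap.trace ℝ E (a : E →ₗ[ℝ] E) with ht
  have i1 : Integrable fun y => (2 * deformDeriv T a b y) ^ 2 := (hD.const_mul 2).integrable_sq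
  have i2 : Integrable fun y => 4 * t * (η ‖y‖ * deformDeriv T a b y) :=
    (hη.integrable_mul hD).const_mul _
  have i3 : Integrable fun y : E => t ^ 2 * η ‖y‖ ^ 2 := hη.integrable_sq.const_mul _
  have i12 : Integrable fun y => (2 * deformDeriv T a b y) ^ 2
      + 4 * t * (η ‖y‖ * deformDeriv T a b y) := i1.add i2
  have e : (fun y => rootScore η T a b y ^ 2 * η ‖y‖ ^ 2) =ᵐ[volume] fun y =>
      (2 * deformDeriv T a b y) ^ 2 + 4 * t * (η ‖y‖ * deformDeriv T a b y)
        + t ^ 2 * η ‖y‖ ^ 2 := by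
    filter_upwards [rootScore_mul_root hk hpos a b] with y hy
    rw [← mul_pow, hy]
    ring
  rw [hR.integral_rootLaw, integral_congr_ae e, integral_add i12 i3, integral_add i1 i2,
    integral_const_mul, integral_const_mul, mul_add, mul_add, hR.integral_deformDeriv_sq hk ha b,
    mul_left_comm _ (4 * t), hR.integral_root_mul_deformDeriv hk hpos ha b, mul_left_comm _ (t ^ 2),
    inv_mul_cancel₀ hm.ne', scoreInfo]
  ring

lemma IsRegularRoot.integral_rootScore (hR : IsRegularRoot k η T)
    (hk : Module.finrank ℝ E = k)
    (hpos : ∀ᵐ r ∂(volume.restrict (Ioi (0 : ℝ))), 0 < η r) {a : E →L[ℝ] E}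
    (ha : (a : E →ₗ[ℝ] E).IsSymmetric) (b : E) :
    ∫ y, rootScore η T a b y ∂(rootLaw η) = 0 := by
  have hm := hR.integral_sq_pos (E := E) hk hpos
  have hD := hR.memLp_deformDeriv hk a b
  have hη := hR.memLp_root (E := E) hk
  set t := LinearMap.trace ℝ E (a : E →ₗ[ℝ] E) with ht
  have i2 : Integrable fun y => 2 * (η ‖y‖ * deformDeriv T a b y) :=
    (hη.integrable_mul hD).const_mul _
  have i3 : Integrable fun y : E => t * η ‖y‖ ^ 2 := hη.integrable_sq.const_mul _
  have e : (fun y => rootScore η T a b y * η ‖y‖ ^ 2) =ᵐ[volume] fun y =>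
      2 * (η ‖y‖ * deformDeriv T a b y) + t * η ‖y‖ ^ 2 := by
    filter_upwards [rootScore_mul_root hk hpos a b] with y hy
    rw [sq, ← mul_assoc, hy]
    ring
  rw [hR.integral_rootLaw, integral_congr_ae e, integral_add i2 i3,
    integral_const_mul, integral_const_mul, mul_add,
    mul_left_comm _ 2, hR.integral_root_mul_deformDeriv hk hpos ha b, mul_left_comm _ t,
    inv_mul_cancel₀ hm.ne']
  ring

lemma integral_comp_norm_pos [Nontrivial E] {g : ℝ → ℝ} (hg0 : ∀ r, 0 ≤ g r)
    (hi : Integrable fun y : E => g ‖y‖)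
    (hne : ¬ ∀ᵐ r ∂(volume.restrict (Ioi (0 : ℝ))), g r = 0) : 0 < ∫ y : E, g ‖y‖ := by
  refine (integral_nonneg fun y => hg0 _).lt_of_ne fun h0 => hne ?_
  have hi' := (integrable_fun_norm_addHaar (volume : Measure E) (f := g)).1 hi
  rw [integral_fun_norm_addHaar] at h0
  have hb : 0 < (volume : Measure E).real (Metric.ball 0 1) :=
    ENNReal.toReal_pos (Metric.measure_ball_pos _ _ one_pos).ne' measure_ball_lt_top.ne
  have hd : 0 < Module.finrank ℝ E := Module.finrank_pos
  have h1 : ∫ y in Ioi (0 : ℝ), y ^ (Module.finrank ℝ E - 1) • g y = 0 := by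
    have := h0.symm
    simp only [smul_eq_mul, nsmul_eq_mul, mul_eq_zero, Nat.cast_eq_zero, hd.ne', hb.ne',
      false_or] at this
    simpa using this
  rw [setIntegral_eq_zero_iff_of_nonneg_ae ?_ hi'] at h1
  · filter_upwards [h1, ae_restrict_mem measurableSet_Ioi] with r hr hr0
    have hr0' : (0 : ℝ) < r := hr0
    have : r ^ (Module.finrank ℝ E - 1) * g r = 0 := hr
    exact (mul_eq_zero.1 this).resolve_left (pow_pos hr0' _).ne'
  · filter_upwards [ae_restrict_mem measurableSet_Ioi] with r hr0
    have hr0' : (0 : ℝ) < r := hr0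
    exact mul_nonneg (pow_pos hr0' _).le (hg0 r)

lemma IsRegularRoot.rootLocInfo_pos (hR : IsRegularRoot k η T)
    (hk : Module.finrank ℝ E = k)
    (hpos : ∀ᵐ r ∂(volume.restrict (Ioi (0 : ℝ))), 0 < η r) : 0 < rootLocInfo E η T := by
  have := nontrivial_of_finrank_eq hk
  refine mul_pos (inv_pos.2 (hR.integral_sq_pos hk hpos)) (integral_comp_norm_pos
    (g := fun r => (2 * T r) ^ 2) (fun r => sq_nonneg _)
    ((hR.memLp_deriv hk).const_mul 2).integrable_sq fun h => ?_)
  refine hR.not_ae_mul_deriv_eq (Nat.pos_of_ne_zero (NeZero.ne k)) hpos 0 ?_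
  filter_upwards [h] with r hr
  have : T r = 0 := by simpa using hr
  rw [this]
  simp

/-- The Cauchy–Schwarz inequality for the identity `integral_root_mul_norm_mul_deriv`; equality would
make the root a power. -/
lemma IsRegularRoot.sq_dim_lt_rootShapeInfo (hR : IsRegularRoot k η T)
    (hk : Module.finrank ℝ E = k)
    (hpos : ∀ᵐ r ∂(volume.restrict (Ioi (0 : ℝ))), 0 < η r) :
    (k : ℝ) ^ 2 < rootShapeInfo E η T := by
  have := nontrivial_of_finrank_eq hk
  have hm := hR.integral_sq_pos (E := E) hk hpos
  have hη := hR.memLp_root (E := E) hk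
  have hT := hR.memLp_norm_mul_deriv (E := E) hk
  have h1 : 0 < ∫ y : E, (2 * (‖y‖ * T ‖y‖) + k * η ‖y‖) ^ 2 := by
    refine integral_comp_norm_pos (g := fun r => (2 * (r * T r) + k * η r) ^ 2)
      (fun r => sq_nonneg _) ((hT.const_mul 2).add (hη.const_mul k)).integrable_sq fun h => ?_
    refine hR.not_ae_mul_deriv_eq (Nat.pos_of_ne_zero (NeZero.ne k)) hpos (k / 2) ?_
    filter_upwards [h] with r hr
    have : 2 * (r * T r) + k * η r = 0 := by simpa using hr
    linarith
  have i1 : Integrable fun y : E => (2 * (‖y‖ * T ‖y‖)) ^ 2 := (hT.const_mul 2).integrable_sq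
  have i2 : Integrable fun y : E => 4 * k * (‖y‖ * T ‖y‖ * η ‖y‖) :=
    (hT.integrable_mul hη).const_mul _
  have i3 : Integrable fun y : E => (k : ℝ) ^ 2 * η ‖y‖ ^ 2 := hη.integrable_sq.const_mul _
  have i12 : Integrable fun y : E => (2 * (‖y‖ * T ‖y‖)) ^ 2
      + 4 * k * (‖y‖ * T ‖y‖ * η ‖y‖) := i1.add i2
  have e : ∀ y : E, (2 * (‖y‖ * T ‖y‖) + k * η ‖y‖) ^ 2
      = (2 * (‖y‖ * T ‖y‖)) ^ 2 + 4 * k * (‖y‖ * T ‖y‖ * η ‖y‖) + (k : ℝ) ^ 2 * η ‖y‖ ^ 2 :=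
    fun y => by ring
  simp only [e] at h1
  rw [integral_add i12 i3, integral_add i1 i2, integral_const_mul, integral_const_mul] at h1
  have h2 := mul_pos (inv_pos.2 hm) h1
  rw [mul_add, mul_add, mul_left_comm _ (4 * (k : ℝ)), mul_left_comm _ ((k : ℝ) ^ 2),
    inv_mul_cancel₀ hm.ne', hR.integral_root_mul_norm_mul_deriv hk hpos] at h2
  rw [rootShapeInfo]
  linarith

lemma rootScore_sub (a a' : E →L[ℝ] E) (b b' y : E) :
    rootScore η T a b y - rootScore η T a' b' y = rootScore η T (a - a') (b - b') y := by
  have h := deformDeriv_add T (a - a') a' (b - b') b' y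
  rw [sub_add_cancel, sub_add_cancel] at h
  have : LinearMap.trace ℝ E ((a - a' : E →L[ℝ] E) : E →ₗ[ℝ] E)
      = LinearMap.trace ℝ E a - LinearMap.trace ℝ E a' := map_sub (LinearMap.trace ℝ E) _ _
  rw [rootScore, rootScore, rootScore, h, this]
  ring

/-- The root of the density ratio between the deformed and the undeformed law. -/
def rootRatio (η : ℝ → ℝ) (A : E →L[ℝ] E) (b y : E) : ℝ :=
  √|(1 + A).det| * η ‖y + (A y - b)‖ / η ‖y‖

lemma measurable_rootRatio (hR : IsRegularRoot k η T) (A : E →L[ℝ] E) (b : E) :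
    Measurable (rootRatio η A b) := by
  have h1 : Measurable fun y : E => η ‖y + (A y - b)‖ :=
    hR.measurable.comp (measurable_norm.comp (measurable_deform A b))
  have h2 : Measurable fun y : E => η ‖y‖ := hR.measurable.comp measurable_norm
  exact (h1.const_mul _).div h2

lemma rootRatio_mul_root (hk : Module.finrank ℝ E = k)
    (hpos : ∀ᵐ r ∂(volume.restrict (Ioi (0 : ℝ))), 0 < η r) (A : E →L[ℝ] E) (b : E) :
    (fun y => rootRatio η A b y * η ‖y‖)
      =ᵐ[volume] fun y => √|(1 + A).det| * η ‖y + (A y - b)‖ := by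
  have := nontrivial_of_finrank_eq hk
  filter_upwards [ae_comp_norm (E := E) hpos] with y hy
  rw [rootRatio]
  field_simp

lemma IsRegularRoot.memLp_rootRatio (hR : IsRegularRoot k η T) (hk : Module.finrank ℝ E = k)
    (hpos : ∀ᵐ r ∂(volume.restrict (Ioi (0 : ℝ))), 0 < η r) {A : E →L[ℝ] E} (b : E)
    (h : (1 + A).det ≠ 0) : MemLp (rootRatio η A b) 2 (rootLaw η) := by
  refine hR.memLp_rootLaw (measurable_rootRatio hR A b) ?_
  rw [memLp_congr_ae (rootRatio_mul_root hk hpos A b)]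
  exact (hR.memLp_comp_deform hk b h).const_mul _

lemma IsRegularRoot.integral_rootRatio_sq (hR : IsRegularRoot k η T)
    (hk : Module.finrank ℝ E = k)
    (hpos : ∀ᵐ r ∂(volume.restrict (Ioi (0 : ℝ))), 0 < η r) {A : E →L[ℝ] E} (b : E)
    (h : (1 + A).det ≠ 0) : ∫ y, rootRatio η A b y ^ 2 ∂(rootLaw η) = 1 := by
  have hm := hR.integral_sq_pos (E := E) hk hpos
  have e : (fun y => rootRatio η A b y ^ 2 * η ‖y‖ ^ 2) =ᵐ[volume]
      fun y => |(1 + A).det| * (fun z => η ‖z‖ ^ 2) (y + (A y - b)) := by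
    filter_upwards [rootRatio_mul_root hk hpos A b] with y hy
    rw [← mul_pow, hy, mul_pow, Real.sq_sqrt (abs_nonneg _)]
  rw [hR.integral_rootLaw, integral_congr_ae e, integral_const_mul, integral_comp_deform b h
    (g := fun z => η ‖z‖ ^ 2) ((hR.measurable.comp measurable_norm).pow_const 2), abs_inv,
    mul_inv_cancel_left₀ (abs_ne_zero.2 h), inv_mul_cancel₀ hm.ne']

/-- The root density ratios are differentiable in quadratic mean, with derivative half the score. -/
theorem IsRegularRoot.tendsto_rootRatio {ι : Type*} {l : Filter ι}
    (hR : IsRegularRoot k η T) (hk : Module.finrank ℝ E = k)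
    (hpos : ∀ᵐ r ∂(volume.restrict (Ioi (0 : ℝ))), 0 < η r)
    {s : ι → ℝ} (hs : Tendsto (fun n => (s n)⁻¹) l (𝓝 0)) (hs0 : ∀ᶠ n in l, 0 < s n)
    {A : ι → E →L[ℝ] E} {b : ι → E} {a : E →L[ℝ] E} {β : E}
    (ha : (a : E →ₗ[ℝ] E).IsSymmetric)
    (hA : Tendsto (fun n => s n • A n) l (𝓝 a)) (hb : Tendsto (fun n => s n • b n) l (𝓝 β)) :
    Tendsto (fun n => s n ^ 2 * ∫ y, (rootRatio η (A n) (b n) y - 1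
      - (2 * s n)⁻¹ * rootScore η T a β y) ^ 2 ∂(rootLaw η)) l (𝓝 0) := by
  have h := (hR.tendsto_normalized_deform hk hpos hs hs0 hA hb).2
  refine h.congr fun n => ?_
  rw [hR.integral_rootLaw, hR.integral_root_mul_deformDeriv hk hpos ha β]
  congr 2
  refine integral_congr_ae ?_
  filter_upwards [rootRatio_mul_root hk hpos (A n) (b n), rootScore_mul_root hk hpos a β]
    with y h1 h2
  rw [← mul_pow, sub_mul, sub_mul, h1, one_mul, mul_assoc, h2, mul_inv]
  ring

end ScoreMoments

/-! ### Square roots of positive definite matrices -/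

section MatrixSqrt

variable {ι : Type*} [Fintype ι] [DecidableEq ι]

open scoped MatrixOrder in
/-- The positive semidefinite square root of a matrix. -/
def matSqrt (A : Matrix ι ι ℝ) : Matrix ι ι ℝ := CFC.sqrt A

open scoped MatrixOrder in
lemma posSemidef_sqrt (A : Matrix ι ι ℝ) : (matSqrt A).PosSemidef :=
  Matrix.nonneg_iff_posSemidef.1 (CFC.sqrt_nonneg A)

open scoped MatrixOrder in
lemma sqrt_mul_self {A : Matrix ι ι ℝ} (hA : A.PosSemidef) : matSqrt A * matSqrt A = A :=
  CFC.sqrt_mul_sqrt_self A hA.nonneg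

lemma invSqrt_eq (A : Matrix ι ι ℝ) : invSqrt A = (matSqrt A)⁻¹ := rfl

lemma posDef_sqrt {A : Matrix ι ι ℝ} (hA : A.PosDef) : (matSqrt A).PosDef := by
  refine (posSemidef_sqrt A).posDef_iff_det_ne_zero.2 fun h => hA.det_pos.ne' ?_
  rw [← sqrt_mul_self hA.posSemidef, Matrix.det_mul, h, zero_mul]

open scoped MatrixOrder in
lemma sqrt_eq_of_mul_self {A B : Matrix ι ι ℝ} (hB : B.PosSemidef) (h : B * B = A) :
    matSqrt A = B := CFC.sqrt_unique h hB.nonneg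

lemma posDef_invSqrt {A : Matrix ι ι ℝ} (hA : A.PosDef) : (invSqrt A).PosDef :=
  (posDef_sqrt hA).inv

lemma invSqrt_mul_self {A : Matrix ι ι ℝ} (hA : A.PosDef) : invSqrt A * invSqrt A = A⁻¹ := by
  rw [invSqrt_eq, ← Matrix.mul_inv_rev, sqrt_mul_self hA.posSemidef]

lemma invSqrt_mul_sqrt {A : Matrix ι ι ℝ} (hA : A.PosDef) : invSqrt A * matSqrt A = 1 :=
  Matrix.nonsing_inv_mul _ (posDef_sqrt hA).det_pos.ne'.isUnit

lemma invSqrt_kronecker {κ : Type*} [Fintype κ] [DecidableEq κ] {A : Matrix ι ι ℝ}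
    {B : Matrix κ κ ℝ} (hA : A.PosDef) (hB : B.PosDef) :
    invSqrt (A ⊗ₖ B) = invSqrt A ⊗ₖ invSqrt B := by
  rw [invSqrt_eq, invSqrt_eq, invSqrt_eq, ← Matrix.inv_kronecker]
  congr 1
  refine sqrt_eq_of_mul_self ((posSemidef_sqrt A).kronecker (posSemidef_sqrt B)) ?_
  rw [← Matrix.mul_kronecker_mul, sqrt_mul_self hA.posSemidef, sqrt_mul_self hB.posSemidef]

lemma posDef_isSymm {A : Matrix ι ι ℝ} (hA : A.PosDef) : Aᵀ = A := by
  have := hA.isHermitian.eq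
  rwa [Matrix.conjTranspose_eq_transpose_of_trivial] at this

open scoped MatrixOrder in
open scoped Matrix.Norms.L2Operator in
lemma tendsto_sqrt {α : Type*} {l : Filter α} {A : α → Matrix ι ι ℝ} {A₀ : Matrix ι ι ℝ}
    (h : Tendsto A l (𝓝 A₀)) (hA : ∀ᶠ n in l, (A n).PosSemidef) (hA₀ : A₀.PosSemidef) :
    Tendsto (fun n => matSqrt (A n)) l (𝓝 (matSqrt A₀)) := by
  have h1 := CFC.continuousOn_sqrt (A := Matrix ι ι ℝ) A₀ hA₀.nonneg
  exact h1.tendsto.comp (tendsto_nhdsWithin_iff.2 ⟨h, hA.mono fun n hn => hn.nonneg⟩)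

lemma tendsto_matrix_inv {α : Type*} {l : Filter α} {A : α → Matrix ι ι ℝ} {A₀ : Matrix ι ι ℝ}
    (h : Tendsto A l (𝓝 A₀)) (hA₀ : A₀.det ≠ 0) : Tendsto (fun n => (A n)⁻¹) l (𝓝 A₀⁻¹) := by
  simp only [Matrix.inv_def, Ring.inverse_eq_inv']
  have hd : Tendsto (fun n => (A n).det) l (𝓝 A₀.det) :=
    (continuous_id.matrix_det.tendsto A₀).comp h
  have ha : Tendsto (fun n => (A n).adjugate) l (𝓝 A₀.adjugate) :=
    (continuous_id.matrix_adjugate.tendsto A₀).comp h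
  exact (hd.inv₀ hA₀).smul ha

lemma sqrt_one_matrix : matSqrt (1 : Matrix ι ι ℝ) = 1 :=
  sqrt_eq_of_mul_self Matrix.PosSemidef.one (one_mul 1)

/-- The derivative of `W ↦ (1 + W)^{-1/2}` at `0`, along sequences. -/
lemma tendsto_smul_invSqrt_sub_one {α : Type*} {l : Filter α} {s : α → ℝ}
    (hs : Tendsto (fun n => (s n)⁻¹) l (𝓝 0)) (hs0 : ∀ᶠ n in l, 0 < s n)
    {S : α → Matrix ι ι ℝ} {W : Matrix ι ι ℝ} (hS : ∀ᶠ n in l, (S n).PosDef)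
    (h : Tendsto (fun n => s n • ((S n)⁻¹ - 1)) l (𝓝 W)) :
    Tendsto (fun n => s n • (matSqrt (S n) - 1)) l (𝓝 (-(1 / 2 : ℝ) • W)) := by
  have hinv : Tendsto (fun n => (S n)⁻¹) l (𝓝 1) := by
    have h1 := (hs.smul h).add_const 1
    rw [zero_smul, zero_add] at h1
    refine h1.congr' ?_
    filter_upwards [hs0] with n hn
    rw [smul_smul, inv_mul_cancel₀ hn.ne', one_smul, sub_add_cancel]
  have hS1 : Tendsto S l (𝓝 1) := by
    have h1 := tendsto_matrix_inv hinv (by simp)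
    rw [inv_one] at h1
    refine h1.congr' ?_
    filter_upwards [hS] with n hn
    exact Matrix.nonsing_inv_nonsing_inv _ hn.det_pos.ne'.isUnit
  have hB : Tendsto (fun n => matSqrt (S n)) l (𝓝 1) := by
    have := tendsto_sqrt hS1 (hS.mono fun n hn => hn.posSemidef) Matrix.PosSemidef.one
    rwa [sqrt_one_matrix] at this
  have hB2 : Tendsto (fun n => (matSqrt (S n) + 1)⁻¹) l (𝓝 ((1 / 2 : ℝ) • 1)) := by
    have h2 : (1 + 1 : Matrix ι ι ℝ) = (2 : ℝ) • 1 := by rw [two_smul]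
    have h1 := tendsto_matrix_inv (hB.add_const 1) (by rw [h2, Matrix.det_smul]; simp)
    have h3 : (1 + 1 : Matrix ι ι ℝ)⁻¹ = (1 / 2 : ℝ) • 1 := by
      refine Matrix.inv_eq_left_inv ?_
      rw [h2, smul_mul_smul_comm, one_mul]
      norm_num
    rwa [h3] at h1
  have hlim := ((hS1.mul h).neg).mul hB2
  have e : -(1 * W) * ((1 / 2 : ℝ) • 1) = -(1 / 2 : ℝ) • W := by
    rw [one_mul, mul_smul_comm, mul_one, smul_neg, neg_smul]
  rw [e] at hlim
  refine hlim.congr' ?_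
  filter_upwards [hS] with n hn
  have hd : IsUnit (matSqrt (S n) + 1).det :=
    ((posDef_sqrt hn).add_posSemidef Matrix.PosSemidef.one).det_pos.ne'.isUnit
  have h1 : S n * (S n)⁻¹ = 1 := Matrix.mul_nonsing_inv _ hn.det_pos.ne'.isUnit
  have h2 : (matSqrt (S n) - 1) * (matSqrt (S n) + 1) = S n - 1 := by
    have := sqrt_mul_self hn.posSemidef
    rw [sub_mul, mul_add, mul_one, one_mul, this]
    abel
  have h3 : -(S n * s n • ((S n)⁻¹ - 1)) = s n • (S n - 1) := by
    rw [mul_smul_comm, mul_sub, h1, mul_one, ← smul_neg, neg_sub]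
  rw [h3, ← h2, smul_mul_assoc, Matrix.mul_nonsing_inv_cancel_right _ _ hd]

end MatrixSqrt

/-! ### Vectorization -/

section Vec

variable {k : ℕ}

lemma commMat_mulVec_vec (A : Matrix (Fin k) (Fin k) ℝ) :
    commMat k *ᵥ A.vec = Aᵀ.vec := by
  ext ⟨i, j⟩
  simp only [commMat, Matrix.sum_mulVec, Matrix.kronecker_mulVec_vec, Matrix.transpose_single,
    Matrix.single_mul_mul_single, Finset.sum_apply, Matrix.vec, Matrix.single_apply, one_mul,
    mul_one, Matrix.transpose_apply, ite_and]
  simp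

lemma jMat_mulVec_vec (A : Matrix (Fin k) (Fin k) ℝ) :
    jMat k *ᵥ A.vec = A.trace • (1 : Matrix (Fin k) (Fin k) ℝ).vec := by
  ext ⟨i, j⟩
  simp only [jMat, Matrix.sum_mulVec, Matrix.kronecker_mulVec_vec, Matrix.transpose_single,
    Matrix.single_mul_mul_single, Finset.sum_apply, Matrix.vec, Matrix.single_apply, one_mul,
    mul_one, ite_and, Pi.smul_apply, smul_eq_mul, Matrix.one_apply, Matrix.trace, Matrix.diag]
  rcases eq_or_ne i j with h | h
  · simp [h]
  · simp [h.symm]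

end Vec

/-! ### The central sequence and the information matrix as quadratic functionals -/

section Directions

variable {k : ℕ} [NeZero k]

/-- The symmetric matrix with vanishing corner entry which is the shape component of a
direction. -/
def shapeDir (τ : Param k) : Matrix (Fin k) (Fin k) ℝ :=
  unvech 0 fun p => τ (Sum.inr (Sum.inr p))

lemma unvech_transpose (c : ℝ) (w : VechIdx k → ℝ) : (unvech c w)ᵀ = unvech c w := by
  ext i j
  simp only [unvech, Matrix.transpose_apply, Matrix.of_apply]
  by_cases h : (i, j) = (0, 0)
  · have h' : (j, i) = (0, 0) := by
      simp only [Prod.mk.injEq] at h ⊢; exact h.symm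
    rw [dif_pos h, dif_pos h']
  · have h' : ¬ (j, i) = (0, 0) := by
      simp only [Prod.mk.injEq] at h ⊢; exact fun hh => h hh.symm
    rw [dif_neg h, dif_neg h']
    congr 2
    rw [min_comm, max_comm]

lemma shapeDir_transpose (τ : Param k) : (shapeDir τ)ᵀ = shapeDir τ := unvech_transpose _ _

lemma shape_add_smul (ϑ τ : Param k) (ε : ℝ) :
    shape (ϑ + ε • τ) = shape ϑ + ε • shapeDir τ := by
  ext i j
  simp only [shape, shapeDir, unvech, Matrix.of_apply, Matrix.add_apply, Matrix.smul_apply]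
  split_ifs <;> simp

lemma shapeDir_zero_zero (τ : Param k) : shapeDir τ 0 0 = 0 := by
  simp [shapeDir, unvech]

lemma shapeDir_apply (τ : Param k) (p : VechIdx k) :
    shapeDir τ p.1.1 p.1.2 = τ (Sum.inr (Sum.inr p)) := by
  obtain ⟨⟨i, j⟩, hij, hne⟩ := p
  simp only [shapeDir, unvech, Matrix.of_apply]
  rw [dif_neg hne]
  exact congrArg (fun p => τ (Sum.inr (Sum.inr p)))
    (Subtype.ext (Prod.ext (min_eq_left hij) (max_eq_right hij)))

lemma location_add_smul (ϑ τ : Param k) (ε : ℝ) :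
    location (ϑ + ε • τ) = location ϑ + ε • location τ := by
  ext i; simp [location]

lemma scaleSq_add_smul (ϑ τ : Param k) (ε : ℝ) :
    scaleSq (ϑ + ε • τ) = scaleSq ϑ + ε * scaleSq τ := by
  simp [scaleSq]

/-- The symmetric matrix `(s / σ²) I + V^{-1/2} v V^{-1/2}` describing the infinitesimal change of
scatter in the direction `τ = (t, s, v)`, after standardization. -/
def scatterDir (ϑ τ : Param k) : Matrix (Fin k) (Fin k) ℝ :=
  (scaleSq τ / scaleSq ϑ) • 1 + invSqrt (shape ϑ) * shapeDir τ * invSqrt (shape ϑ)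

/-- The vector `σ⁻¹ V^{-1/2} t` describing the infinitesimal shift in the direction
`τ = (t, s, v)`, after standardization. -/
def shiftDir (ϑ τ : Param k) : EuclideanSpace ℝ (Fin k) :=
  WithLp.toLp 2 ((scale ϑ)⁻¹ • (invSqrt (shape ϑ) *ᵥ (location τ).ofLp))

/-- The standardized observation `σ⁻¹ V^{-1/2} (x - θ)`. -/
def standardize (ϑ : Param k) (x : EuclideanSpace ℝ (Fin k)) : EuclideanSpace ℝ (Fin k) :=
  (scale ϑ)⁻¹ • sphericized ϑ x

/-- The score at a standardized observation in the direction given by a scatter matrix `W` and a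
shift `b`. -/
def standardScore (f : ℝ → ℝ) (W : Matrix (Fin k) (Fin k) ℝ) (b y : EuclideanSpace ℝ (Fin k)) :
    ℝ :=
  locScore f ‖y‖ * (inner ℝ b y / ‖y‖)
    + 1 / 2 * (shapeScore f ‖y‖ * ‖y‖ * (y.ofLp ⬝ᵥ (W *ᵥ y.ofLp) / ‖y‖ ^ 2) - W.trace)

lemma scale_pos {ϑ : Param k} (hϑ : ϑ ∈ paramSpace k) : 0 < scale ϑ := Real.sqrt_pos.2 hϑ.1

lemma scale_sq {ϑ : Param k} (hϑ : ϑ ∈ paramSpace k) : scale ϑ ^ 2 = scaleSq ϑ :=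
  Real.sq_sqrt hϑ.1.le

lemma norm_standardize {ϑ : Param k} (hϑ : ϑ ∈ paramSpace k) (x : EuclideanSpace ℝ (Fin k)) :
    ‖standardize ϑ x‖ = modulus ϑ x / scale ϑ := by
  rw [standardize, norm_smul, Real.norm_eq_abs, abs_of_pos (inv_pos.2 (scale_pos hϑ)), modulus,
    mul_comm, div_eq_mul_inv]

lemma msign_eq {ϑ : Param k} (hϑ : ϑ ∈ paramSpace k) (x : EuclideanSpace ℝ (Fin k)) :
    msign ϑ x = ‖standardize ϑ x‖⁻¹ • (standardize ϑ x).ofLp := by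
  have h := scale_pos hϑ
  rw [msign, norm_standardize hϑ, standardize, WithLp.ofLp_smul, WithLp.ofLp_smul, smul_smul,
    inv_div]
  congr 1
  field_simp

lemma inner_eq_dotProduct {ι : Type*} [Fintype ι] (x y : EuclideanSpace ℝ ι) :
    inner ℝ x y = x.ofLp ⬝ᵥ y.ofLp := by
  rw [EuclideanSpace.inner_eq_star_dotProduct, star_trivial, dotProduct_comm]

lemma dotProduct_central1 (f : ℝ → ℝ) (n : ℕ) {ϑ : Param k} (hϑ : ϑ ∈ paramSpace k) (τ : Param k)
    (X : Fin n → EuclideanSpace ℝ (Fin k)) :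
    (location τ).ofLp ⬝ᵥ central1 f n ϑ X = (√n)⁻¹ * ∑ i, locScore f ‖standardize ϑ (X i)‖
      * (inner ℝ (shiftDir ϑ τ) (standardize ϑ (X i)) / ‖standardize ϑ (X i)‖) := by
  rw [central1, dotProduct_smul, smul_eq_mul, dotProduct_sum, mul_assoc, Finset.mul_sum]
  congr 1
  refine Finset.sum_congr rfl fun i _ => ?_
  rw [← norm_standardize hϑ, inner_eq_dotProduct, shiftDir, msign_eq hϑ, dotProduct_smul,
    Matrix.mulVec_smul, dotProduct_smul, smul_dotProduct, Matrix.dotProduct_mulVec,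
    ← Matrix.mulVec_transpose, posDef_isSymm (posDef_invSqrt hϑ.2)]
  simp only [smul_eq_mul]
  ring

/-- The trace pairing of `W` with the centred outer product in the central sequence. -/
lemma trace_mul_scatter (f : ℝ → ℝ) {ϑ : Param k} (hϑ : ϑ ∈ paramSpace k)
    (W : Matrix (Fin k) (Fin k) ℝ) (x : EuclideanSpace ℝ (Fin k)) :
    (W * ((shapeScore f (modulus ϑ x / scale ϑ) * (modulus ϑ x / scale ϑ)) •
      Matrix.vecMulVec (msign ϑ x) (msign ϑ x) - 1)).trace
      = shapeScore f ‖standardize ϑ x‖ * ‖standardize ϑ x‖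
        * ((standardize ϑ x).ofLp ⬝ᵥ (W *ᵥ (standardize ϑ x).ofLp) / ‖standardize ϑ x‖ ^ 2)
        - W.trace := by
  rw [← norm_standardize hϑ, mul_sub, mul_one, Matrix.trace_sub, mul_smul_comm, Matrix.trace_smul,
    Matrix.mul_vecMulVec, Matrix.trace_vecMulVec, msign_eq hϑ, dotProduct_comm, Matrix.mulVec_smul,
    smul_dotProduct, dotProduct_smul]
  simp only [smul_eq_mul]
  congr 1
  rw [sq, div_eq_mul_inv, mul_inv]
  ring

lemma vec_dotProduct_scatterSum (f : ℝ → ℝ) (n : ℕ) {ϑ : Param k} (hϑ : ϑ ∈ paramSpace k)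
    {W : Matrix (Fin k) (Fin k) ℝ} (hW : Wᵀ = W) (X : Fin n → EuclideanSpace ℝ (Fin k)) :
    W.vec ⬝ᵥ scatterSum f n ϑ X = ∑ i, (shapeScore f ‖standardize ϑ (X i)‖
      * ‖standardize ϑ (X i)‖ * ((standardize ϑ (X i)).ofLp ⬝ᵥ (W *ᵥ (standardize ϑ (X i)).ofLp)
        / ‖standardize ϑ (X i)‖ ^ 2) - W.trace) := by
  rw [scatterSum, dotProduct_sum]
  refine Finset.sum_congr rfl fun i _ => ?_
  rw [Matrix.vec_dotProduct_vec, hW, trace_mul_scatter f hϑ]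

lemma conj_shapeDir_transpose {ϑ : Param k} (hϑ : ϑ ∈ paramSpace k) (τ : Param k) :
    (invSqrt (shape ϑ) * shapeDir τ * invSqrt (shape ϑ))ᵀ
      = invSqrt (shape ϑ) * shapeDir τ * invSqrt (shape ϑ) := by
  rw [Matrix.transpose_mul, Matrix.transpose_mul, posDef_isSymm (posDef_invSqrt hϑ.2),
    shapeDir_transpose, mul_assoc]

lemma scatterDir_transpose {ϑ : Param k} (hϑ : ϑ ∈ paramSpace k) (τ : Param k) :
    (scatterDir ϑ τ)ᵀ = scatterDir ϑ τ := by
  rw [scatterDir, Matrix.transpose_add, conj_shapeDir_transpose hϑ, Matrix.transpose_smul,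
    Matrix.transpose_one]

/-- The shape component of a direction, multiplied by `M_k (V ⊗ V)^{-1/2}`. -/
lemma vecMul_dupMat_invSqrt {ϑ : Param k} (hϑ : ϑ ∈ paramSpace k) (τ : Param k) :
    (fun p : VechIdx k => τ (Sum.inr (Sum.inr p))) ᵥ* (dupMat k * invSqrt (shape ϑ ⊗ₖ shape ϑ))
      = (invSqrt (shape ϑ) * shapeDir τ * invSqrt (shape ϑ)).vec := by
  have hs := posDef_isSymm (posDef_invSqrt hϑ.2)
  rw [← Matrix.vecMul_vecMul, ← Matrix.mulVec_transpose, ← Matrix.mulVec_transpose (dupMat k),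
    dupMat_transpose_mulVec, invSqrt_kronecker hϑ.2 hϑ.2, ← Matrix.kroneckerMap_transpose, hs,
    Matrix.kronecker_mulVec_vec, hs]
  rfl

theorem inner_centralSeq (f : ℝ → ℝ) (n : ℕ) {ϑ : Param k} (hϑ : ϑ ∈ paramSpace k) (τ : Param k)
    (X : Fin n → EuclideanSpace ℝ (Fin k)) :
    inner ℝ τ (centralSeq f n ϑ X) = (√n)⁻¹ * ∑ i, standardScore f (scatterDir ϑ τ) (shiftDir ϑ τ)
      (standardize ϑ (X i)) := by
  have hsplit : inner ℝ τ (centralSeq f n ϑ X) = (location τ).ofLp ⬝ᵥ central1 f n ϑ X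
      + (scaleSq τ * central2 f n ϑ X
        + (fun p : VechIdx k => τ (Sum.inr (Sum.inr p))) ⬝ᵥ central3 f n ϑ X) := by
    rw [inner_eq_dotProduct]
    simp only [dotProduct, Fintype.sum_sum_type, centralSeq, Sum.elim_inl, Sum.elim_inr, location,
      scaleSq, Finset.univ_unique, Finset.sum_singleton]
  have h2 : scaleSq τ * central2 f n ϑ X
      + (fun p : VechIdx k => τ (Sum.inr (Sum.inr p))) ⬝ᵥ central3 f n ϑ X
      = (√n)⁻¹ * (1 / 2 * ((scatterDir ϑ τ).vec ⬝ᵥ scatterSum f n ϑ X)) := by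
    rw [central2, central3, dotProduct_smul, Matrix.dotProduct_mulVec, vecMul_dupMat_invSqrt hϑ,
      scatterDir, Matrix.vec_add, add_dotProduct, Matrix.vec_smul, smul_dotProduct]
    simp only [smul_eq_mul]
    ring
  rw [hsplit, h2, dotProduct_central1 f n hϑ, vec_dotProduct_scatterSum f n hϑ
    (scatterDir_transpose hϑ τ), ← mul_add, Finset.mul_sum, ← Finset.sum_add_distrib]
  rfl

/-- The information quadratic form of a spherical law in the direction given by a scatter matrix
`W` and a shift `b`, where `I` and `J` are the radial informations. -/
def infoForm (I J : ℝ) (W : Matrix (Fin k) (Fin k) ℝ) (b : EuclideanSpace ℝ (Fin k)) : ℝ :=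
  I / k * ‖b‖ ^ 2
    + 1 / 4 * (J / (k * (k + 2)) * (2 * (W * W).trace + W.trace ^ 2) - W.trace ^ 2)

lemma vec_dotProduct_self {W : Matrix (Fin k) (Fin k) ℝ} (hW : Wᵀ = W) :
    W.vec ⬝ᵥ W.vec = (W * W).trace := by
  rw [Matrix.vec_dotProduct_vec, hW]

lemma norm_shiftDir_sq {ϑ : Param k} (hϑ : ϑ ∈ paramSpace k) (τ : Param k) :
    ‖shiftDir ϑ τ‖ ^ 2
      = (scaleSq ϑ)⁻¹ * ((location τ).ofLp ⬝ᵥ ((shape ϑ)⁻¹ *ᵥ (location τ).ofLp)) := by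
  rw [← real_inner_self_eq_norm_sq, inner_eq_dotProduct, shiftDir, smul_dotProduct,
    dotProduct_smul, ← invSqrt_mul_self hϑ.2, ← scale_sq hϑ, ← Matrix.mulVec_mulVec,
    Matrix.dotProduct_mulVec _ (invSqrt (shape ϑ)), ← Matrix.mulVec_transpose,
    posDef_isSymm (posDef_invSqrt hϑ.2), sq]
  rw [dotProduct_comm (invSqrt (shape ϑ) *ᵥ invSqrt (shape ϑ) *ᵥ _)]
  simp only [smul_eq_mul, mul_inv]
  ring

theorem dotProduct_infoMat (f : ℝ → ℝ) {ϑ : Param k} (hϑ : ϑ ∈ paramSpace k) (τ : Param k) :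
    τ.ofLp ⬝ᵥ (infoMat f ϑ *ᵥ τ.ofLp)
      = infoForm (locInfo k f) (shapeInfo k f) (scatterDir ϑ τ) (shiftDir ϑ τ) := by
  have hk : (0 : ℝ) < k := Nat.cast_pos.2 (Nat.pos_of_ne_zero (NeZero.ne k))
  have hσ : 0 < scaleSq ϑ := hϑ.1
  set w : VechIdx k → ℝ := fun p => τ (Sum.inr (Sum.inr p)) with hw
  set t : Fin k → ℝ := (location τ).ofLp with ht
  set s : Unit → ℝ := fun _ => scaleSq τ with hs
  set Vh := invSqrt (shape ϑ) with hVh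
  set m := Vh * shapeDir τ * Vh with hm
  set J := shapeInfo k f with hJ
  have hmt : mᵀ = m := conj_shapeDir_transpose hϑ τ
  have hτ : τ.ofLp = Sum.elim t (Sum.elim s w) := by
    funext i
    rcases i with i | i | i <;> rfl
  have hsplit : τ.ofLp ⬝ᵥ (infoMat f ϑ *ᵥ τ.ofLp) = t ⬝ᵥ (info11 f ϑ *ᵥ t)
      + (s ⬝ᵥ (info22 f ϑ *ᵥ s) + 2 * (w ⬝ᵥ (info32 f ϑ *ᵥ s)) + w ⬝ᵥ (info33 f ϑ *ᵥ w)) := by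
    rw [hτ, infoMat, Matrix.fromBlocks_mulVec, sumElim_dotProduct_sumElim]
    simp only [Sum.elim_comp_inl, Sum.elim_comp_inr, Matrix.zero_mulVec, add_zero, zero_add]
    rw [Matrix.fromBlocks_mulVec, sumElim_dotProduct_sumElim]
    simp only [Sum.elim_comp_inl, Sum.elim_comp_inr, dotProduct_add]
    have : s ⬝ᵥ ((info32 f ϑ)ᵀ *ᵥ w) = w ⬝ᵥ (info32 f ϑ *ᵥ s) := by
      rw [Matrix.mulVec_transpose, Matrix.dotProduct_mulVec, dotProduct_comm]
    rw [this]
    ring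
  have h11 : t ⬝ᵥ (info11 f ϑ *ᵥ t) = locInfo k f / k * ‖shiftDir ϑ τ‖ ^ 2 := by
    rw [info11, Matrix.smul_mulVec, dotProduct_smul, norm_shiftDir_sq hϑ, smul_eq_mul, ← ht]
    field_simp
  have h22 : s ⬝ᵥ (info22 f ϑ *ᵥ s) = 1 / (4 * scaleSq ϑ ^ 2) * (J - k ^ 2) * scaleSq τ ^ 2 := by
    simp only [info22, Matrix.mulVec, dotProduct, Finset.univ_unique, Finset.sum_singleton,
      Matrix.of_apply, hs]
    ring
  have htrm : m.trace = (shapeDir τ).vec ⬝ᵥ ((shape ϑ)⁻¹).vec := by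
    rw [Matrix.vec_dotProduct_vec, shapeDir_transpose, ← invSqrt_mul_self hϑ.2, hm, mul_assoc,
      Matrix.trace_mul_comm, mul_assoc]
  have h32 : w ⬝ᵥ (info32 f ϑ *ᵥ s)
      = 1 / (4 * k * scaleSq ϑ) * (J - k ^ 2) * m.trace * scaleSq τ := by
    have e : info32 f ϑ *ᵥ s = (1 / (4 * k * scaleSq ϑ) * (J - k ^ 2) * scaleSq τ) •
        (dupMat k *ᵥ ((shape ϑ)⁻¹).vec) := by
      funext p
      simp only [info32, Matrix.mulVec, dotProduct, Finset.univ_unique, Finset.sum_singleton,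
        Matrix.of_apply, hs, Pi.smul_apply, smul_eq_mul]
      ring
    rw [e, dotProduct_smul, Matrix.dotProduct_mulVec, ← Matrix.mulVec_transpose,
      dupMat_transpose_mulVec, htrm, smul_eq_mul]
    simp only [shapeDir]
    ring
  have h33 : w ⬝ᵥ (info33 f ϑ *ᵥ w)
      = 1 / 4 * (J / (k * (k + 2)) * (2 * (m * m).trace + m.trace ^ 2) - m.trace ^ 2) := by
    have hP := posDef_isSymm (posDef_invSqrt (hϑ.2.kronecker hϑ.2))
    have hv := vecMul_dupMat_invSqrt hϑ τ
    rw [← hw, ← hVh, ← hm] at hv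
    rw [info33, Matrix.smul_mulVec, dotProduct_smul, Matrix.mul_assoc _ _ (dupMat k)ᵀ,
      ← Matrix.mulVec_mulVec, ← Matrix.mulVec_mulVec, Matrix.dotProduct_mulVec w, hv]
    have h1 : (invSqrt (shape ϑ ⊗ₖ shape ϑ) * (dupMat k)ᵀ) *ᵥ w = m.vec := by
      rw [← hv, ← Matrix.mulVec_transpose, Matrix.transpose_mul, hP]
    rw [h1, Matrix.sub_mulVec, Matrix.smul_mulVec, Matrix.add_mulVec, Matrix.add_mulVec,
      Matrix.one_mulVec, commMat_mulVec_vec, jMat_mulVec_vec, hmt]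
    simp only [dotProduct_sub, dotProduct_smul, dotProduct_add, smul_eq_mul]
    rw [vec_dotProduct_self hmt, Matrix.vec_dotProduct_vec, hmt, mul_one]
    ring
  have hW : scatterDir ϑ τ = (scaleSq τ / scaleSq ϑ) • 1 + m := rfl
  have hWtr : (scatterDir ϑ τ).trace = k * (scaleSq τ / scaleSq ϑ) + m.trace := by
    rw [hW, Matrix.trace_add, Matrix.trace_smul, Matrix.trace_one, Fintype.card_fin, smul_eq_mul]
    ring
  have hWW : (scatterDir ϑ τ * scatterDir ϑ τ).trace = k * (scaleSq τ / scaleSq ϑ) ^ 2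
      + 2 * (scaleSq τ / scaleSq ϑ) * m.trace + (m * m).trace := by
    rw [hW, add_mul, mul_add, mul_add, smul_mul_smul_comm, one_mul, smul_mul_assoc, one_mul,
      mul_smul_comm, mul_one, Matrix.trace_add, Matrix.trace_add, Matrix.trace_add,
      Matrix.trace_smul, Matrix.trace_smul, Matrix.trace_one, Fintype.card_fin]
    simp only [smul_eq_mul]
    ring
  rw [hsplit, h11, h22, h32, h33, infoForm, hWtr, hWW]
  field_simp
  ring

end Directions

/-! ### Radial densities and their square roots -/

section RadialRoot

variable {k : ℕ} [NeZero k] {f η T : ℝ → ℝ}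

/-- `η` is a regular version of the square root of the radial density `f`, and `T` is its
derivative; both scores of `f` agree with `-2 T / η`. -/
structure IsRadialRoot (k : ℕ) (f η T : ℝ → ℝ) : Prop where
  regular : IsRegularRoot k η T
  pos : ∀ᵐ r ∂(volume.restrict (Ioi (0 : ℝ))), 0 < η r
  density_eq : ∀ᵐ r ∂(volume.restrict (Ioi (0 : ℝ))), f r = η r ^ 2
  locScore_eq : ∀ᵐ r ∂(volume.restrict (Ioi (0 : ℝ))), locScore f r = -2 * T r / η r
  shapeScore_eq : ∀ᵐ r ∂(volume.restrict (Ioi (0 : ℝ))), shapeScore f r = -2 * T r / η r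

lemma exists_isRadialRoot (hf : IsStandardizedRadialDensity k f) (hA1 : AssumptionA1 k f)
    (hA2 : AssumptionA2 k f) : ∃ η T, IsRadialRoot k f η T := by
  obtain ⟨η, T, hR, hη, hl, hs⟩ := exists_isRegularRoot hA1 hA2
  refine ⟨η, T, hR, ?_, ?_, hl, hs⟩
  · filter_upwards [hη, hf.ae_pos] with r h1 h2
    rw [← h1]; exact Real.sqrt_pos.2 h2
  · filter_upwards [hη, hf.ae_pos] with r h1 h2
    rw [← h1, Real.sq_sqrt h2.le]

lemma finrank_euclidean : Module.finrank ℝ (EuclideanSpace ℝ (Fin k)) = k := by simp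

instance : Nontrivial (EuclideanSpace ℝ (Fin k)) := nontrivial_of_finrank_eq finrank_euclidean

lemma ballVolume_pos : 0 < (k : ℝ) * (volume : Measure (EuclideanSpace ℝ (Fin k))).real
    (Metric.ball 0 1) :=
  mul_pos (Nat.cast_pos.2 (Nat.pos_of_ne_zero (NeZero.ne k)))
    (ENNReal.toReal_pos (Metric.measure_ball_pos _ _ one_pos).ne' measure_ball_lt_top.ne)

lemma integral_comp_norm_eq (g : ℝ → ℝ) : ∫ y : EuclideanSpace ℝ (Fin k), g ‖y‖
    = k * (volume : Measure (EuclideanSpace ℝ (Fin k))).real (Metric.ball 0 1)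
      * ∫ r in Ioi (0 : ℝ), r ^ (k - 1) * g r := by
  rw [integral_fun_norm_addHaar, finrank_euclidean, nsmul_eq_mul, smul_eq_mul, mul_assoc]
  rfl

lemma IsRadialRoot.integral_root_sq (h : IsRadialRoot k f η T) :
    ∫ y : EuclideanSpace ℝ (Fin k), η ‖y‖ ^ 2
    = k * (volume : Measure (EuclideanSpace ℝ (Fin k))).real (Metric.ball 0 1)
      * radialMass k f := by
  rw [integral_comp_norm_eq (fun r => η r ^ 2), radialMass]
  congr 1
  refine integral_congr_ae ?_
  filter_upwards [h.density_eq] with r hr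
  rw [hr]

lemma IsRadialRoot.locInfo_eq (h : IsRadialRoot k f η T) :
    locInfo k f = rootLocInfo (EuclideanSpace ℝ (Fin k)) η T := by
  have hb := ballVolume_pos (k := k)
  rw [rootLocInfo, h.integral_root_sq, integral_comp_norm_eq (fun r => (2 * T r) ^ 2), locInfo,
    mul_inv, mul_mul_mul_comm, inv_mul_cancel₀ hb.ne', one_mul, ← integral_const_mul]
  refine integral_congr_ae ?_
  filter_upwards [h.pos, h.density_eq, h.locScore_eq] with r h1 h2 h3
  rw [h3, modulusDensity, h2]
  field_simp

lemma IsRadialRoot.shapeInfo_eq (h : IsRadialRoot k f η T) :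
    shapeInfo k f = rootShapeInfo (EuclideanSpace ℝ (Fin k)) η T := by
  have hb := ballVolume_pos (k := k)
  rw [rootShapeInfo, h.integral_root_sq, integral_comp_norm_eq (fun r => (2 * (r * T r)) ^ 2),
    shapeInfo, mul_inv, mul_mul_mul_comm, inv_mul_cancel₀ hb.ne', one_mul, ← integral_const_mul]
  refine integral_congr_ae ?_
  filter_upwards [h.pos, h.density_eq, h.shapeScore_eq] with r h1 h2 h3
  rw [h3, modulusDensity, h2]
  field_simp

/-! ### Matrices as operators of Euclidean space -/

lemma toEuclideanCLM_coe (W : Matrix (Fin k) (Fin k) ℝ) :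
    ((Matrix.toEuclideanCLM (𝕜 := ℝ) W : EuclideanSpace ℝ (Fin k) →L[ℝ] EuclideanSpace ℝ (Fin k))
      : EuclideanSpace ℝ (Fin k) →ₗ[ℝ] EuclideanSpace ℝ (Fin k))
    = Matrix.toLin (PiLp.basisFun 2 ℝ (Fin k)) (PiLp.basisFun 2 ℝ (Fin k)) W := by
  rw [Matrix.coe_toEuclideanCLM_eq_toEuclideanLin]
  exact DFunLike.congr_fun (Matrix.toLpLin_eq_toLin 2 2) W

lemma toEuclideanCLM_trace (W : Matrix (Fin k) (Fin k) ℝ) :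
    LinearMap.trace ℝ (EuclideanSpace ℝ (Fin k)) (Matrix.toEuclideanCLM (𝕜 := ℝ) W) = W.trace := by
  rw [toEuclideanCLM_coe, Matrix.trace_toLin_eq]

lemma toEuclideanCLM_det (W : Matrix (Fin k) (Fin k) ℝ) :
    (Matrix.toEuclideanCLM (𝕜 := ℝ) W).det = W.det := by
  rw [ContinuousLinearMap.det, toEuclideanCLM_coe, LinearMap.det_toLin]

lemma toEuclideanCLM_isSymmetric {W : Matrix (Fin k) (Fin k) ℝ} (hW : Wᵀ = W) :
    ((Matrix.toEuclideanCLM (𝕜 := ℝ) W : EuclideanSpace ℝ (Fin k) →L[ℝ] EuclideanSpace ℝ (Fin k))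
      : EuclideanSpace ℝ (Fin k) →ₗ[ℝ] EuclideanSpace ℝ (Fin k)).IsSymmetric := by
  rw [Matrix.coe_toEuclideanCLM_eq_toEuclideanLin, Matrix.isSymmetric_toEuclideanLin_iff]
  rw [Matrix.IsHermitian, Matrix.conjTranspose_eq_transpose_of_trivial, hW]

lemma toEuclideanCLM_ofLp (W : Matrix (Fin k) (Fin k) ℝ) (y : EuclideanSpace ℝ (Fin k)) :
    (Matrix.toEuclideanCLM (𝕜 := ℝ) W y).ofLp = W *ᵥ y.ofLp := rfl

lemma continuous_toEuclideanCLM : Continuous fun W : Matrix (Fin k) (Fin k) ℝ =>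
    Matrix.toEuclideanCLM (𝕜 := ℝ) W :=
  LinearMap.continuous_of_finiteDimensional
    (Matrix.toEuclideanCLM (n := Fin k) (𝕜 := ℝ)).toAlgEquiv.toLinearMap

/-- The infinitesimal deformation of the observations which compensates an infinitesimal change of
scatter `W`. -/
def scatterDeform (W : Matrix (Fin k) (Fin k) ℝ) :
    EuclideanSpace ℝ (Fin k) →L[ℝ] EuclideanSpace ℝ (Fin k) :=
  Matrix.toEuclideanCLM (𝕜 := ℝ) (-(1 / 2 : ℝ) • W)

lemma scatterDeform_isSymmetric {W : Matrix (Fin k) (Fin k) ℝ} (hW : Wᵀ = W) :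
    ((scatterDeform W : EuclideanSpace ℝ (Fin k) →L[ℝ] EuclideanSpace ℝ (Fin k))
      : EuclideanSpace ℝ (Fin k) →ₗ[ℝ] EuclideanSpace ℝ (Fin k)).IsSymmetric :=
  toEuclideanCLM_isSymmetric (by rw [Matrix.transpose_smul, hW])

lemma scatterDeform_sub (W W' : Matrix (Fin k) (Fin k) ℝ) :
    scatterDeform W - scatterDeform W' = scatterDeform (W - W') := by
  rw [scatterDeform, scatterDeform, scatterDeform, ← map_sub, smul_sub]

lemma scatterDeform_trace (W : Matrix (Fin k) (Fin k) ℝ) :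
    LinearMap.trace ℝ (EuclideanSpace ℝ (Fin k)) (scatterDeform W) = -(1 / 2) * W.trace := by
  rw [scatterDeform, toEuclideanCLM_trace, Matrix.trace_smul, smul_eq_mul]

lemma scoreInfo_scatterDeform (W : Matrix (Fin k) (Fin k) ℝ) (b : EuclideanSpace ℝ (Fin k)) :
    scoreInfo (EuclideanSpace ℝ (Fin k)) k η T (scatterDeform W) b
      = infoForm (rootLocInfo (EuclideanSpace ℝ (Fin k)) η T)
        (rootShapeInfo (EuclideanSpace ℝ (Fin k)) η T) W b := by
  have h2 : LinearMap.trace ℝ (EuclideanSpace ℝ (Fin k))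
      ((scatterDeform W : EuclideanSpace ℝ (Fin k) →ₗ[ℝ] EuclideanSpace ℝ (Fin k))
        * (scatterDeform W : EuclideanSpace ℝ (Fin k) →ₗ[ℝ] EuclideanSpace ℝ (Fin k)))
      = 1 / 4 * (W * W).trace := by
    have : ((scatterDeform W : EuclideanSpace ℝ (Fin k) →ₗ[ℝ] EuclideanSpace ℝ (Fin k))
        * (scatterDeform W : EuclideanSpace ℝ (Fin k) →ₗ[ℝ] EuclideanSpace ℝ (Fin k)))
        = (Matrix.toEuclideanCLM (𝕜 := ℝ) ((-(1 / 2 : ℝ) • W) * (-(1 / 2 : ℝ) • W)) :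
          EuclideanSpace ℝ (Fin k) →L[ℝ] EuclideanSpace ℝ (Fin k)) := by
      rw [map_mul]
      rfl
    rw [this, toEuclideanCLM_trace, smul_mul_smul_comm, Matrix.trace_smul, smul_eq_mul]
    norm_num
  rw [scoreInfo, h2, scatterDeform_trace, infoForm]
  ring

/-- The score which occurs in the central sequence is the derivative of the log-density along the
affine deformation compensating the change of parameter. -/
lemma IsRadialRoot.standardScore_eq (h : IsRadialRoot k f η T) (W : Matrix (Fin k) (Fin k) ℝ)
    (b : EuclideanSpace ℝ (Fin k)) :
    standardScore f W b =ᵐ[volume] rootScore η T (scatterDeform W) b := by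
  filter_upwards [ae_comp_norm (E := EuclideanSpace ℝ (Fin k)) h.pos,
    ae_comp_norm (E := EuclideanSpace ℝ (Fin k)) h.locScore_eq,
    ae_comp_norm (E := EuclideanSpace ℝ (Fin k)) h.shapeScore_eq] with y h1 h2 h3
  rw [standardScore, rootScore, deformDeriv_eq, scatterDeform_trace, h2, h3,
    inner_eq_dotProduct y, scatterDeform, toEuclideanCLM_ofLp, Matrix.smul_mulVec,
    dotProduct_smul, smul_eq_mul]
  ring

/-! ### Positive definiteness of the information matrix -/

/-- Apart from `J > k ^ 2` this rests on `(tr W) ^ 2 ≤ k tr (W ^ 2)`. -/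
lemma infoForm_pos {I J : ℝ} (hI : 0 < I) (hJ : (k : ℝ) ^ 2 < J) {W : Matrix (Fin k) (Fin k) ℝ}
    (hW : Wᵀ = W) {b : EuclideanSpace ℝ (Fin k)} (h : W ≠ 0 ∨ b ≠ 0) : 0 < infoForm I J W b := by
  have hk : (0 : ℝ) < k := Nat.cast_pos.2 (Nat.pos_of_ne_zero (NeZero.ne k))
  have hWW : (W * W).trace = ∑ i, ∑ j, W i j ^ 2 := by
    nth_rewrite 1 [← hW]
    simp only [Matrix.trace, Matrix.diag, Matrix.mul_apply, Matrix.transpose_apply]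
    rw [Finset.sum_comm]
    simp only [sq]
  have hWW0 : 0 ≤ (W * W).trace := by rw [hWW]; positivity
  have htr : W.trace ^ 2 ≤ k * (W * W).trace := by
    have h1 := sq_sum_le_card_mul_sum_sq (s := Finset.univ) (f := fun i => W i i)
    rw [Finset.card_univ, Fintype.card_fin] at h1
    refine h1.trans (mul_le_mul_of_nonneg_left ?_ hk.le)
    rw [hWW]
    exact Finset.sum_le_sum fun i _ =>
      Finset.single_le_sum (f := fun j => W i j ^ 2) (fun j _ => sq_nonneg _) (Finset.mem_univ i)
  have hcomb : infoForm I J W b = I / k * ‖b‖ ^ 2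
      + 1 / 4 * ((J - k ^ 2) / (k * (k + 2)) * (2 * (W * W).trace + W.trace ^ 2)
        + 2 / (k + 2) * (k * (W * W).trace - W.trace ^ 2)) := by
    rw [infoForm]
    field_simp
    ring
  rw [hcomb]
  have hJ' : 0 < J - k ^ 2 := by linarith
  have t2 : 0 ≤ 2 / ((k : ℝ) + 2) * (k * (W * W).trace - W.trace ^ 2) :=
    mul_nonneg (by positivity) (by linarith)
  rcases h with h | h
  · have hWpos : 0 < (W * W).trace := by
      refine hWW0.lt_of_ne fun h0 => h ?_
      rw [hWW, eq_comm, Finset.sum_eq_zero_iff_of_nonneg fun i _ => by positivity] at h0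
      ext i j
      have h1 := h0 i (Finset.mem_univ i)
      rw [Finset.sum_eq_zero_iff_of_nonneg fun j _ => by positivity] at h1
      simpa using h1 j (Finset.mem_univ j)
    have t1 : 0 < (J - k ^ 2) / (k * (k + 2)) * (2 * (W * W).trace + W.trace ^ 2) := by positivity
    have t0 : 0 ≤ I / k * ‖b‖ ^ 2 := by positivity
    linarith
  · have hb : 0 < ‖b‖ := norm_pos_iff.2 h
    have t0 : 0 < I / k * ‖b‖ ^ 2 := by positivity
    have t1 : 0 ≤ (J - k ^ 2) / (k * (k + 2)) * (2 * (W * W).trace + W.trace ^ 2) := by positivity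
    linarith

/-- A nonzero direction changes the law: scale and shape are identifiable thanks to the
normalization of the corner entry of the shape. -/
lemma dir_ne_zero {ϑ : Param k} (hϑ : ϑ ∈ paramSpace k) {τ : Param k} (hτ : τ ≠ 0) :
    scatterDir ϑ τ ≠ 0 ∨ shiftDir ϑ τ ≠ 0 := by
  by_contra! h
  obtain ⟨h1, h2⟩ := h
  have hinv : IsUnit (invSqrt (shape ϑ)).det := (posDef_invSqrt hϑ.2).det_pos.ne'.isUnit
  have hcancel : matSqrt (shape ϑ) * invSqrt (shape ϑ) = 1 :=
    Matrix.mul_nonsing_inv _ (posDef_sqrt hϑ.2).det_pos.ne'.isUnit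
  have hcancel' : invSqrt (shape ϑ) * matSqrt (shape ϑ) = 1 := invSqrt_mul_sqrt hϑ.2
  -- The vanishing of the scatter component, multiplied by `V^{1/2}` on both sides.
  have h3 : (scaleSq τ / scaleSq ϑ) • shape ϑ + shapeDir τ = 0 := by
    have h4 : matSqrt (shape ϑ) * scatterDir ϑ τ * matSqrt (shape ϑ) = 0 := by
      rw [h1, mul_zero, zero_mul]
    rw [scatterDir, mul_add, add_mul, mul_smul_comm, mul_one, smul_mul_assoc,
      sqrt_mul_self hϑ.2.posSemidef] at h4
    rw [← h4]
    congr 1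
    calc shapeDir τ = (matSqrt (shape ϑ) * invSqrt (shape ϑ)) * shapeDir τ
          * (invSqrt (shape ϑ) * matSqrt (shape ϑ)) := by rw [hcancel, hcancel', one_mul, mul_one]
      _ = _ := by simp only [mul_assoc]
  have h5 : scaleSq τ = 0 := by
    have := congrFun (congrFun h3 0) 0
    simp only [Matrix.add_apply, Matrix.smul_apply, shapeDir_zero_zero, Matrix.zero_apply,
      add_zero, smul_eq_mul, mul_eq_zero, div_eq_zero_iff, hϑ.1.ne', or_false] at this
    rcases this with h | h
    · exact h
    · exact absurd h (by simp [shape, unvech])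
  have h6 : shapeDir τ = 0 := by simpa [h5] using h3
  have h7 : (location τ).ofLp = 0 := by
    have h8 : (scale ϑ)⁻¹ • (invSqrt (shape ϑ) *ᵥ (location τ).ofLp) = 0 :=
      congrArg WithLp.ofLp h2
    rw [smul_eq_zero_iff_right (inv_ne_zero (scale_pos hϑ).ne')] at h8
    exact Matrix.eq_zero_of_mulVec_eq_zero hinv.ne_zero h8
  refine hτ ?_
  ext i
  rcases i with i | i | p
  · exact congrFun h7 i
  · exact h5
  · rw [← shapeDir_apply, h6]; rfl

lemma infoMat_isHermitian (f : ℝ → ℝ) {ϑ : Param k} (hϑ : ϑ ∈ paramSpace k) :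
    (infoMat f ϑ).IsHermitian := by
  have hK : (commMat k)ᵀ = commMat k := by
    simp only [commMat, Matrix.transpose_sum, ← Matrix.kroneckerMap_transpose,
      Matrix.transpose_single]
    rw [Finset.sum_comm]
  have hJ : (jMat k)ᵀ = jMat k := by
    simp only [jMat, Matrix.transpose_sum, ← Matrix.kroneckerMap_transpose,
      Matrix.transpose_single]
    rw [Finset.sum_comm]
  have hP := posDef_isSymm (posDef_invSqrt (hϑ.2.kronecker hϑ.2))
  have h1 : (info11 f ϑ)ᵀ = info11 f ϑ := by
    rw [info11, Matrix.transpose_smul, posDef_isSymm hϑ.2.inv]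
  have h2 : (info22 f ϑ)ᵀ = info22 f ϑ := rfl
  have h3 : (info33 f ϑ)ᵀ = info33 f ϑ := by
    rw [info33]
    simp only [Matrix.transpose_smul, Matrix.transpose_mul, Matrix.transpose_sub,
      Matrix.transpose_add, Matrix.transpose_one, Matrix.transpose_transpose, hK, hJ, hP,
      Matrix.mul_assoc]
  rw [Matrix.IsHermitian, Matrix.conjTranspose_eq_transpose_of_trivial, infoMat,
    Matrix.fromBlocks_transpose, Matrix.fromBlocks_transpose, Matrix.transpose_transpose,
    Matrix.transpose_zero, Matrix.transpose_zero, h1, h2, h3]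

theorem IsRadialRoot.posDef_infoMat (h : IsRadialRoot k f η T) {ϑ : Param k}
    (hϑ : ϑ ∈ paramSpace k) : (infoMat f ϑ).PosDef := by
  refine Matrix.PosDef.of_dotProduct_mulVec_pos (infoMat_isHermitian f hϑ) fun x hx => ?_
  have hI := h.regular.rootLocInfo_pos (E := EuclideanSpace ℝ (Fin k)) finrank_euclidean h.pos
  have hJ := h.regular.sq_dim_lt_rootShapeInfo (E := EuclideanSpace ℝ (Fin k)) finrank_euclidean
    h.pos
  rw [star_trivial]
  have := dotProduct_infoMat f hϑ (WithLp.toLp 2 x)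
  rw [this, h.locInfo_eq, h.shapeInfo_eq]
  refine infoForm_pos hI hJ (scatterDir_transpose hϑ _) (dir_ne_zero hϑ fun h0 => hx ?_)
  exact congrArg WithLp.ofLp h0

end RadialRoot

/-! ### Standardization and the law of one observation -/

section Standardization

variable {k : ℕ} [NeZero k] {f η T : ℝ → ℝ}

/-- The matrix `σ V^{1/2}`. -/
def rootScatter (ϑ : Param k) : Matrix (Fin k) (Fin k) ℝ := scale ϑ • matSqrt (shape ϑ)

lemma posDef_rootScatter {ϑ : Param k} (hϑ : ϑ ∈ paramSpace k) : (rootScatter ϑ).PosDef :=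
  (posDef_sqrt hϑ.2).smul (scale_pos hϑ)

lemma rootScatter_mul_self {ϑ : Param k} (hϑ : ϑ ∈ paramSpace k) :
    rootScatter ϑ * rootScatter ϑ = scaleSq ϑ • shape ϑ := by
  rw [rootScatter, smul_mul_smul_comm, sqrt_mul_self hϑ.2.posSemidef, ← sq, scale_sq hϑ]

lemma isUnit_det_rootScatter {ϑ : Param k} (hϑ : ϑ ∈ paramSpace k) :
    IsUnit (rootScatter ϑ).det := (posDef_rootScatter hϑ).det_pos.ne'.isUnit

lemma rootScatter_inv {ϑ : Param k} (hϑ : ϑ ∈ paramSpace k) :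
    (rootScatter ϑ)⁻¹ = (scale ϑ)⁻¹ • invSqrt (shape ϑ) := by
  refine Matrix.inv_eq_left_inv ?_
  rw [rootScatter, smul_mul_smul_comm, invSqrt_eq,
    Matrix.nonsing_inv_mul _ (posDef_sqrt hϑ.2).det_pos.ne'.isUnit,
    inv_mul_cancel₀ (scale_pos hϑ).ne', one_smul]

lemma det_rootScatter {ϑ : Param k} (hϑ : ϑ ∈ paramSpace k) :
    (rootScatter ϑ).det = scale ϑ ^ k * √(shape ϑ).det := by
  rw [rootScatter, Matrix.det_smul, Fintype.card_fin]
  congr 1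
  rw [eq_comm, Real.sqrt_eq_iff_mul_self_eq hϑ.2.det_pos.le (posDef_sqrt hϑ.2).det_pos.le,
    ← Matrix.det_mul, sqrt_mul_self hϑ.2.posSemidef]

lemma standardize_eq {ϑ : Param k} (hϑ : ϑ ∈ paramSpace k) (x : EuclideanSpace ℝ (Fin k)) :
    standardize ϑ x = Matrix.toEuclideanCLM (𝕜 := ℝ) (rootScatter ϑ)⁻¹ (x - location ϑ) := by
  refine WithLp.ofLp_injective 2 ?_
  rw [toEuclideanCLM_ofLp, rootScatter_inv hϑ, Matrix.smul_mulVec]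
  rfl

/-- The inverse of the standardization. -/
def unstandardize (ϑ : Param k) (y : EuclideanSpace ℝ (Fin k)) : EuclideanSpace ℝ (Fin k) :=
  Matrix.toEuclideanCLM (𝕜 := ℝ) (rootScatter ϑ) y + location ϑ

lemma toEuclideanCLM_mul_apply (A B : Matrix (Fin k) (Fin k) ℝ) (y : EuclideanSpace ℝ (Fin k)) :
    Matrix.toEuclideanCLM (𝕜 := ℝ) (A * B) y
      = Matrix.toEuclideanCLM (𝕜 := ℝ) A (Matrix.toEuclideanCLM (𝕜 := ℝ) B y) := by
  rw [map_mul]; rfl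

lemma standardize_unstandardize {ϑ : Param k} (hϑ : ϑ ∈ paramSpace k)
    (y : EuclideanSpace ℝ (Fin k)) : standardize ϑ (unstandardize ϑ y) = y := by
  rw [standardize_eq hϑ, unstandardize, add_sub_cancel_right, ← toEuclideanCLM_mul_apply,
    Matrix.nonsing_inv_mul _ (isUnit_det_rootScatter hϑ), map_one]
  rfl

lemma measurable_unstandardize (ϑ : Param k) : Measurable (unstandardize ϑ) :=
  ((Matrix.toEuclideanCLM (𝕜 := ℝ) (rootScatter ϑ)).continuous.measurable).add_const _

lemma measurable_standardize {ϑ : Param k} (hϑ : ϑ ∈ paramSpace k) :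
    Measurable (standardize ϑ) := by
  have : standardize ϑ = fun x => Matrix.toEuclideanCLM (𝕜 := ℝ) (rootScatter ϑ)⁻¹
      (x - location ϑ) := funext fun x => standardize_eq hϑ x
  rw [this]
  exact (Matrix.toEuclideanCLM (𝕜 := ℝ) (rootScatter ϑ)⁻¹).continuous.measurable.comp
    (measurable_id.sub_const _)

lemma map_unstandardize_volume {ϑ : Param k} (hϑ : ϑ ∈ paramSpace k) :
    Measure.map (unstandardize ϑ) volume
      = ENNReal.ofReal ((rootScatter ϑ).det)⁻¹ • volume := by
  have hd := (posDef_rootScatter hϑ).det_pos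
  have h1 : (1 + Matrix.toEuclideanCLM (𝕜 := ℝ) (rootScatter ϑ - 1)).det
      = (rootScatter ϑ).det := by
    rw [← map_one (Matrix.toEuclideanCLM (n := Fin k) (𝕜 := ℝ)), ← map_add, toEuclideanCLM_det,
      add_sub_cancel]
  have h2 := map_deform_volume (Matrix.toEuclideanCLM (𝕜 := ℝ) (rootScatter ϑ - 1))
    (-location ϑ) (by rw [h1]; exact hd.ne')
  rw [h1, abs_inv, abs_of_pos hd] at h2
  rw [← h2]
  congr 1
  funext y
  rw [unstandardize, map_sub, map_one]
  change _ = y + (Matrix.toEuclideanCLM (𝕜 := ℝ) (rootScatter ϑ) y - y - -location ϑ)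
  abel

/-- A property of almost every point holds for almost every standardized observation. -/
lemma ae_standardize {ϑ : Param k} (hϑ : ϑ ∈ paramSpace k) {p : EuclideanSpace ℝ (Fin k) → Prop}
    (hp : ∀ᵐ y, p y) : ∀ᵐ x, p (standardize ϑ x) := by
  have hd := (posDef_rootScatter hϑ).det_pos
  have hac : (volume : Measure (EuclideanSpace ℝ (Fin k)))
      ≪ Measure.map (unstandardize ϑ) volume := by
    rw [map_unstandardize_volume hϑ]
    refine Measure.absolutelyContinuous_smul ?_
    simpa using hd
  refine hac.ae_le ?_
  obtain ⟨N, hpN, hNm, hN0⟩ := exists_measurable_superset_of_null (ae_iff.1 hp)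
  have h1 : ∀ᵐ x ∂(Measure.map (unstandardize ϑ) volume), standardize ϑ x ∉ N := by
    rw [ae_map_iff (p := fun x => standardize ϑ x ∉ N) (measurable_unstandardize ϑ).aemeasurable
      ((measurable_standardize hϑ) hNm.compl)]
    simp only [standardize_unstandardize hϑ]
    exact measure_eq_zero_iff_ae_notMem.1 hN0
  filter_upwards [h1] with x hx
  by_contra h
  exact hx (hpN h)

lemma modulus_eq {ϑ : Param k} (hϑ : ϑ ∈ paramSpace k) (x : EuclideanSpace ℝ (Fin k)) :
    modulus ϑ x = √((x - location ϑ).ofLp ⬝ᵥ ((shape ϑ)⁻¹ *ᵥ (x - location ϑ).ofLp)) := by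
  rw [modulus, ← Real.sqrt_sq (norm_nonneg _), ← real_inner_self_eq_norm_sq, inner_eq_dotProduct,
    sphericized, ← invSqrt_mul_self hϑ.2, ← Matrix.mulVec_mulVec,
    Matrix.dotProduct_mulVec (x - location ϑ).ofLp, ← Matrix.mulVec_transpose,
    posDef_isSymm (posDef_invSqrt hϑ.2)]

lemma ellipticalDensity_eq (f : ℝ → ℝ) {ϑ : Param k} (hϑ : ϑ ∈ paramSpace k)
    (x : EuclideanSpace ℝ (Fin k)) :
    ellipticalDensity f ϑ x
      = normConst k f * ((rootScatter ϑ).det)⁻¹ * f ‖standardize ϑ x‖ := by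
  have hσ := scale_pos hϑ
  rw [ellipticalDensity, det_rootScatter hϑ, one_div (_ * _)]
  congr 2
  rw [norm_standardize hϑ, modulus_eq hϑ, one_div_mul_eq_div]

lemma IsRadialRoot.normConst_eq (h : IsRadialRoot k f η T) :
    normConst k f = (∫ y : EuclideanSpace ℝ (Fin k), η ‖y‖ ^ 2)⁻¹ := by
  rw [normConst]
  congr 1
  refine integral_congr_ae ?_
  filter_upwards [ae_comp_norm (E := EuclideanSpace ℝ (Fin k)) h.density_eq] with y hy using hy

lemma IsRadialRoot.normConst_pos (h : IsRadialRoot k f η T) : 0 < normConst k f := by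
  rw [h.normConst_eq]
  exact inv_pos.2 (h.regular.integral_sq_pos finrank_euclidean h.pos)

lemma measurable_ellipticalDensity (hf : Measurable f) {ϑ : Param k} (hϑ : ϑ ∈ paramSpace k) :
    Measurable (ellipticalDensity f ϑ) := by
  have : ellipticalDensity f ϑ
      = fun x => normConst k f * ((rootScatter ϑ).det)⁻¹ * f ‖standardize ϑ x‖ :=
    funext fun x => ellipticalDensity_eq f hϑ x
  rw [this]
  exact (hf.comp (measurable_norm.comp (measurable_standardize hϑ))).const_mul _

/-- An elliptical observation is an affine image of a spherical one. -/
lemma IsRadialRoot.ellipticalLaw_eq_map (h : IsRadialRoot k f η T) (hf : Measurable f)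
    {ϑ : Param k} (hϑ : ϑ ∈ paramSpace k) :
    ellipticalLaw f ϑ = Measure.map (unstandardize ϑ) (rootLaw η) := by
  have hd := (posDef_rootScatter hϑ).det_pos
  have hc := h.normConst_pos
  have hG : (rootLaw η : Measure (EuclideanSpace ℝ (Fin k)))
      = volume.withDensity fun y => ENNReal.ofReal (normConst k f * f ‖y‖) := by
    rw [rootLaw, ← h.normConst_eq]
    refine withDensity_congr_ae ?_
    filter_upwards [ae_comp_norm (E := EuclideanSpace ℝ (Fin k)) h.density_eq] with y hy
    rw [hy]
  have hfm : Measurable fun y : EuclideanSpace ℝ (Fin k) =>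
      ENNReal.ofReal (normConst k f * f ‖y‖) :=
    ((hf.comp measurable_norm).const_mul _).ennreal_ofReal
  ext s hs
  have hs' : MeasurableSet (unstandardize ϑ ⁻¹' s) := measurable_unstandardize ϑ hs
  have hgm : Measurable fun x => ENNReal.ofReal (normConst k f * f ‖standardize ϑ x‖) :=
    hfm.comp (measurable_standardize hϑ)
  rw [Measure.map_apply (measurable_unstandardize ϑ) hs, hG, withDensity_apply _ hs',
    ellipticalLaw, withDensity_apply _ hs]
  have h1 := lintegral_map (μ := (volume : Measure (EuclideanSpace ℝ (Fin k))))
    (hgm.indicator hs) (measurable_unstandardize ϑ)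
  rw [map_unstandardize_volume hϑ, lintegral_smul_measure, lintegral_indicator hs] at h1
  have h2 : ∀ y, s.indicator (fun x => ENNReal.ofReal (normConst k f * f ‖standardize ϑ x‖))
      (unstandardize ϑ y) = (unstandardize ϑ ⁻¹' s).indicator
        (fun y => ENNReal.ofReal (normConst k f * f ‖y‖)) y := fun y => by
    simp only [indicator, standardize_unstandardize hϑ]
    rfl
  simp only [h2] at h1
  rw [lintegral_indicator hs'] at h1
  rw [← h1, smul_eq_mul, ← lintegral_const_mul _ hgm]
  refine lintegral_congr fun x => ?_
  rw [← ENNReal.ofReal_mul (inv_nonneg.2 hd.le), ellipticalDensity_eq f hϑ]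
  congr 1
  ring

end Standardization

/-! ### Pairs of parameters -/

section ParameterPairs

variable {k : ℕ} [NeZero k] {f η T : ℝ → ℝ}

/-- The inverse scatter matrix of the parameter `ϑ'` in the coordinates standardized by `ϑ`. -/
def relScatter (ϑ ϑ' : Param k) : Matrix (Fin k) (Fin k) ℝ :=
  rootScatter ϑ * (scaleSq ϑ' • shape ϑ')⁻¹ * rootScatter ϑ

lemma posDef_relScatter {ϑ ϑ' : Param k} (hϑ : ϑ ∈ paramSpace k) (hϑ' : ϑ' ∈ paramSpace k) :
    (relScatter ϑ ϑ').PosDef := by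
  have h1 : (scaleSq ϑ' • shape ϑ')⁻¹.PosDef := (hϑ'.2.smul hϑ'.1).inv
  have h2 := h1.conjTranspose_mul_mul_same (B := rootScatter ϑ)
    (Matrix.mulVec_injective_iff_isUnit.2
      ((Matrix.isUnit_iff_isUnit_det _).2 (isUnit_det_rootScatter hϑ)))
  rwa [(posDef_rootScatter hϑ).isHermitian.eq] at h2

/-- The linear part of the deformation which maps the parameter `ϑ` to `ϑ'`, minus the identity,
in the coordinates standardized by `ϑ`. -/
def relDeform (ϑ ϑ' : Param k) : EuclideanSpace ℝ (Fin k) →L[ℝ] EuclideanSpace ℝ (Fin k) :=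
  Matrix.toEuclideanCLM (𝕜 := ℝ) (matSqrt (relScatter ϑ ϑ') - 1)

/-- The shift of the deformation which maps the parameter `ϑ` to `ϑ'`, in the coordinates
standardized by `ϑ`. -/
def relShift (ϑ ϑ' : Param k) : EuclideanSpace ℝ (Fin k) :=
  Matrix.toEuclideanCLM (𝕜 := ℝ) (matSqrt (relScatter ϑ ϑ')) (standardize ϑ (location ϑ'))

lemma det_one_add_relDeform {ϑ ϑ' : Param k} (hϑ : ϑ ∈ paramSpace k) (hϑ' : ϑ' ∈ paramSpace k) :
    (1 + relDeform ϑ ϑ').det = (rootScatter ϑ).det * ((rootScatter ϑ').det)⁻¹ := by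
  have h1 : (1 + relDeform ϑ ϑ').det = (matSqrt (relScatter ϑ ϑ')).det := by
    rw [relDeform, ← map_one (Matrix.toEuclideanCLM (n := Fin k) (𝕜 := ℝ)), ← map_add,
      toEuclideanCLM_det, add_sub_cancel]
  have hp := posDef_relScatter hϑ hϑ'
  rw [h1, ← pow_left_inj₀ (posDef_sqrt hp).det_pos.le (mul_pos (posDef_rootScatter hϑ).det_pos
    (inv_pos.2 (posDef_rootScatter hϑ').det_pos)).le two_ne_zero, sq, ← Matrix.det_mul,
    sqrt_mul_self hp.posSemidef, relScatter, ← rootScatter_mul_self hϑ', Matrix.det_mul,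
    Matrix.det_mul, Matrix.det_nonsing_inv, Ring.inverse_eq_inv', Matrix.det_mul, mul_inv]
  ring

/-- Standardizing with `ϑ'` instead of `ϑ` amounts, for the modulus, to an affine deformation whose
linear part is symmetric. -/
lemma norm_standardize_eq_norm_deform {ϑ ϑ' : Param k} (hϑ : ϑ ∈ paramSpace k)
    (hϑ' : ϑ' ∈ paramSpace k) (x : EuclideanSpace ℝ (Fin k)) :
    ‖standardize ϑ' x‖
      = ‖standardize ϑ x + (relDeform ϑ ϑ' (standardize ϑ x) - relShift ϑ ϑ')‖ := by
  set R := rootScatter ϑ with hR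
  set R' := rootScatter ϑ' with hR'
  set B := matSqrt (relScatter ϑ ϑ') with hB
  set y := standardize ϑ x - standardize ϑ (location ϑ') with hy
  have h1 : standardize ϑ x + (relDeform ϑ ϑ' (standardize ϑ x) - relShift ϑ ϑ')
      = Matrix.toEuclideanCLM (𝕜 := ℝ) B y := by
    rw [relDeform, relShift, map_sub, map_one, hy, map_sub]
    change standardize ϑ x + (Matrix.toEuclideanCLM (𝕜 := ℝ) B (standardize ϑ x)
      - standardize ϑ x - _) = _
    abel
  have h2 : standardize ϑ' x = Matrix.toEuclideanCLM (𝕜 := ℝ) (R'⁻¹ * R) y := by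
    have h3 : Matrix.toEuclideanCLM (𝕜 := ℝ) R y = x - location ϑ' := by
      rw [hy, standardize_eq hϑ, standardize_eq hϑ, ← map_sub, ← toEuclideanCLM_mul_apply,
        Matrix.mul_nonsing_inv _ (isUnit_det_rootScatter hϑ), map_one]
      change (x - location ϑ) - (location ϑ' - location ϑ) = _
      abel
    rw [standardize_eq hϑ', toEuclideanCLM_mul_apply, h3]
  have hBB : B * B = R * (R' * R')⁻¹ * R := by
    rw [hB, sqrt_mul_self (posDef_relScatter hϑ hϑ').posSemidef, relScatter, hR',
      rootScatter_mul_self hϑ']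
  have hnorm : ∀ M : Matrix (Fin k) (Fin k) ℝ, ‖Matrix.toEuclideanCLM (𝕜 := ℝ) M y‖ ^ 2
      = y.ofLp ⬝ᵥ ((Mᵀ * M) *ᵥ y.ofLp) := fun M => by
    rw [← real_inner_self_eq_norm_sq, inner_eq_dotProduct, toEuclideanCLM_ofLp,
      ← Matrix.mulVec_mulVec, Matrix.dotProduct_mulVec _ Mᵀ, Matrix.vecMul_transpose]
  rw [h1, h2, ← pow_left_inj₀ (norm_nonneg _) (norm_nonneg _) two_ne_zero, hnorm, hnorm,
    posDef_isSymm (posDef_sqrt (posDef_relScatter hϑ hϑ')), ← hB, hBB, Matrix.transpose_mul,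
    posDef_isSymm (posDef_rootScatter hϑ), posDef_isSymm (posDef_rootScatter hϑ').inv,
    Matrix.mul_inv_rev]
  simp only [Matrix.mul_assoc]
  rfl

/-- The laws of one observation are mutually absolutely continuous, with an explicit density. -/
lemma IsRadialRoot.ellipticalLaw_eq_withDensity (h : IsRadialRoot k f η T) (hf : Measurable f)
    {ϑ ϑ' : Param k} (hϑ : ϑ ∈ paramSpace k) (hϑ' : ϑ' ∈ paramSpace k) :
    ellipticalLaw f ϑ' = (ellipticalLaw f ϑ).withDensity fun x =>
      ENNReal.ofReal (rootRatio η (relDeform ϑ ϑ') (relShift ϑ ϑ') (standardize ϑ x) ^ 2) := by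
  have hm : Measurable fun x => ENNReal.ofReal
      (rootRatio η (relDeform ϑ ϑ') (relShift ϑ ϑ') (standardize ϑ x) ^ 2) :=
    (((measurable_rootRatio h.regular _ _).comp (measurable_standardize hϑ)).pow_const
      2).ennreal_ofReal
  rw [ellipticalLaw, ellipticalLaw,
    ← withDensity_mul _ (measurable_ellipticalDensity hf hϑ).ennreal_ofReal hm]
  refine withDensity_congr_ae ?_
  have hd := (posDef_rootScatter hϑ).det_pos
  have hd' := (posDef_rootScatter hϑ').det_pos
  have hc := h.normConst_pos
  filter_upwards [ae_standardize hϑ (ae_comp_norm h.pos),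
    ae_standardize hϑ (ae_comp_norm h.density_eq),
    ae_standardize hϑ' (ae_comp_norm h.density_eq)] with x h1 h2 h3
  rw [Pi.mul_apply, ← ENNReal.ofReal_mul' (sq_nonneg _), ellipticalDensity_eq f hϑ,
    ellipticalDensity_eq f hϑ', h2, h3, norm_standardize_eq_norm_deform hϑ hϑ', rootRatio,
    div_pow, mul_pow, Real.sq_sqrt (abs_nonneg _), det_one_add_relDeform hϑ hϑ',
    abs_of_pos (mul_pos hd (inv_pos.2 hd'))]
  congr 1
  field_simp

end ParameterPairs

/-! ### Local parameters -/

section LocalParameters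

variable {k : ℕ} [NeZero k] {ι : Type*} {l : Filter ι}

lemma continuous_unvech (c : ℝ) : Continuous (unvech (k := k) c) := by
  refine continuous_matrix fun i j => ?_
  simp only [unvech, Matrix.of_apply]
  split_ifs
  · exact continuous_const
  · exact continuous_apply _

lemma continuous_shape : Continuous (shape : Param k → Matrix (Fin k) (Fin k) ℝ) :=
  (continuous_unvech 1).comp (by fun_prop)

lemma continuous_shapeDir : Continuous (shapeDir : Param k → Matrix (Fin k) (Fin k) ℝ) :=
  (continuous_unvech 0).comp (by fun_prop)

lemma continuous_scaleSq : Continuous (scaleSq : Param k → ℝ) := by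
  unfold scaleSq; fun_prop

lemma continuous_location : Continuous (location : Param k → EuclideanSpace ℝ (Fin k)) := by
  unfold location; fun_prop

lemma tendsto_invSqrt_shape {ϑn : ι → Param k} {ϑ : Param k} (hϑ : ϑ ∈ paramSpace k)
    (hϑn : ∀ n, ϑn n ∈ paramSpace k) (h : Tendsto ϑn l (𝓝 ϑ)) :
    Tendsto (fun n => invSqrt (shape (ϑn n))) l (𝓝 (invSqrt (shape ϑ))) :=
  tendsto_matrix_inv (tendsto_sqrt ((continuous_shape.tendsto ϑ).comp h)
    (Eventually.of_forall fun n => (hϑn n).2.posSemidef) hϑ.2.posSemidef)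
    (posDef_sqrt hϑ.2).det_pos.ne'

lemma tendsto_scatterDir {ϑn τn : ι → Param k} {ϑ τ : Param k} (hϑ : ϑ ∈ paramSpace k)
    (hϑn : ∀ n, ϑn n ∈ paramSpace k) (h : Tendsto ϑn l (𝓝 ϑ)) (hτ : Tendsto τn l (𝓝 τ)) :
    Tendsto (fun n => scatterDir (ϑn n) (τn n)) l (𝓝 (scatterDir ϑ τ)) := by
  have h1 := tendsto_invSqrt_shape hϑ hϑn h
  have h2 := (continuous_shapeDir.tendsto τ).comp hτ
  have h3 := ((continuous_scaleSq.tendsto τ).comp hτ).div ((continuous_scaleSq.tendsto ϑ).comp h)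
    hϑ.1.ne'
  exact (h3.smul tendsto_const_nhds).add ((h1.mul h2).mul h1)

lemma tendsto_mulVec {α : Type*} {l : Filter α} {A : α → Matrix (Fin k) (Fin k) ℝ}
    {A₀ : Matrix (Fin k) (Fin k) ℝ} {v : α → Fin k → ℝ} {v₀ : Fin k → ℝ}
    (hA : Tendsto A l (𝓝 A₀)) (hv : Tendsto v l (𝓝 v₀)) :
    Tendsto (fun n => A n *ᵥ v n) l (𝓝 (A₀ *ᵥ v₀)) := by
  have : Continuous fun p : Matrix (Fin k) (Fin k) ℝ × (Fin k → ℝ) => p.1 *ᵥ p.2 :=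
    continuous_fst.matrix_mulVec continuous_snd
  exact (this.tendsto (A₀, v₀)).comp (hA.prodMk_nhds hv)

lemma tendsto_shiftDir {ϑn τn : ι → Param k} {ϑ τ : Param k} (hϑ : ϑ ∈ paramSpace k)
    (hϑn : ∀ n, ϑn n ∈ paramSpace k) (h : Tendsto ϑn l (𝓝 ϑ)) (hτ : Tendsto τn l (𝓝 τ)) :
    Tendsto (fun n => shiftDir (ϑn n) (τn n)) l (𝓝 (shiftDir ϑ τ)) := by
  have h1 := tendsto_invSqrt_shape hϑ hϑn h
  have h2 : Tendsto (fun n => (location (τn n)).ofLp) l (𝓝 (location τ).ofLp) :=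
    ((PiLp.continuous_ofLp 2 _).tendsto _).comp ((continuous_location.tendsto τ).comp hτ)
  have h3 : Tendsto (fun n => (scale (ϑn n))⁻¹) l (𝓝 (scale ϑ)⁻¹) :=
    (((Real.continuous_sqrt.tendsto _).comp ((continuous_scaleSq.tendsto ϑ).comp h))).inv₀
      (scale_pos hϑ).ne'
  exact ((PiLp.continuous_toLp 2 _).tendsto _).comp (h3.smul (tendsto_mulVec h1 h2))

/-- Positive definiteness is an open condition on symmetric matrices. -/
lemma eventually_posDef {V : ι → Matrix (Fin k) (Fin k) ℝ} {V₀ : Matrix (Fin k) (Fin k) ℝ}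
    (hV₀ : V₀.PosDef) (hV : ∀ n, (V n)ᵀ = V n) (h : Tendsto V l (𝓝 V₀)) :
    ∀ᶠ n in l, (V n).PosDef := by
  set C := ‖Matrix.toEuclideanCLM (n := Fin k) (𝕜 := ℝ) (invSqrt V₀)‖ with hC
  have hlim : Tendsto (fun n => C ^ 2 * ‖Matrix.toEuclideanCLM (n := Fin k) (𝕜 := ℝ) (V n - V₀)‖)
      l (𝓝 0) := by
    have h1 := (continuous_toEuclideanCLM.tendsto _).comp (h.sub_const V₀)
    rw [sub_self, map_zero] at h1
    simpa using h1.norm.const_mul (C ^ 2)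
  filter_upwards [hlim.eventually (gt_mem_nhds one_pos)] with n hn
  refine Matrix.PosDef.of_dotProduct_mulVec_pos (by
    rw [Matrix.IsHermitian, Matrix.conjTranspose_eq_transpose_of_trivial, hV]) fun x hx => ?_
  rw [star_trivial]
  set y : EuclideanSpace ℝ (Fin k) := WithLp.toLp 2 x with hy
  have hy0 : y ≠ 0 := fun h0 => hx (congrArg WithLp.ofLp h0)
  have hypos : 0 < ‖y‖ := norm_pos_iff.2 hy0
  set z := Matrix.toEuclideanCLM (n := Fin k) (𝕜 := ℝ) (matSqrt V₀) y with hz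
  have hyz : ‖y‖ ≤ C * ‖z‖ := by
    have : y = Matrix.toEuclideanCLM (n := Fin k) (𝕜 := ℝ) (invSqrt V₀) z := by
      rw [hz, ← toEuclideanCLM_mul_apply, invSqrt_eq,
        Matrix.nonsing_inv_mul _ (posDef_sqrt hV₀).det_pos.ne'.isUnit, map_one]
      rfl
    conv_lhs => rw [this]
    exact ContinuousLinearMap.le_opNorm _ _
  have hz2 : ‖z‖ ^ 2 = x ⬝ᵥ (V₀ *ᵥ x) := by
    rw [← real_inner_self_eq_norm_sq, inner_eq_dotProduct, hz, toEuclideanCLM_ofLp,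
      Matrix.dotProduct_mulVec, ← Matrix.mulVec_transpose, Matrix.mulVec_mulVec,
      posDef_isSymm (posDef_sqrt hV₀), sqrt_mul_self hV₀.posSemidef, dotProduct_comm]
  have hsub : |x ⬝ᵥ ((V n - V₀) *ᵥ x)|
      ≤ ‖Matrix.toEuclideanCLM (n := Fin k) (𝕜 := ℝ) (V n - V₀)‖ * ‖y‖ ^ 2 := by
    have h1 := abs_real_inner_le_norm y (Matrix.toEuclideanCLM (n := Fin k) (𝕜 := ℝ) (V n - V₀) y)
    rw [inner_eq_dotProduct, toEuclideanCLM_ofLp] at h1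
    refine h1.trans ?_
    have h2 := (Matrix.toEuclideanCLM (n := Fin k) (𝕜 := ℝ) (V n - V₀)).le_opNorm y
    nlinarith
  have e : x ⬝ᵥ (V n *ᵥ x) = ‖z‖ ^ 2 + x ⬝ᵥ ((V n - V₀) *ᵥ x) := by
    rw [hz2, Matrix.sub_mulVec, dotProduct_sub]; ring
  rw [e]
  have hy2 : ‖y‖ ^ 2 ≤ C ^ 2 * ‖z‖ ^ 2 := by
    rw [← mul_pow]; exact pow_le_pow_left₀ hypos.le hyz 2
  have hz0 : 0 < ‖z‖ ^ 2 := by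
    have : 0 < C ^ 2 * ‖z‖ ^ 2 := lt_of_lt_of_le (by positivity) hy2
    exact pos_of_mul_pos_right this (sq_nonneg C)
  have h5 : ‖Matrix.toEuclideanCLM (n := Fin k) (𝕜 := ℝ) (V n - V₀)‖ * ‖y‖ ^ 2
      ≤ (C ^ 2 * ‖Matrix.toEuclideanCLM (n := Fin k) (𝕜 := ℝ) (V n - V₀)‖) * ‖z‖ ^ 2 := by
    calc _ ≤ ‖Matrix.toEuclideanCLM (n := Fin k) (𝕜 := ℝ) (V n - V₀)‖ * (C ^ 2 * ‖z‖ ^ 2) := by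
          gcongr
      _ = _ := by ring
  have h6 := mul_lt_mul_of_pos_right hn hz0
  have h7 := neg_abs_le (x ⬝ᵥ ((V n - V₀) *ᵥ x))
  linarith

lemma shape_transpose (ϑ : Param k) : (shape ϑ)ᵀ = shape ϑ := unvech_transpose _ _

/-- The parameter space is open. -/
lemma eventually_mem_paramSpace {ϑn : ι → Param k} {ϑ : Param k} (hϑ : ϑ ∈ paramSpace k)
    (h : Tendsto ϑn l (𝓝 ϑ)) : ∀ᶠ n in l, ϑn n ∈ paramSpace k := by
  filter_upwards [((continuous_scaleSq.tendsto ϑ).comp h).eventually (lt_mem_nhds hϑ.1),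
    eventually_posDef hϑ.2 (fun n => shape_transpose (ϑn n))
      ((continuous_shape.tendsto ϑ).comp h)] with n h1 h2 using ⟨h1, h2⟩

variable {s : ι → ℝ}

lemma tendsto_add_inv_smul (hs : Tendsto (fun n => (s n)⁻¹) l (𝓝 0)) {ϑn τn : ι → Param k}
    {ϑ τ : Param k} (h : Tendsto ϑn l (𝓝 ϑ)) (hτ : Tendsto τn l (𝓝 τ)) :
    Tendsto (fun n => ϑn n + (s n)⁻¹ • τn n) l (𝓝 ϑ) := by
  have := h.add (hs.smul hτ)
  rwa [zero_smul, add_zero] at this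

lemma relScatter_inv_sub_one {ϑ τ : Param k} (hϑ : ϑ ∈ paramSpace k) {ε : ℝ}
    (hϑ' : ϑ + ε • τ ∈ paramSpace k) :
    (relScatter ϑ (ϑ + ε • τ))⁻¹ - 1
      = ε • (scatterDir ϑ τ
        + (ε * scaleSq τ / scaleSq ϑ) • (invSqrt (shape ϑ) * shapeDir τ * invSqrt (shape ϑ))) := by
  have hσ := hϑ.1.ne'
  have hsc : (scale ϑ)⁻¹ * (scale ϑ)⁻¹ = (scaleSq ϑ)⁻¹ := by
    rw [← mul_inv, ← sq, scale_sq hϑ]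
  have hV : invSqrt (shape ϑ) * shape ϑ * invSqrt (shape ϑ) = 1 := by
    have h1 : invSqrt (shape ϑ) * matSqrt (shape ϑ) = 1 :=
      Matrix.nonsing_inv_mul _ (posDef_sqrt hϑ.2).det_pos.ne'.isUnit
    have h2 : matSqrt (shape ϑ) * invSqrt (shape ϑ) = 1 :=
      Matrix.mul_nonsing_inv _ (posDef_sqrt hϑ.2).det_pos.ne'.isUnit
    have h3 : invSqrt (shape ϑ) * (matSqrt (shape ϑ) * matSqrt (shape ϑ)) * invSqrt (shape ϑ)
        = 1 := by
      rw [← mul_assoc, h1, one_mul, h2]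
    rwa [sqrt_mul_self hϑ.2.posSemidef] at h3
  have hd' : IsUnit (scaleSq (ϑ + ε • τ) • shape (ϑ + ε • τ)).det :=
    (hϑ'.2.smul hϑ'.1).det_pos.ne'.isUnit
  rw [relScatter, Matrix.mul_inv_rev, Matrix.mul_inv_rev, Matrix.nonsing_inv_nonsing_inv _ hd',
    rootScatter_inv hϑ, scaleSq_add_smul, shape_add_smul]
  set P := invSqrt (shape ϑ) with hP
  set v := shapeDir τ with hv
  have e : ((scale ϑ)⁻¹ • P) * (((scaleSq ϑ + ε * scaleSq τ) • (shape ϑ + ε • v))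
      * ((scale ϑ)⁻¹ • P)) = ((scaleSq ϑ)⁻¹ * (scaleSq ϑ + ε * scaleSq τ)) •
        (P * shape ϑ * P + ε • (P * v * P)) := by
    rw [← hsc]
    simp only [smul_mul_assoc, mul_smul_comm, add_mul, mul_add, smul_add, smul_smul, ← mul_assoc]
    module
  rw [e, hV, scatterDir, ← hP, ← hv]
  have hc : (scaleSq ϑ)⁻¹ * (scaleSq ϑ + ε * scaleSq τ) = 1 + ε * (scaleSq τ / scaleSq ϑ) := by
    field_simp
  rw [hc, mul_div_assoc]
  generalize P * v * P = m
  generalize scaleSq τ / scaleSq ϑ = c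
  module

/-- The deformations between neighbouring parameters, magnified by `s n`, converge to the deformation
given by the scatter direction and the shift direction. -/
theorem tendsto_relDeform (hs : Tendsto (fun n => (s n)⁻¹) l (𝓝 0)) (hs0 : ∀ᶠ n in l, 0 < s n)
    {ϑn τn : ι → Param k} {ϑ τ : Param k} (hϑ : ϑ ∈ paramSpace k)
    (hϑn : ∀ n, ϑn n ∈ paramSpace k) (h : Tendsto ϑn l (𝓝 ϑ)) (hτ : Tendsto τn l (𝓝 τ)) :
    Tendsto (fun n => s n • relDeform (ϑn n) (ϑn n + (s n)⁻¹ • τn n)) l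
      (𝓝 (scatterDeform (scatterDir ϑ τ))) ∧
    Tendsto (fun n => s n • relShift (ϑn n) (ϑn n + (s n)⁻¹ • τn n)) l (𝓝 (shiftDir ϑ τ)) := by
  have hmem := eventually_mem_paramSpace hϑ (tendsto_add_inv_smul hs h hτ)
  have hS : ∀ᶠ n in l, (relScatter (ϑn n) (ϑn n + (s n)⁻¹ • τn n)).PosDef := by
    filter_upwards [hmem] with n hn using posDef_relScatter (hϑn n) hn
  have hW := tendsto_scatterDir hϑ hϑn h hτ
  have hb := tendsto_shiftDir hϑ hϑn h hτ
  have h1 := tendsto_invSqrt_shape hϑ hϑn h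
  have h2 := (continuous_shapeDir.tendsto τ).comp hτ
  have hrem : Tendsto (fun n => ((s n)⁻¹ * scaleSq (τn n) / scaleSq (ϑn n)) •
      (invSqrt (shape (ϑn n)) * shapeDir (τn n) * invSqrt (shape (ϑn n)))) l (𝓝 0) := by
    have h3 := (hs.mul ((continuous_scaleSq.tendsto τ).comp hτ)).div
      ((continuous_scaleSq.tendsto ϑ).comp h) hϑ.1.ne'
    have h4 := h3.smul ((h1.mul h2).mul h1)
    rwa [zero_mul, zero_div, zero_smul] at h4
  have hlim : Tendsto (fun n => s n • ((relScatter (ϑn n) (ϑn n + (s n)⁻¹ • τn n))⁻¹ - 1)) l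
      (𝓝 (scatterDir ϑ τ)) := by
    have h5 := hW.add hrem
    rw [add_zero] at h5
    refine h5.congr' ?_
    filter_upwards [hs0, hmem] with n hn hm
    rw [relScatter_inv_sub_one (hϑn n) hm, smul_smul, mul_inv_cancel₀ hn.ne', one_smul]
  have hB := tendsto_smul_invSqrt_sub_one hs hs0 hS hlim
  constructor
  · refine ((continuous_toEuclideanCLM.tendsto _).comp hB).congr fun n => ?_
    simp only [Function.comp_apply, map_smul, relDeform]
  · have hB1 : Tendsto (fun n => matSqrt (relScatter (ϑn n) (ϑn n + (s n)⁻¹ • τn n))) l (𝓝 1) := by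
      have h6 := (hs.smul hB).add_const 1
      rw [zero_smul, zero_add] at h6
      refine h6.congr' ?_
      filter_upwards [hs0] with n hn
      rw [smul_smul, inv_mul_cancel₀ hn.ne', one_smul, sub_add_cancel]
    have h7 := tendsto_mulVec hB1 (((PiLp.continuous_ofLp 2 _).tendsto _).comp hb)
    have h8 := ((PiLp.continuous_toLp 2 _).tendsto _).comp h7
    rw [Matrix.one_mulVec] at h8
    refine h8.congr' ?_
    filter_upwards [hs0] with n hn
    rw [relShift, standardize_eq (hϑn n), location_add_smul, add_sub_cancel_left, map_smul,
      map_smul, smul_smul, mul_inv_cancel₀ hn.ne', one_smul, rootScatter_inv (hϑn n)]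
    refine WithLp.ofLp_injective 2 ?_
    rw [toEuclideanCLM_ofLp, toEuclideanCLM_ofLp, Matrix.smul_mulVec]
    rfl

end LocalParameters

/-! ### Samples of elliptical observations -/

section ProductDensity

/-- The density of a product law is the product of the densities. -/
lemma pi_withDensity {ι α : Type*} [Fintype ι] [MeasurableSpace α] (ν : Measure α)
    [IsProbabilityMeasure ν] {g : α → ENNReal} (hg : Measurable g)
    [IsProbabilityMeasure (ν.withDensity g)] :
    Measure.pi (fun _ : ι => ν.withDensity g)
      = (Measure.pi fun _ : ι => ν).withDensity fun x => ∏ i, g (x i) := by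
  refine (Measure.pi_eq fun s hs => ?_)
  rw [withDensity_apply _ (MeasurableSet.univ_pi hs),
    ← lintegral_indicator (MeasurableSet.univ_pi hs)]
  have e : (univ.pi s).indicator (fun x : ι → α => ∏ i, g (x i))
      = fun x => ∏ i, (s i).indicator g (x i) := by
    funext x
    by_cases hx : x ∈ univ.pi s
    · rw [indicator_of_mem hx]
      exact Finset.prod_congr rfl fun i _ => (indicator_of_mem (hx i (mem_univ i)) _).symm
    · rw [indicator_of_notMem hx]
      obtain ⟨i, hi⟩ : ∃ i, x i ∉ s i := by
        by_contra! h
        exact hx fun i _ => h i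
      exact (Finset.prod_eq_zero (Finset.mem_univ i) (indicator_of_notMem hi _)).symm
  rw [e, lintegral_prod_eq_prod_lintegral_of_indepFun Finset.univ
    (fun i (x : ι → α) => (s i).indicator g (x i))
    (iIndepFun_pi (μ := fun _ : ι => ν) fun i => (hg.indicator (hs i)).aemeasurable)
    fun i => (hg.indicator (hs i)).comp (measurable_pi_apply i)]
  refine Finset.prod_congr rfl fun i _ => ?_
  rw [withDensity_apply _ (hs i), ← lintegral_indicator (hs i)]
  exact (measurePreserving_eval (fun _ : ι => ν) i).lintegral_comp (hg.indicator (hs i))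

end ProductDensity

section SampleLaw

variable {k : ℕ} [NeZero k] {f η T : ℝ → ℝ} {Ω : Type*} [MeasurableSpace Ω] {P : Measure Ω}
  {Y : ℕ → Ω → EuclideanSpace ℝ (Fin k)}

lemma IsRadialRoot.isProbabilityMeasure_ellipticalLaw (h : IsRadialRoot k f η T)
    (hf : Measurable f) {ϑ : Param k} (hϑ : ϑ ∈ paramSpace k) :
    IsProbabilityMeasure (ellipticalLaw f ϑ) := by
  have := h.regular.isProbabilityMeasure_rootLaw (E := EuclideanSpace ℝ (Fin k)) finrank_euclidean
    h.pos
  rw [h.ellipticalLaw_eq_map hf hϑ]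
  exact Measure.isProbabilityMeasure_map (measurable_unstandardize ϑ).aemeasurable

lemma IsRadialRoot.isProbabilityMeasure_sampleLaw (h : IsRadialRoot k f η T)
    (hf : Measurable f) (n : ℕ) {ϑ : Param k} (hϑ : ϑ ∈ paramSpace k) :
    IsProbabilityMeasure (sampleLaw f n ϑ) := by
  have := h.isProbabilityMeasure_ellipticalLaw hf hϑ
  rw [sampleLaw]
  infer_instance

lemma measurable_unstandardize_sample (hY : IsSample Y (rootLaw η) P) (n : ℕ) (ϑ : Param k) :
    Measurable fun ω (i : Fin n) => unstandardize ϑ (Y i ω) :=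
  measurable_pi_lambda _ fun i => (measurable_unstandardize ϑ).comp (hY.measurable i)

/-- A sample of elliptical observations is the affine image of a sample of spherical ones. -/
lemma IsRadialRoot.sampleLaw_eq_map (h : IsRadialRoot k f η T) (hf : Measurable f)
    (hY : IsSample Y (rootLaw η) P) (n : ℕ) {ϑ : Param k} (hϑ : ϑ ∈ paramSpace k) :
    sampleLaw f n ϑ = P.map fun ω (i : Fin n) => unstandardize ϑ (Y i ω) := by
  have hind : iIndepFun (fun (i : Fin n) ω => unstandardize ϑ (Y i ω)) P :=
    (hY.indep.precomp (g := fun i : Fin n => (i : ℕ)) Fin.val_injective).comp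
      (fun _ => unstandardize ϑ) fun _ => measurable_unstandardize ϑ
  have hm : ∀ i : Fin n, AEMeasurable (fun ω => unstandardize ϑ (Y i ω)) P := fun i =>
    ((measurable_unstandardize ϑ).comp (hY.measurable i)).aemeasurable
  rw [hind.map_fun_eq_pi_map hm, sampleLaw]
  congr 1
  funext i
  rw [h.ellipticalLaw_eq_map hf hϑ, ← hY.map_eq i,
    Measure.map_map (measurable_unstandardize ϑ) (hY.measurable i)]
  rfl

lemma IsRadialRoot.ae_sampleLaw (h : IsRadialRoot k f η T) (hf : Measurable f) (n : ℕ)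
    {ϑ : Param k} (hϑ : ϑ ∈ paramSpace k) {p : EuclideanSpace ℝ (Fin k) → Prop}
    (hp : ∀ᵐ x, p x) : ∀ᵐ X ∂(sampleLaw f n ϑ), ∀ i, p (X i) := by
  have := h.isProbabilityMeasure_ellipticalLaw hf hϑ
  have hp' : ∀ᵐ x ∂(ellipticalLaw f ϑ), p x := (withDensity_absolutelyContinuous _ _).ae_le hp
  rw [ae_all_iff]
  intro i
  exact (Measure.quasiMeasurePreserving_eval (fun _ : Fin n => ellipticalLaw f ϑ) i).ae hp'

/-- The log-likelihood ratio of two sample laws is a sum over the observations. -/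
lemma IsRadialRoot.llr_sampleLaw (h : IsRadialRoot k f η T) (hf : Measurable f) (n : ℕ)
    {ϑ ϑ' : Param k} (hϑ : ϑ ∈ paramSpace k) (hϑ' : ϑ' ∈ paramSpace k) :
    ∀ᵐ X ∂(sampleLaw f n ϑ), llr (sampleLaw f n ϑ') (sampleLaw f n ϑ) X
      = ∑ i, Real.log
        (rootRatio η (relDeform ϑ ϑ') (relShift ϑ ϑ') (standardize ϑ (X i)) ^ 2) := by
  have h1 := h.isProbabilityMeasure_ellipticalLaw hf hϑ
  have h2 := h.isProbabilityMeasure_ellipticalLaw hf hϑ'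
  have h3 := h.isProbabilityMeasure_sampleLaw hf n hϑ
  set g : EuclideanSpace ℝ (Fin k) → ENNReal := fun x => ENNReal.ofReal
    (rootRatio η (relDeform ϑ ϑ') (relShift ϑ ϑ') (standardize ϑ x) ^ 2) with hg
  have hgm : Measurable g :=
    (((measurable_rootRatio h.regular _ _).comp (measurable_standardize hϑ)).pow_const
      2).ennreal_ofReal
  have hL : ellipticalLaw f ϑ' = (ellipticalLaw f ϑ).withDensity g :=
    h.ellipticalLaw_eq_withDensity hf hϑ hϑ'
  have h4 : IsProbabilityMeasure ((ellipticalLaw f ϑ).withDensity g) := by rwa [← hL]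
  have hS : sampleLaw f n ϑ' = (sampleLaw f n ϑ).withDensity fun X => ∏ i, g (X i) := by
    rw [sampleLaw, hL, pi_withDensity _ hgm, sampleLaw]
  have hpos : ∀ᵐ x : EuclideanSpace ℝ (Fin k),
      rootRatio η (relDeform ϑ ϑ') (relShift ϑ ϑ') (standardize ϑ x) ≠ 0 := by
    filter_upwards [ae_standardize hϑ (ae_comp_norm h.pos),
      ae_standardize hϑ' (ae_comp_norm h.pos)] with x hx hx'
    have hd : 0 < |(1 + relDeform ϑ ϑ').det| := by
      rw [det_one_add_relDeform hϑ hϑ']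
      exact abs_pos.2 (mul_pos (posDef_rootScatter hϑ).det_pos
        (inv_pos.2 (posDef_rootScatter hϑ').det_pos)).ne'
    rw [norm_standardize_eq_norm_deform hϑ hϑ'] at hx'
    exact (div_pos (mul_pos (Real.sqrt_pos.2 hd) hx') hx).ne'
  have hm : Measurable fun X : Fin n → EuclideanSpace ℝ (Fin k) => ∏ i, g (X i) :=
    Finset.measurable_fun_prod _ fun i _ => hgm.comp (measurable_pi_apply i)
  filter_upwards [Measure.rnDeriv_withDensity (sampleLaw f n ϑ) hm,
    h.ae_sampleLaw hf n hϑ hpos] with X h5 h6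
  rw [llr, hS, h5, ENNReal.toReal_prod, Real.log_prod fun i _ => ?_]
  · simp only [hg, ENNReal.toReal_ofReal (sq_nonneg _)]
  · simp only [hg, ENNReal.toReal_ofReal (sq_nonneg _)]
    exact pow_ne_zero 2 (h6 i)

end SampleLaw

section DirectionalScore

variable {k : ℕ} [NeZero k] {f η T : ℝ → ℝ} {ι : Type*} {l : Filter ι}

/-- The score of one standardized observation at `ϑ` in the direction `τ`. -/
def dirScore (η T : ℝ → ℝ) (ϑ τ : Param k) : EuclideanSpace ℝ (Fin k) → ℝ :=
  rootScore η T (scatterDeform (scatterDir ϑ τ)) (shiftDir ϑ τ)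

lemma IsRadialRoot.measurable_dirScore (h : IsRadialRoot k f η T) (ϑ τ : Param k) :
    Measurable (dirScore η T ϑ τ) :=
  measurable_rootScore h.regular _ _

lemma IsRadialRoot.memLp_dirScore (h : IsRadialRoot k f η T) (ϑ τ : Param k) :
    MemLp (dirScore η T ϑ τ) 2 (rootLaw η) :=
  h.regular.memLp_rootScore finrank_euclidean h.pos _ _

lemma IsRadialRoot.integral_dirScore (h : IsRadialRoot k f η T) {ϑ : Param k}
    (hϑ : ϑ ∈ paramSpace k) (τ : Param k) : ∫ y, dirScore η T ϑ τ y ∂(rootLaw η) = 0 :=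
  h.regular.integral_rootScore finrank_euclidean h.pos
    (scatterDeform_isSymmetric (scatterDir_transpose hϑ τ)) _

lemma IsRadialRoot.integral_dirScore_sq (h : IsRadialRoot k f η T) {ϑ : Param k}
    (hϑ : ϑ ∈ paramSpace k) (τ : Param k) :
    ∫ y, dirScore η T ϑ τ y ^ 2 ∂(rootLaw η) = τ.ofLp ⬝ᵥ (infoMat f ϑ *ᵥ τ.ofLp) := by
  rw [dotProduct_infoMat f hϑ, h.locInfo_eq, h.shapeInfo_eq, ← scoreInfo_scatterDeform]
  exact h.regular.integral_rootScore_sq finrank_euclidean h.pos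
    (scatterDeform_isSymmetric (scatterDir_transpose hϑ τ)) _

/-- The score depends continuously, in quadratic mean, on the parameter and the direction. -/
lemma IsRadialRoot.tendsto_integral_dirScore_sub_sq (h : IsRadialRoot k f η T)
    {ϑn τn : ι → Param k} {ϑ τ : Param k} (hϑ : ϑ ∈ paramSpace k)
    (hϑn : ∀ n, ϑn n ∈ paramSpace k) (hlim : Tendsto ϑn l (𝓝 ϑ)) (hτ : Tendsto τn l (𝓝 τ)) :
    Tendsto (fun n => ∫ y, (dirScore η T (ϑn n) (τn n) y - dirScore η T ϑ τ y) ^ 2 ∂(rootLaw η)) l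
      (𝓝 0) := by
  have hW := (tendsto_scatterDir hϑ hϑn hlim hτ).sub_const (scatterDir ϑ τ)
  have hb := (tendsto_shiftDir hϑ hϑn hlim hτ).sub_const (shiftDir ϑ τ)
  rw [sub_self] at hW hb
  set I := rootLocInfo (EuclideanSpace ℝ (Fin k)) η T
  set J := rootShapeInfo (EuclideanSpace ℝ (Fin k)) η T
  have hcont : Continuous fun p : Matrix (Fin k) (Fin k) ℝ × EuclideanSpace ℝ (Fin k) =>
      infoForm I J p.1 p.2 := by
    have h1 : Continuous fun p : Matrix (Fin k) (Fin k) ℝ × EuclideanSpace ℝ (Fin k) =>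
      p.1.trace := continuous_fst.matrix_trace
    have h2 : Continuous fun p : Matrix (Fin k) (Fin k) ℝ × EuclideanSpace ℝ (Fin k) =>
      (p.1 * p.1).trace := (continuous_fst.matrix_mul continuous_fst).matrix_trace
    unfold infoForm
    fun_prop
  have h3 := (hcont.tendsto (0, 0)).comp (hW.prodMk_nhds hb)
  have h0 : infoForm I J (0 : Matrix (Fin k) (Fin k) ℝ) 0 = 0 := by simp [infoForm]
  dsimp only at h3
  rw [h0] at h3
  refine h3.congr fun n => ?_
  have hs : (scatterDir (ϑn n) (τn n) - scatterDir ϑ τ)ᵀ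
      = scatterDir (ϑn n) (τn n) - scatterDir ϑ τ := by
    rw [Matrix.transpose_sub, scatterDir_transpose (hϑn n), scatterDir_transpose hϑ]
  simp only [dirScore, rootScore_sub, scatterDeform_sub]
  rw [h.regular.integral_rootScore_sq finrank_euclidean h.pos (scatterDeform_isSymmetric hs),
    scoreInfo_scatterDeform]
  rfl

/-- The central sequence is, in every direction, the normalized sum of the scores. -/
lemma IsRadialRoot.inner_centralSeq_ae_eq (h : IsRadialRoot k f η T) (hf : Measurable f) (n : ℕ)
    {ϑ : Param k} (hϑ : ϑ ∈ paramSpace k) (τ : Param k) :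
    ∀ᵐ X ∂(sampleLaw f n ϑ), inner ℝ τ (centralSeq f n ϑ X)
      = (√n)⁻¹ * ∑ i, dirScore η T ϑ τ (standardize ϑ (X i)) := by
  filter_upwards [h.ae_sampleLaw hf n hϑ (ae_standardize hϑ
    (h.standardScore_eq (scatterDir ϑ τ) (shiftDir ϑ τ)))] with X hX
  rw [inner_centralSeq f n hϑ]
  congr 1
  exact Finset.sum_congr rfl fun i _ => hX i

/-- The central sequence is only almost everywhere measurable, because the scores are defined through
arbitrary versions of weak derivatives. -/
lemma IsRadialRoot.aemeasurable_centralSeq (h : IsRadialRoot k f η T) (hf : Measurable f) (n : ℕ)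
    {ϑ : Param k} (hϑ : ϑ ∈ paramSpace k) : AEMeasurable (centralSeq f n ϑ) (sampleLaw f n ϑ) := by
  have hm : Measurable fun X : Fin n → EuclideanSpace ℝ (Fin k) =>
      (WithLp.toLp 2 fun p : ParamIdx k => (√n)⁻¹ * ∑ i,
        dirScore η T ϑ (EuclideanSpace.single p 1) (standardize ϑ (X i)) : Param k) := by
    refine (PiLp.continuous_toLp 2 _).measurable.comp (measurable_pi_lambda _ fun p => ?_)
    refine (Finset.measurable_fun_sum _ fun i _ => ?_).const_mul _
    exact (h.measurable_dirScore _ _).comp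
      ((measurable_standardize hϑ).comp (measurable_pi_apply i))
  refine ⟨_, hm, ?_⟩
  have hall : ∀ᵐ X ∂(sampleLaw f n ϑ), ∀ p : ParamIdx k,
      inner ℝ (EuclideanSpace.single p (1 : ℝ)) (centralSeq f n ϑ X) = (√n)⁻¹ * ∑ i,
        dirScore η T ϑ (EuclideanSpace.single p 1) (standardize ϑ (X i)) :=
    ae_all_iff.2 fun p => h.inner_centralSeq_ae_eq hf n hϑ _
  filter_upwards [hall] with X hX
  refine WithLp.ofLp_injective 2 (funext fun p => ?_)
  have h1 := hX p
  rw [EuclideanSpace.inner_single_left, map_one, one_mul] at h1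
  exact h1

end DirectionalScore

/-! ### Local asymptotic normality -/

section LocalAsymptoticNormality

variable {k : ℕ} [NeZero k] {f η T : ℝ → ℝ} {Ω : Type*} [MeasurableSpace Ω] {P : Measure Ω}
  {Y : ℕ → Ω → EuclideanSpace ℝ (Fin k)} {l : Filter ℕ}

/-- Almost everywhere equality allows probabilities of a sample of elliptical observations to be
computed on a sample of spherical ones. -/
lemma IsRadialRoot.sampleLaw_abs_ge_eq (h : IsRadialRoot k f η T) (hf : Measurable f)
    (hY : IsSample Y (rootLaw η) P) (n : ℕ) {ϑ : Param k} (hϑ : ϑ ∈ paramSpace k)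
    {Z Z' : (Fin n → EuclideanSpace ℝ (Fin k)) → ℝ} (hZ' : Measurable Z')
    (hZ : ∀ᵐ X ∂(sampleLaw f n ϑ), Z X = Z' fun i => standardize ϑ (X i)) (ε : ℝ) :
    sampleLaw f n ϑ {X | ε ≤ |Z X|} = P {ω | ε ≤ |Z' fun i => Y i ω|} := by
  have hs : Measurable fun (X : Fin n → EuclideanSpace ℝ (Fin k)) i => standardize ϑ (X i) :=
    measurable_pi_lambda _ fun i => (measurable_standardize hϑ).comp (measurable_pi_apply i)
  have e : {X | ε ≤ |Z X|} =ᵐ[sampleLaw f n ϑ] {X | ε ≤ |Z' fun i => standardize ϑ (X i)|} := by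
    filter_upwards [hZ] with X hX
    refine propext ?_
    change ε ≤ |Z X| ↔ ε ≤ |Z' fun i => standardize ϑ (X i)|
    rw [hX]
  have hms : MeasurableSet {X : Fin n → EuclideanSpace ℝ (Fin k) |
      ε ≤ |Z' fun i => standardize ϑ (X i)|} :=
    measurableSet_le measurable_const (hZ'.comp hs).abs
  rw [measure_congr e, h.sampleLaw_eq_map hf hY n hϑ,
    Measure.map_apply (measurable_unstandardize_sample hY n ϑ) hms]
  simp only [preimage_ofPred_eq, standardize_unstandardize hϑ]

/-- The expansion of the log-likelihood ratios along a filter on which the parameters and the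
directions converge, for a sample of standardized observations. -/
lemma IsRadialRoot.vanishesInProb_log_rootRatio (h : IsRadialRoot k f η T)
    (hY : IsSample Y (rootLaw η) P) [IsProbabilityMeasure P] (hl : l ≤ atTop)
    {ϑn τn : ℕ → Param k} {ϑ τ : Param k}
    (hϑ : ϑ ∈ paramSpace k) (hϑn : ∀ n, ϑn n ∈ paramSpace k) (hlim : Tendsto ϑn l (𝓝 ϑ))
    (hτ : Tendsto τn l (𝓝 τ)) :
    VanishesInProb P l fun n ω =>
      ∑ i ∈ Finset.range n, Real.log (rootRatio η (relDeform (ϑn n) (ϑn n + (√(n : ℝ))⁻¹ • τn n))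
        (relShift (ϑn n) (ϑn n + (√(n : ℝ))⁻¹ • τn n)) (Y i ω) ^ 2)
      - ((√(n : ℝ))⁻¹ * ∑ i ∈ Finset.range n, dirScore η T (ϑn n) (τn n) (Y i ω)
        - 1 / 2 * ((τn n).ofLp ⬝ᵥ (infoMat f ϑ *ᵥ (τn n).ofLp))) := by
  have hs : Tendsto (fun n : ℕ => (√(n : ℝ))⁻¹) l (𝓝 0) :=
    (tendsto_inv_atTop_zero.comp (Real.tendsto_sqrt_atTop.comp
      tendsto_natCast_atTop_atTop)).mono_left hl
  have hs0 : ∀ᶠ n : ℕ in l, 0 < √(n : ℝ) := by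
    filter_upwards [hl (eventually_gt_atTop 0)] with n hn
    exact Real.sqrt_pos.2 (Nat.cast_pos.2 hn)
  obtain ⟨hA, hb⟩ := tendsto_relDeform hs hs0 hϑ hϑn hlim hτ
  have hmem := eventually_mem_paramSpace hϑ (tendsto_add_inv_smul hs hlim hτ)
  have hdet : ∀ᶠ n : ℕ in l, (1 + relDeform (ϑn n) (ϑn n + (√(n : ℝ))⁻¹ • τn n)).det ≠ 0 := by
    filter_upwards [hmem] with n hn
    rw [det_one_add_relDeform (hϑn n) hn]
    exact (mul_pos (posDef_rootScatter (hϑn n)).det_pos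
      (inv_pos.2 (posDef_rootScatter hn).det_pos)).ne'
  have hqm := h.regular.tendsto_rootRatio finrank_euclidean h.pos hs hs0
    (scatterDeform_isSymmetric (scatterDir_transpose hϑ τ)) hA hb
  have h1 := hY.vanishesInProb_log_sub hl (h.memLp_dirScore ϑ τ) (h.integral_dirScore hϑ τ)
    (Λ := fun n => rootRatio η (relDeform (ϑn n) (ϑn n + (√(n : ℝ))⁻¹ • τn n))
        (relShift (ϑn n) (ϑn n + (√(n : ℝ))⁻¹ • τn n)))
    (hdet.mono fun n hn => h.regular.memLp_rootRatio finrank_euclidean h.pos _ hn)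
    (hdet.mono fun n hn => h.regular.integral_rootRatio_sq finrank_euclidean h.pos _ hn)
    (hqm.congr fun n => by rw [Real.sq_sqrt (Nat.cast_nonneg n)]; rfl)
  -- The score at the limiting parameter is replaced by the score at `ϑn n`.
  have h2 : VanishesInProb P l fun n ω => (√(n : ℝ))⁻¹ * ∑ i ∈ Finset.range n,
      (dirScore η T ϑ τ (Y i ω) - dirScore η T (ϑn n) (τn n) (Y i ω)) := by
    have hL : ∀ n, MemLp (fun y => dirScore η T ϑ τ y - dirScore η T (ϑn n) (τn n) y) 2
        (rootLaw η) := fun n => (h.memLp_dirScore ϑ τ).sub (h.memLp_dirScore _ _)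
    have hG : IsProbabilityMeasure (rootLaw η : Measure (EuclideanSpace ℝ (Fin k))) :=
      hY.isProbabilityMeasure
    refine vanishesInProb_of_integral_sq_le
      (Eventually.of_forall fun n => (memLp_finsetSum _ fun i _ =>
        hY.memLp_comp i (hL n)).const_mul _) (Eventually.of_forall fun n => ?_)
      (h.tendsto_integral_dirScore_sub_sq hϑ hϑn hlim hτ)
    have h0 : ∫ y, (dirScore η T ϑ τ y - dirScore η T (ϑn n) (τn n) y) ∂(rootLaw η) = 0 := by
      rw [integral_sub ((h.memLp_dirScore ϑ τ).integrable one_le_two)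
        ((h.memLp_dirScore _ _).integrable one_le_two), h.integral_dirScore hϑ,
        h.integral_dirScore (hϑn n), sub_zero]
    have hsq := hY.integral_sum_sq (hL n) h0 n
    simp only [mul_pow, inv_pow, Real.sq_sqrt (Nat.cast_nonneg (α := ℝ) n)]
    rw [integral_const_mul, hsq, ← mul_assoc]
    have e : ∫ y, (dirScore η T ϑ τ y - dirScore η T (ϑn n) (τn n) y) ^ 2 ∂(rootLaw η)
        = ∫ y, (dirScore η T (ϑn n) (τn n) y - dirScore η T ϑ τ y) ^ 2 ∂(rootLaw η) :=
      integral_congr_ae (ae_of_all _ fun y => by ring)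
    rw [e]
    exact mul_le_of_le_one_left (integral_nonneg fun _ => sq_nonneg _) inv_mul_le_one
  have h3 : VanishesInProb P l fun n (_ : Ω) =>
      1 / 2 * ((τn n).ofLp ⬝ᵥ (infoMat f ϑ *ᵥ (τn n).ofLp))
      - 1 / 2 * ∫ y, dirScore η T ϑ τ y ^ 2 ∂(rootLaw η) := by
    refine vanishesInProb_of_tendsto ?_
    have hc : Continuous fun t : Param k => t.ofLp ⬝ᵥ (infoMat f ϑ *ᵥ t.ofLp) := by
      have : Continuous fun t : Param k => infoMat f ϑ *ᵥ t.ofLp :=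
        continuous_const.matrix_mulVec (PiLp.continuous_ofLp 2 _)
      exact (PiLp.continuous_ofLp 2 _).dotProduct this
    have h4 := ((hc.tendsto τ).comp hτ).const_mul (1 / 2)
    have h5 := h4.sub_const (1 / 2 * ∫ y, dirScore η T ϑ τ y ^ 2 ∂(rootLaw η))
    rw [h.integral_dirScore_sq hϑ, sub_self] at h5
    rw [h.integral_dirScore_sq hϑ]
    exact h5
  refine ((h1.add h2).add h3).congr (Eventually.of_forall fun n => ae_of_all _ fun ω => ?_)
  simp only [Finset.sum_sub_distrib, mul_sub]
  ring

/-- The likelihood ratios of local alternatives have the locally asymptotically normal expansion. -/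
theorem IsRadialRoot.tendsto_sampleLaw_llr_sub (h : IsRadialRoot k f η T) (hf : Measurable f)
    {ϑ : Param k} (hϑ : ϑ ∈ paramSpace k) {ϑn τ : ℕ → Param k} (hϑn : ∀ n, ϑn n ∈ paramSpace k)
    (hlim : Tendsto ϑn atTop (𝓝 ϑ)) {C : ℝ} (hτ : ∀ n, ‖τ n‖ ≤ C) {ε : ℝ} (hε : 0 < ε) :
    Tendsto (fun n => sampleLaw f n (ϑn n) {X |
        ε ≤ |llr (sampleLaw f n (ϑn n + (√(n : ℝ))⁻¹ • τ n)) (sampleLaw f n (ϑn n)) X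
          - (inner ℝ (τ n) (centralSeq f n (ϑn n) X)
            - 1 / 2 * ((τ n).ofLp ⬝ᵥ (infoMat f ϑ *ᵥ (τ n).ofLp)))|}) atTop (𝓝 0) := by
  have hG := h.regular.isProbabilityMeasure_rootLaw (E := EuclideanSpace ℝ (Fin k))
    finrank_euclidean h.pos
  obtain ⟨Ω, _, P, Y, hYm, hYl, hYi, hP⟩ := exists_iid ℕ
    (rootLaw η : Measure (EuclideanSpace ℝ (Fin k)))
  have hY : IsSample Y (rootLaw η) P := ⟨hYm, fun i => (hYl i).map_eq, hYi⟩
  refine tendsto_iff_ultrafilter _ _ _ |>.2 fun u hu => ?_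
  -- Along an ultrafilter the bounded sequence of directions converges.
  obtain ⟨τ₀, -, hτ₀⟩ := (isCompact_closedBall (0 : Param k) C).ultrafilter_le_nhds' (u.map τ)
    (Ultrafilter.mem_map.2 (univ_mem' fun n => by simpa using hτ n))
  have hτ₀ : Tendsto τ u (𝓝 τ₀) := hτ₀
  have hlu := hlim.mono_left hu
  have hs : Tendsto (fun n : ℕ => (√(n : ℝ))⁻¹) u (𝓝 0) :=
    (tendsto_inv_atTop_zero.comp (Real.tendsto_sqrt_atTop.comp
      tendsto_natCast_atTop_atTop)).mono_left hu
  refine (h.vanishesInProb_log_rootRatio hY hu hϑ hϑn hlu hτ₀ ε hε).congr' ?_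
  filter_upwards [eventually_mem_paramSpace hϑ (tendsto_add_inv_smul hs hlu hτ₀)] with n hn
  have hm : Measurable fun y : Fin n → EuclideanSpace ℝ (Fin k) =>
      ∑ i, Real.log (rootRatio η (relDeform (ϑn n) (ϑn n + (√(n : ℝ))⁻¹ • τ n))
        (relShift (ϑn n) (ϑn n + (√(n : ℝ))⁻¹ • τ n)) (y i) ^ 2)
      - ((√(n : ℝ))⁻¹ * ∑ i, dirScore η T (ϑn n) (τ n) (y i)
        - 1 / 2 * ((τ n).ofLp ⬝ᵥ (infoMat f ϑ *ᵥ (τ n).ofLp))) := by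
    refine (Finset.measurable_fun_sum _ fun i _ => ?_).sub
      (((Finset.measurable_fun_sum _ fun i _ => ?_).const_mul _).sub_const _)
    · exact Real.measurable_log.comp (((measurable_rootRatio h.regular _ _).comp
        (measurable_pi_apply i)).pow_const 2)
    · exact (h.measurable_dirScore _ _).comp (measurable_pi_apply i)
  rw [h.sampleLaw_abs_ge_eq hf hY n (hϑn n) hm]
  · simp only [Finset.sum_range]
  · filter_upwards [h.llr_sampleLaw hf n (hϑn n) hn,
      h.inner_centralSeq_ae_eq hf n (hϑn n) (τ n)] with X h1 h2
    rw [h1, h2]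

/-- The central sequence is asymptotically normal. -/
theorem IsRadialRoot.tendstoInDistribution_centralSeq (h : IsRadialRoot k f η T)
    (hf : Measurable f) {ϑ : Param k} (hϑ : ϑ ∈ paramSpace k) {ϑn : ℕ → Param k}
    (hϑn : ∀ n, ϑn n ∈ paramSpace k) (hlim : Tendsto ϑn atTop (𝓝 ϑ))
    [∀ n, IsProbabilityMeasure (sampleLaw f n (ϑn n))] :
    TendstoInDistribution (fun n => centralSeq f n (ϑn n)) atTop id
      (fun n => sampleLaw f n (ϑn n)) (multivariateGaussian 0 (infoMat f ϑ)) where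
  forall_aemeasurable n := h.aemeasurable_centralSeq hf n (hϑn n)
  aemeasurable_limit := aemeasurable_id
  tendsto := by
    refine ProbabilityMeasure.tendsto_iff_tendsto_charFun.2 fun t => ?_
    have hG := h.regular.isProbabilityMeasure_rootLaw (E := EuclideanSpace ℝ (Fin k))
      finrank_euclidean h.pos
    obtain ⟨Ω, _, P, Y, hYm, hYl, hYi, hP⟩ := exists_iid ℕ
      (rootLaw η : Measure (EuclideanSpace ℝ (Fin k)))
    have hY : IsSample Y (rootLaw η) P := ⟨hYm, fun i => (hYl i).map_eq, hYi⟩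
    have hclt := hY.tendsto_integral_exp (h.memLp_dirScore ϑ t) (h.integral_dirScore hϑ t)
      (fun n => h.memLp_dirScore (ϑn n) t) (fun n => h.integral_dirScore (hϑn n) t)
      (h.tendsto_integral_dirScore_sub_sq hϑ hϑn hlim tendsto_const_nhds)
    have hlimit : charFun ((multivariateGaussian 0 (infoMat f ϑ)).map id) t
        = Complex.exp (-(((∫ y, dirScore η T ϑ t y ^ 2 ∂(rootLaw η)) / 2 : ℝ) : ℂ)) := by
      rw [Measure.map_id, charFun_multivariateGaussian (h.posDef_infoMat hϑ).posSemidef,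
        h.integral_dirScore_sq hϑ, inner_zero_right]
      congr 1
      push_cast
      ring
    change Tendsto (fun n => charFun ((sampleLaw f n (ϑn n)).map (centralSeq f n (ϑn n))) t) atTop
      (𝓝 (charFun ((multivariateGaussian 0 (infoMat f ϑ)).map id) t))
    rw [hlimit]
    refine hclt.congr fun n => ?_
    have hm : Measurable fun X : Fin n → EuclideanSpace ℝ (Fin k) =>
        Complex.exp ((((√n)⁻¹ * ∑ i, dirScore η T (ϑn n) t (standardize (ϑn n) (X i)) : ℝ) : ℂ)
          * Complex.I) := by
      refine Complex.measurable_exp.comp ((Complex.measurable_ofReal.comp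
        ((Finset.measurable_fun_sum _ fun i _ => ?_).const_mul _)).mul_const _)
      exact (h.measurable_dirScore _ _).comp
        ((measurable_standardize (hϑn n)).comp (measurable_pi_apply i))
    have hexp : Continuous fun x : Param k => Complex.exp ((inner ℝ x t : ℝ) * Complex.I) := by
      fun_prop
    rw [charFun, integral_map (h.aemeasurable_centralSeq hf n (hϑn n))
      hexp.aestronglyMeasurable]
    have e : (fun X => Complex.exp ((inner ℝ (centralSeq f n (ϑn n) X) t : ℝ) * Complex.I))
        =ᵐ[sampleLaw f n (ϑn n)] fun X => Complex.exp
          ((((√n)⁻¹ * ∑ i, dirScore η T (ϑn n) t (standardize (ϑn n) (X i)) : ℝ) : ℂ)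
            * Complex.I) := by
      filter_upwards [h.inner_centralSeq_ae_eq hf n (hϑn n) t] with X hX
      rw [real_inner_comm, hX]
    rw [integral_congr_ae e, h.sampleLaw_eq_map hf hY n (hϑn n),
      integral_map (measurable_unstandardize_sample hY n (ϑn n)).aemeasurable
        hm.aestronglyMeasurable]
    simp only [standardize_unstandardize (hϑn n), Finset.sum_range]

end LocalAsymptoticNormality

end EllipticalULAN

end

theorem proposition2p1 (k : ℕ) [NeZero k] (f₁ : ℝ → ℝ)
    (hf : IsStandardizedRadialDensity k f₁) (hA1 : AssumptionA1 k f₁) (hA2 : AssumptionA2 k f₁)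
    (ϑ : Param k) (hϑ : ϑ ∈ paramSpace k) :
    (infoMat f₁ ϑ).PosDef ∧
    ∀ ϑn : ℕ → Param k, (∀ n, ϑn n ∈ paramSpace k) →
      (fun n => ϑn n - ϑ) =O[atTop] (fun n : ℕ => (√(n : ℝ))⁻¹) →
      (∀ τ : ℕ → Param k, (∃ C : ℝ, ∀ n, ‖τ n‖ ≤ C) →
        ∀ ε : ℝ, 0 < ε →
          Tendsto (fun n => sampleLaw f₁ n (ϑn n) {X |
              ε ≤ |llr (sampleLaw f₁ n (ϑn n + (√(n : ℝ))⁻¹ • τ n)) (sampleLaw f₁ n (ϑn n)) X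
                - (inner ℝ (τ n) (centralSeq f₁ n (ϑn n) X)
                  - 1 / 2 * ((τ n).ofLp ⬝ᵥ (infoMat f₁ ϑ *ᵥ (τ n).ofLp)))|})
            atTop (𝓝 0)) ∧
      ∃ _ : ∀ n, IsProbabilityMeasure (sampleLaw f₁ n (ϑn n)),
        TendstoInDistribution (fun n => centralSeq f₁ n (ϑn n)) atTop id
          (fun n => sampleLaw f₁ n (ϑn n)) (multivariateGaussian 0 (infoMat f₁ ϑ)) := by
  obtain ⟨η, T, h⟩ := exists_isRadialRoot hf hA1 hA2
  refine ⟨h.posDef_infoMat hϑ, fun ϑn hϑn hO => ?_⟩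
  have hs : Tendsto (fun n : ℕ => (√(n : ℝ))⁻¹) atTop (𝓝 0) :=
    tendsto_inv_atTop_zero.comp (Real.tendsto_sqrt_atTop.comp tendsto_natCast_atTop_atTop)
  have hlim : Tendsto ϑn atTop (𝓝 ϑ) := tendsto_sub_nhds_zero_iff.1 (hO.trans_tendsto hs)
  have hprob : ∀ n, IsProbabilityMeasure (sampleLaw f₁ n (ϑn n)) := fun n =>
    h.isProbabilityMeasure_sampleLaw hf.measurable n (hϑn n)
  exact ⟨fun τ ⟨_, hC⟩ _ hε => h.tendsto_sampleLaw_llr_sub hf.measurable hϑ hϑn hlim hC hε,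
    hprob, h.tendstoInDistribution_centralSeq hf.measurable hϑ hϑn hlim⟩
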